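/- Let $T\ge 20$ be real, let $\mathcal M$ be a set of $R$ distinct integers in $(0,T]$, and for each $m\in\mathcal M$ let $\varepsilon_m\in\mathbb C$ with $|\varepsilon_m|\le 1$. Let $N$ be a positive integer and let $q_1,\dots,q_N\in[0,1]$. Put \[M(s)=\sum_{m\in\mathcal M}\varepsilon_m m^{-s},\qquad Q(s)=\sum_{n\le N}q_n n^{-s},\qquad \mathcal I(\mathcal M,Q)=\int_0^T|M(it)Q(it)|^2\,dt,\] \[\mathcal J(\mathcal M,Q)=\sum_{\substack{m_1,m_2\in\mathcal M,\ 1\le n_1,n_2\le N\\ |\log(m_1n_1/(m_2n_2))|\le 2\pi/T}}q_{n_1}q_{n_2}.\] All implied constants below are absolute, except for a dependence on $\eta$ or $k$ where this is indicated. (i) We have $\mathcal I(\mathcal M,Q)\ll T\,\mathcal J(\mathcal M,Q)$. Moreover, if $\varepsilon_m=1$ for every $m\in\mathcal M$, then $\mathcal I(\mathcal M,Q)\ll T\,\mathcal J(\mathcal M,Q)\ll\mathcal I(\mathcal M,Q)$. (ii) Assume the Lindelöf Hypothesis, that is, $\zeta(\tfrac12+it)\ll_\delta t^{\delta}$ as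 $t\to\infty$ for every $\delta>0$. Then for every $\eta>0$ and every $Q$ as above, \[\mathcal I(\mathcal M,Q)\ll_\eta N^2R^2+(NT)^\eta NRT.\tag{$*$}\] (iii) Unconditionally, for every $\eta>0$ and every $Q$ as above, \[\mathcal I(\mathcal M,Q)\ll_\eta N^2R^2+(NT)^\eta\left(NRT+NR^{7/4}T^{3/4}\right).\] Moreover, $(*)$ holds unconditionally for every $\eta>0$ whenever $N\ge T^{2/3}$ or $R\le T^{1/3}$. (iv) Let $k$ be a positive integer. If \[Q(s)=\frac1{k!}\Bigl(\sum_{N^{1/k}/2<p\le N^{1/k}}p^{-s}\Bigr)^k,\] with $p$ running over primes, then \[\mathcal I(\mathcal M,Q)\ll_k N^2R^2+R^2T+NRT.\] -/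

import Mathlib

/-- The finite Dirichlet polynomial `∑_{n ∈ S} a_n n^{-s}`, for a set `S` of positive integers. -/
noncomputable def dirichletPoly (S : Finset ℕ) (a : ℕ → ℂ) (s : ℂ) : ℂ :=
  ∑ n ∈ S, a n * (n : ℂ) ^ (-s)

/-- `Q(s) = ∑_{n ≤ N} q_n n^{-s}` with real coefficients `q_1, …, q_N`. -/
noncomputable def realDirichletPoly (N : ℕ) (q : ℕ → ℝ) (s : ℂ) : ℂ :=
  dirichletPoly (Finset.Icc 1 N) (fun n => (q n : ℂ)) s

/-- `(1 / k!) (∑ p^{-s})^k`, the sum being over the primes `p` with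
`N^{1/k} / 2 < p ≤ N^{1/k}`. (For `k ≥ 1` all these primes lie in `[1, N]`.) -/
noncomputable def primePowerPoly (N k : ℕ) (s : ℂ) : ℂ :=
  (1 / (k.factorial : ℂ)) *
    (∑ p ∈ (Finset.Icc 1 N).filter (fun p : ℕ => p.Prime ∧
        (N : ℝ) ^ (1 / (k : ℝ)) / 2 < (p : ℝ) ∧ (p : ℝ) ≤ (N : ℝ) ^ (1 / (k : ℝ))),
      (p : ℂ) ^ (-s)) ^ k

/-- The mean value `∫_0^T |M(it) Q(it)|^2 dt`. -/
noncomputable def meanValueI (T : ℝ) (M Q : ℂ → ℂ) : ℝ :=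
  ∫ t in (0 : ℝ)..T, ‖M ((t : ℂ) * Complex.I) * Q ((t : ℂ) * Complex.I)‖ ^ 2

/-- The sum of `q_{n₁} q_{n₂}` over all `m₁, m₂ ∈ S` and `n₁, n₂ ≤ N` such that
`|log (m₁ n₁ / (m₂ n₂))| ≤ 2π / T`. -/
noncomputable def closeSumJ (T : ℝ) (S : Finset ℕ) (N : ℕ) (q : ℕ → ℝ) : ℝ :=
  ∑ m₁ ∈ S, ∑ m₂ ∈ S, ∑ n₁ ∈ Finset.Icc 1 N, ∑ n₂ ∈ Finset.Icc 1 N,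
    if |Real.log (((m₁ : ℝ) * (n₁ : ℝ)) / ((m₂ : ℝ) * (n₂ : ℝ)))| ≤ 2 * Real.pi / T
    then q n₁ * q n₂ else 0

/-- The Lindelöf Hypothesis: `ζ(1/2 + it) = O_δ(t^δ)` as `t → ∞`, for every `δ > 0`. -/
def LindelofHypothesis : Prop :=
  ∀ δ : ℝ, 0 < δ →
    (fun t : ℝ => riemannZeta (1 / 2 + (t : ℂ) * Complex.I)) =O[Filter.atTop]
      (fun t : ℝ => t ^ δ)

/-- The standing assumptions on `T`, on the set `S` of integers in `(0, T]`, and on the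
complex coefficients `ε_m` (`m ∈ S`) of modulus at most `1`. -/
structure IsAdmissible (T : ℝ) (S : Finset ℕ) (ε : ℕ → ℂ) : Prop where
  twenty_le : 20 ≤ T
  pos : ∀ m ∈ S, 0 < m
  le : ∀ m ∈ S, (m : ℝ) ≤ T
  norm_le_one : ∀ m ∈ S, ‖ε m‖ ≤ 1

/-- `N` is a positive integer and `q_1, …, q_N` lie in `[0, 1]`. -/
structure IsUnitWeight (N : ℕ) (q : ℕ → ℝ) : Prop where
  pos : 0 < N
  mem : ∀ n ∈ Finset.Icc 1 N, q n ∈ Set.Icc (0 : ℝ) 1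

/-! The argument rests on comparing mean squares with close pairs. For F(t) = ∑ a_j e^{-iλ_j t},
averaging |F(t-u)|^2 over both t and u replaces the oscillating integral attached to a pair (j,k) by
a nonnegative Fejér-type weight in λ_j - λ_k of width about 1/T. For nonnegative coefficients,
keeping only close pairs gives `closePairSum_le_integral`; for arbitrary ones, the decay of the
weight and a Schur test over bins of length 2π/T give `exists_integral_le_closePairSum`. With
frequencies log m + log n this is (i). Since J is monotone in q, it also allows ε_m to be replaced
by 1 and q by any convenient majorant, at the cost of a constant.

For (ii), q is majorised by a smooth weight of length 2N. Mellin inversion on the line Re z = 1/2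
and the Lindelöf bound give |Q(it)| ≪ N/(1+|t|) + N^{1/2}(1+|t|)^δ. The first term is paired with
|M| ≤ R, the second with the mean value ∫|M|^2 ≪ RT.

For (iii), take q = 1 and write J(N) for the resulting count. Dividing n₁, n₂ by their gcd leads to
reduced fractions. Those of height about 2^j are spaced by at least about 4^{-j} in logarithm, so
each pair (m₁,m₂) meets O(4^j/T + 1) of them. Summed over j, the part 4^j/T gives N²R²/T, and the
rest is governed by min(J(2^{j+1}), R²). Let H be the largest value of min(J(2^j), R²)/(R 2^j),
attained at X = 2^j. Cauchy–Schwarz and the divisor bound give J(X)² ≪ T^{o(1)} R J(X²). The dyadic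
estimate for J(X²) again involves H, so the inequality closes on itself: H² ≪ T^{o(1)}(X²R/T + H).
As HX ≤ R, this forces H ≪ T^{o(1)}(1 + (R³/T)^{1/4}), the source of the term R^{7/4}T^{3/4}.

For (iv), M times the k-th power of a prime sum B is expanded over k-tuples of primes. A close pair
of tuples with no common prime gives a reduced fraction, counted by spacing. A common prime can be
cancelled, which leaves the problem with k-1 factors and costs |P|, the number of primes. Writing
I_k = ∫|M B^k|², one gets I_k ≪ (spacing term) + |P| I_{k-1}. A pointwise Young inequality absorbs
the last term into I_k/2 + O(|P|^k I_0), where |P|^k ≤ N and I_0 ≪ RT. -/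

/-! ### Mean squares of exponential sums and close pairs of frequencies. -/

/-- The exponential sum `∑_{j ∈ s} a_j e^{-i λ_j t}`. -/
noncomputable def expSum {ι : Type*} (s : Finset ι) (a : ι → ℂ) (lam : ι → ℝ) (t : ℝ) : ℂ :=
  ∑ j ∈ s, a j * Complex.exp (-((lam j * t : ℝ) : ℂ) * Complex.I)

/-- The sum of `b_j b_k` over all pairs with `|λ_j - λ_k| ≤ δ`. -/
noncomputable def closePairSum {ι : Type*} (s : Finset ι) (b lam : ι → ℝ) (δ : ℝ) : ℝ :=
  ∑ j ∈ s, ∑ k ∈ s, if |lam j - lam k| ≤ δ then b j * b k else 0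

/-- The integral `∫_0^L e^{ixt} dt`. -/
noncomputable def expIntegral (L x : ℝ) : ℂ :=
  ∫ t in (0 : ℝ)..L, Complex.exp (((x * t : ℝ) : ℂ) * Complex.I)

theorem continuous_expSum {ι : Type*} (s : Finset ι) (a : ι → ℂ) (lam : ι → ℝ) :
    Continuous (expSum s a lam) := by
  unfold expSum
  fun_prop

theorem expSum_mul_conj {ι : Type*} (s : Finset ι) (a : ι → ℂ) (lam : ι → ℝ) (t u : ℝ) :
    ((‖expSum s a lam (t - u)‖ ^ 2 : ℝ) : ℂ) = ∑ j ∈ s, ∑ k ∈ s,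
      a j * (starRingEnd ℂ) (a k) *
        (Complex.exp (((lam j - lam k) * u : ℝ) * Complex.I) *
          (starRingEnd ℂ) (Complex.exp (((lam j - lam k) * t : ℝ) * Complex.I))) := by
  push_cast
  rw [← Complex.mul_conj']
  unfold expSum
  rw [map_sum, Finset.sum_mul_sum]
  refine Finset.sum_congr rfl fun j _ => Finset.sum_congr rfl fun k _ => ?_
  rw [map_mul, ← Complex.exp_conj, ← Complex.exp_conj, ← Complex.exp_add]
  rw [mul_mul_mul_comm, ← Complex.exp_add]
  congr 2
  simp only [map_mul, map_neg, Complex.conj_ofReal, Complex.conj_I, Complex.ofReal_mul,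
    Complex.ofReal_sub, map_sub]
  ring

/-- The integrand attached to a pair of frequencies factors into a function of u times the conjugate
of the same function of t. The double average therefore weights each pair by a squared modulus,
which is nonnegative; a single integral over t would not have this positivity. -/
theorem integral_integral_normSq_expSum {ι : Type*} (s : Finset ι) (a : ι → ℂ) (lam : ι → ℝ)
    (L : ℝ) :
    ((∫ u in (0 : ℝ)..L, ∫ t in (0 : ℝ)..L, ‖expSum s a lam (t - u)‖ ^ 2 : ℝ) : ℂ) =
      ∑ j ∈ s, ∑ k ∈ s,
        a j * (starRingEnd ℂ) (a k) * ((‖expIntegral L (lam j - lam k)‖ ^ 2 : ℝ) : ℂ) := by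
  have key : ∀ u : ℝ, ((∫ t in (0 : ℝ)..L, ‖expSum s a lam (t - u)‖ ^ 2 : ℝ) : ℂ) =
      ∑ j ∈ s, ∑ k ∈ s, a j * (starRingEnd ℂ) (a k) *
        (Complex.exp (((lam j - lam k) * u : ℝ) * Complex.I) *
          (starRingEnd ℂ) (expIntegral L (lam j - lam k))) := by
    intro u
    rw [← intervalIntegral.integral_ofReal]
    simp_rw [expSum_mul_conj]
    rw [intervalIntegral.integral_finsetSum]
    · refine Finset.sum_congr rfl fun j _ => ?_
      rw [intervalIntegral.integral_finsetSum]
      · refine Finset.sum_congr rfl fun k _ => ?_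
        rw [intervalIntegral.integral_const_mul, intervalIntegral.integral_const_mul,
          expIntegral]
        congr 2
        simp only [intervalIntegral, integral_conj, map_sub]
      · intro k _
        apply Continuous.intervalIntegrable
        fun_prop
    · intro j _
      apply Continuous.intervalIntegrable
      fun_prop
  rw [← intervalIntegral.integral_ofReal]
  simp_rw [key]
  rw [intervalIntegral.integral_finsetSum]
  · refine Finset.sum_congr rfl fun j _ => ?_
    rw [intervalIntegral.integral_finsetSum]
    · refine Finset.sum_congr rfl fun k _ => ?_
      rw [intervalIntegral.integral_const_mul, intervalIntegral.integral_mul_const]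
      congr 1
      rw [Complex.ofReal_pow, ← Complex.mul_conj']
      rfl
    · intro k _
      apply Continuous.intervalIntegrable
      fun_prop
  · intro j _
    apply Continuous.intervalIntegrable
    fun_prop

theorem norm_expIntegral_le {L : ℝ} (hL : 0 ≤ L) (x : ℝ) : ‖expIntegral L x‖ ≤ L := by
  have := intervalIntegral.norm_integral_le_of_norm_le_const (a := 0) (b := L) (C := 1)
    (f := fun t : ℝ => Complex.exp (((x * t : ℝ) : ℂ) * Complex.I))
    (fun t _ => by rw [Complex.norm_exp_ofReal_mul_I])
  simpa [abs_of_nonneg hL, expIntegral] using this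

theorem norm_expIntegral_le_div (L : ℝ) {x : ℝ} (hx : x ≠ 0) : ‖expIntegral L x‖ ≤ 2 / |x| := by
  have hc : ((x : ℂ) * Complex.I) ≠ 0 := by simp [hx]
  have h1 : expIntegral L x = ∫ t in (0 : ℝ)..L, Complex.exp ((x : ℂ) * Complex.I * t) := by
    unfold expIntegral
    congr 1
    ext t
    push_cast
    ring_nf
  rw [h1, integral_exp_mul_complex hc, norm_div, norm_mul, Complex.norm_I, mul_one,
    Complex.norm_real, Real.norm_eq_abs]
  gcongr
  refine (norm_sub_le _ _).trans ?_
  have h2 : (x : ℂ) * Complex.I * (L : ℂ) = ((x * L : ℝ) : ℂ) * Complex.I := by push_cast; ring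
  rw [h2, Complex.norm_exp_ofReal_mul_I]
  norm_num

theorem half_le_norm_expIntegral {L x : ℝ} (hL : 0 ≤ L) (hx : |x| * L ≤ 1) :
    L / 2 ≤ ‖expIntegral L x‖ := by
  refine le_trans ?_ (Complex.re_le_norm _)
  have h1 : (expIntegral L x).re = ∫ t in (0 : ℝ)..L, Real.cos (x * t) := by
    unfold expIntegral
    have := Complex.reCLM.intervalIntegral_comp_comm (a := 0) (b := L) (μ := MeasureTheory.volume)
      (f := fun t : ℝ => Complex.exp (((x * t : ℝ) : ℂ) * Complex.I))
      (by apply Continuous.intervalIntegrable; fun_prop)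
    rw [Complex.reCLM_apply] at this
    rw [← this]
    congr 1
    ext t
    rw [Complex.reCLM_apply, Complex.exp_ofReal_mul_I_re]
  rw [h1]
  have h2 : ∫ t in (0 : ℝ)..L, (1 / 2 : ℝ) = L / 2 := by simp; ring
  rw [← h2]
  refine intervalIntegral.integral_mono_on hL (by simp) ?_ fun t ht => ?_
  · apply Continuous.intervalIntegrable
    fun_prop
  · have h3 := Real.one_sub_sq_div_two_le_cos (x := x * t)
    have h4 : |x * t| ≤ 1 := by
      rw [abs_mul, abs_of_nonneg ht.1]
      exact (mul_le_mul_of_nonneg_left ht.2 (abs_nonneg x)).trans hx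
    have h5 : (x * t) ^ 2 ≤ 1 := by
      rw [← sq_abs]
      exact pow_le_one₀ (abs_nonneg _) h4
    linarith

theorem closePairSum_nonneg {ι : Type*} {s : Finset ι} {b : ι → ℝ} (hb : ∀ j ∈ s, 0 ≤ b j)
    (lam : ι → ℝ) (δ : ℝ) : 0 ≤ closePairSum s b lam δ := by
  refine Finset.sum_nonneg fun j hj => Finset.sum_nonneg fun k hk => ?_
  split_ifs
  · exact mul_nonneg (hb j hj) (hb k hk)
  · exact le_rfl

/-- The number of close pairs is controlled from above by the mean square. -/
theorem closePairSum_le_integral {ι : Type*} (s : Finset ι) (b lam : ι → ℝ)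
    (hb : ∀ j ∈ s, 0 ≤ b j) {T : ℝ} (hT : 0 < T) :
    T * closePairSum s b lam (2 * Real.pi / T) ≤
      64 * ∫ t in (0 : ℝ)..T, ‖expSum s (fun j => (b j : ℂ)) lam t‖ ^ 2 := by
  set F := expSum s (fun j => (b j : ℂ)) lam with hF
  -- With L = T/8, close pairs satisfy |λ_j - λ_k| L ≤ π/4 ≤ 1, so their weight is at least L²/4,
  -- while t - u stays inside [-T, T].
  set L := T / 8 with hL
  have hL0 : 0 < L := by positivity
  have hcont : Continuous fun t => ‖F t‖ ^ 2 := (continuous_expSum _ _ _).norm.pow 2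
  -- Real coefficients make |F| even, so the window [-T, T] costs only a factor 2.
  have heven : ∀ t, ‖F (-t)‖ = ‖F t‖ := by
    intro t
    rw [← Complex.norm_conj (F t)]
    congr 1
    simp only [hF, expSum, map_sum, map_mul, Complex.conj_ofReal, ← Complex.exp_conj, map_neg,
      Complex.conj_I]
    refine Finset.sum_congr rfl fun j _ => ?_
    push_cast
    ring_nf
  have hsym : ∫ t in (-T)..T, ‖F t‖ ^ 2 = 2 * ∫ t in (0 : ℝ)..T, ‖F t‖ ^ 2 := by
    rw [← intervalIntegral.integral_add_adjacent_intervals (b := 0)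
      (hcont.intervalIntegrable _ _) (hcont.intervalIntegrable _ _)]
    have : ∫ t in (-T)..0, ‖F t‖ ^ 2 = ∫ t in (0 : ℝ)..T, ‖F t‖ ^ 2 := by
      have h := intervalIntegral.integral_comp_neg (a := 0) (b := T) (fun t => ‖F t‖ ^ 2)
      rw [neg_zero] at h
      rw [← h]
      simp_rw [heven]
    rw [this]
    ring
  have hupper : ∫ u in (0 : ℝ)..L, ∫ t in (0 : ℝ)..L, ‖F (t - u)‖ ^ 2 ≤
      L * (2 * ∫ t in (0 : ℝ)..T, ‖F t‖ ^ 2) := by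
    rw [← hsym]
    have h2 : ∫ u in (0 : ℝ)..L, (∫ t in (-T)..T, ‖F t‖ ^ 2) =
        L * ∫ t in (-T)..T, ‖F t‖ ^ 2 := by simp
    rw [← h2]
    refine intervalIntegral.integral_mono_on hL0.le ?_ (by simp) fun u hu => ?_
    · apply Continuous.intervalIntegrable
      apply intervalIntegral.continuous_parametric_intervalIntegral_of_continuous'
      exact hcont.comp (by fun_prop)
    · rw [intervalIntegral.integral_comp_sub_right (fun t => ‖F t‖ ^ 2)]
      refine intervalIntegral.integral_mono_interval ?_ ?_ ?_ ?_
        (hcont.intervalIntegrable _ _)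
      · linarith [hu.2]
      · linarith
      · linarith [hu.1]
      · exact Filter.Eventually.of_forall fun t => by positivity
  have hexp := integral_integral_normSq_expSum s (fun j => (b j : ℂ)) lam L
  rw [← hF] at hexp
  have hexp' : ∫ u in (0 : ℝ)..L, ∫ t in (0 : ℝ)..L, ‖F (t - u)‖ ^ 2 =
      ∑ j ∈ s, ∑ k ∈ s, b j * b k * ‖expIntegral L (lam j - lam k)‖ ^ 2 := by
    have : ((∫ u in (0 : ℝ)..L, ∫ t in (0 : ℝ)..L, ‖F (t - u)‖ ^ 2 : ℝ) : ℂ) =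
      ((∑ j ∈ s, ∑ k ∈ s, b j * b k * ‖expIntegral L (lam j - lam k)‖ ^ 2 : ℝ) : ℂ) := by
      rw [hexp]
      push_cast
      simp only [Complex.conj_ofReal]
    exact_mod_cast this
  have hlower : (L ^ 2 / 4) * closePairSum s b lam (2 * Real.pi / T) ≤
      ∑ j ∈ s, ∑ k ∈ s, b j * b k * ‖expIntegral L (lam j - lam k)‖ ^ 2 := by
    unfold closePairSum
    rw [Finset.mul_sum]
    refine Finset.sum_le_sum fun j hj => ?_
    rw [Finset.mul_sum]
    refine Finset.sum_le_sum fun k hk => ?_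
    have hbb := mul_nonneg (hb j hj) (hb k hk)
    split_ifs with hd
    · have h1 : L / 2 ≤ ‖expIntegral L (lam j - lam k)‖ := by
        refine half_le_norm_expIntegral hL0.le ?_
        calc |lam j - lam k| * L ≤ 2 * Real.pi / T * L := by gcongr
          _ = Real.pi / 4 := by rw [hL]; field_simp; norm_num
          _ ≤ 1 := by linarith [Real.pi_le_four]
      have h2 : L ^ 2 / 4 ≤ ‖expIntegral L (lam j - lam k)‖ ^ 2 := by
        calc L ^ 2 / 4 = (L / 2) ^ 2 := by ring
          _ ≤ _ := by gcongr
      rw [mul_comm]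
      gcongr
    · rw [mul_zero]
      positivity
  have h3 := hlower.trans (hexp'.symm.le.trans hupper)
  have h4 : L ^ 2 / 4 * closePairSum s b lam (2 * Real.pi / T) =
    L * (L / 4 * closePairSum s b lam (2 * Real.pi / T)) := by ring
  rw [h4] at h3
  have h5 := le_of_mul_le_mul_left h3 hL0
  rw [hL] at h5
  linarith

theorem exists_sum_inv_one_add_sq_le : ∃ C : ℝ, 0 < C ∧ ∀ (B : Finset ℤ) (r : ℤ),
    ∑ r' ∈ B, 1 / (1 + ((r - r' : ℤ) : ℝ) ^ 2) ≤ C := by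
  have hs : Summable fun d : ℤ => 1 / (1 + (d : ℝ) ^ 2) := by
    have h := (Real.summable_one_div_int_pow (p := 2)).mpr (by norm_num)
    refine Summable.of_norm_bounded_eventually (g := fun d : ℤ => 1 / (d : ℝ) ^ 2) h ?_
    have : ∀ᶠ d : ℤ in Filter.cofinite, d ≠ 0 := by
      rw [Filter.eventually_cofinite]
      simp
    filter_upwards [this] with d hd
    have hd' : (0 : ℝ) < (d : ℝ) ^ 2 := by positivity
    rw [Real.norm_of_nonneg (by positivity)]
    exact one_div_le_one_div_of_le hd' (by linarith)
  refine ⟨∑' d : ℤ, 1 / (1 + (d : ℝ) ^ 2) + 1, ?_, fun B r => ?_⟩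
  · have : 0 ≤ ∑' d : ℤ, 1 / (1 + (d : ℝ) ^ 2) := tsum_nonneg fun d => by positivity
    linarith
  · have hinj : Function.Injective fun r' : ℤ => r - r' := sub_right_injective
    have h1 : ∑ r' ∈ B, 1 / (1 + ((r - r' : ℤ) : ℝ) ^ 2) =
        ∑ d ∈ B.map ⟨fun r' : ℤ => r - r', hinj⟩, 1 / (1 + (d : ℝ) ^ 2) := by
      rw [Finset.sum_map]
      rfl
    rw [h1]
    have := hs.sum_le_tsum (B.map ⟨fun r' : ℤ => r - r', hinj⟩) fun d _ => by positivity
    linarith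

/-- Schur's test on bins: with S_x the total weight in bin x, bound S_x S_y by (S_x² + S_y²)/2 and
use that the row sums of φ are at most C. -/
theorem sum_mul_kernel_le {ι : Type*} (s : Finset ι) (b : ι → ℝ) (r : ι → ℤ) (φ : ℤ → ℝ)
    (hφ : ∀ d, 0 ≤ φ d) (heven : ∀ d, φ (-d) = φ d) {C : ℝ}
    (hC : ∀ (B : Finset ℤ) (x : ℤ), ∑ x' ∈ B, φ (x - x') ≤ C) :
    ∑ j ∈ s, ∑ k ∈ s, b j * b k * φ (r j - r k) ≤
      C * ∑ j ∈ s, ∑ k ∈ s, if r j = r k then b j * b k else 0 := by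
  classical
  set B := s.image r
  set S : ℤ → ℝ := fun x => ∑ j ∈ s with r j = x, b j with hS
  have hmaps : ∀ j ∈ s, r j ∈ B := fun j hj => Finset.mem_image_of_mem r hj
  have hfib : ∀ f : ι → ℝ, ∑ x ∈ B, ∑ j ∈ s with r j = x, f j = ∑ j ∈ s, f j :=
    fun f => Finset.sum_fiberwise_of_maps_to hmaps f
  have h1 : ∑ j ∈ s, ∑ k ∈ s, b j * b k * φ (r j - r k) =
      ∑ x ∈ B, ∑ y ∈ B, S x * S y * φ (x - y) := by
    rw [← hfib]
    refine Finset.sum_congr rfl fun x _ => ?_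
    have : ∀ j ∈ s.filter (fun j => r j = x), ∑ k ∈ s, b j * b k * φ (r j - r k) =
        ∑ y ∈ B, b j * S y * φ (x - y) := by
      intro j hj
      rw [← hfib]
      refine Finset.sum_congr rfl fun y _ => ?_
      rw [hS, Finset.mul_sum, Finset.sum_mul]
      refine Finset.sum_congr rfl fun k hk => ?_
      rw [(Finset.mem_filter.mp hj).2, (Finset.mem_filter.mp hk).2]
    rw [Finset.sum_congr rfl this, Finset.sum_comm]
    refine Finset.sum_congr rfl fun y _ => ?_
    rw [← Finset.sum_mul, ← Finset.sum_mul]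
  have h2 : ∑ j ∈ s, ∑ k ∈ s, (if r j = r k then b j * b k else 0) = ∑ x ∈ B, S x ^ 2 := by
    rw [← hfib]
    refine Finset.sum_congr rfl fun x _ => ?_
    have : ∀ j ∈ s.filter (fun j => r j = x),
        ∑ k ∈ s, (if r j = r k then b j * b k else 0) = b j * S x := by
      intro j hj
      rw [hS, Finset.mul_sum, Finset.sum_filter, (Finset.mem_filter.mp hj).2]
      simp only [eq_comm]
    rw [Finset.sum_congr rfl this, ← Finset.sum_mul, sq]
  rw [h1, h2]
  have h3 : ∑ x ∈ B, ∑ y ∈ B, S x * S y * φ (x - y) ≤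
      ∑ x ∈ B, ∑ y ∈ B, (S x ^ 2 * φ (x - y) / 2 + S y ^ 2 * φ (x - y) / 2) := by
    refine Finset.sum_le_sum fun x _ => Finset.sum_le_sum fun y _ => ?_
    nlinarith [mul_nonneg (sq_nonneg (S x - S y)) (hφ (x - y))]
  have h4 : ∑ x ∈ B, ∑ y ∈ B, S y ^ 2 * φ (x - y) / 2 =
      ∑ x ∈ B, ∑ y ∈ B, S x ^ 2 * φ (x - y) / 2 := by
    rw [Finset.sum_comm]
    refine Finset.sum_congr rfl fun x _ => Finset.sum_congr rfl fun y _ => ?_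
    rw [← heven, neg_sub]
  have h5 : ∑ x ∈ B, ∑ y ∈ B, S x ^ 2 * φ (x - y) / 2 ≤ ∑ x ∈ B, C * S x ^ 2 / 2 := by
    refine Finset.sum_le_sum fun x _ => ?_
    rw [← Finset.sum_div, ← Finset.mul_sum, mul_comm C]
    gcongr
    exact hC B x
  simp_rw [Finset.sum_add_distrib] at h3
  rw [h4] at h3
  have h6 : ∑ x ∈ B, C * S x ^ 2 / 2 = C * (∑ x ∈ B, S x ^ 2) / 2 := by
    rw [Finset.mul_sum, Finset.sum_div]
  linarith

/-- If the bin indices differ by at most 1, the trivial bound 2T suffices. If they differ by d with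
|d| ≥ 2, then |u - v| ≥ π|d|/T, and the bound 2/|u - v| supplies the decay in d. -/
theorem normSq_expIntegral_le {T : ℝ} (hT : 0 < T) (u v : ℝ) :
    ‖expIntegral (2 * T) (u - v)‖ ^ 2 ≤
      16 * T ^ 2 * (1 / (1 +
        ((⌊u * (T / (2 * Real.pi))⌋ - ⌊v * (T / (2 * Real.pi))⌋ : ℤ) : ℝ) ^ 2)) := by
  set c := T / (2 * Real.pi) with hc
  have hc0 : 0 < c := by positivity
  set d : ℤ := ⌊u * c⌋ - ⌊v * c⌋ with hd
  have h1 := Int.floor_le (u * c)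
  have h2 := Int.lt_floor_add_one (u * c)
  have h3 := Int.floor_le (v * c)
  have h4 := Int.lt_floor_add_one (v * c)
  have hdR : (d : ℝ) = (⌊u * c⌋ : ℝ) - (⌊v * c⌋ : ℝ) := by rw [hd]; push_cast; ring
  have hxd : |(d : ℝ)| - 1 ≤ |u - v| * c := by
    have : |(d : ℝ) - (u - v) * c| ≤ 1 := by
      rw [abs_le]
      constructor <;> rw [hdR] <;> linarith
    have h5 := abs_sub_abs_le_abs_sub (d : ℝ) ((u - v) * c)
    rw [abs_mul, abs_of_pos hc0] at h5
    linarith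
  rw [mul_one_div]
  by_cases hdd : |d| ≤ 1
  · have h5 : (d : ℝ) ^ 2 ≤ 1 := by
      have : |(d : ℝ)| ≤ 1 := by exact_mod_cast hdd
      rw [← sq_abs]
      exact pow_le_one₀ (abs_nonneg _) this
    have h6 := norm_expIntegral_le (L := 2 * T) (by linarith) (u - v)
    rw [le_div_iff₀ (by positivity)]
    have h7 : ‖expIntegral (2 * T) (u - v)‖ ^ 2 ≤ (2 * T) ^ 2 := by gcongr
    nlinarith [sq_nonneg T, sq_nonneg ‖expIntegral (2 * T) (u - v)‖]
  · have h2d : (2 : ℝ) ≤ |(d : ℝ)| := by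
      have : 2 ≤ |d| := by omega
      exact_mod_cast this
    have h5 : |(d : ℝ)| / 2 ≤ |u - v| * c := by linarith
    have hx0 : 0 < |u - v| := by
      by_contra h
      have : |u - v| = 0 := le_antisymm (not_lt.mp h) (abs_nonneg _)
      rw [this] at h5
      linarith
    have h6 := norm_expIntegral_le_div (2 * T) (abs_pos.mp hx0)
    have h7 : 2 / |u - v| ≤ 2 * T / |(d : ℝ)| := by
      rw [div_le_div_iff₀ hx0 (by linarith)]
      have h8 : |u - v| * c ≤ |u - v| * T / 2 := by
        rw [hc, mul_div_assoc]
        gcongr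
        nlinarith [Real.pi_gt_three]
      linarith
    have h8 : ‖expIntegral (2 * T) (u - v)‖ ^ 2 ≤ (2 * T / |(d : ℝ)|) ^ 2 :=
      pow_le_pow_left₀ (norm_nonneg _) (h6.trans h7) 2
    refine h8.trans ?_
    rw [div_pow, sq_abs]
    have h9 : (4 : ℝ) ≤ (d : ℝ) ^ 2 := by
      rw [← sq_abs]
      nlinarith
    rw [div_le_div_iff₀ (by linarith) (by linarith)]
    nlinarith [sq_nonneg T]

/-- The mean square is controlled from above by the number of close pairs. -/
theorem exists_integral_le_closePairSum : ∃ C : ℝ, 0 < C ∧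
    ∀ {ι : Type} (s : Finset ι) (a : ι → ℂ) (lam : ι → ℝ) (T : ℝ), 0 < T →
      ∫ t in (0 : ℝ)..T, ‖expSum s a lam t‖ ^ 2 ≤
        C * (T * closePairSum s (fun j => ‖a j‖) lam (2 * Real.pi / T)) := by
  obtain ⟨C, hC0, hC⟩ := exists_sum_inv_one_add_sq_le
  refine ⟨16 * C, by positivity, ?_⟩
  intro ι s a lam T hT
  set F := expSum s a lam with hF
  have hcont : Continuous fun t => ‖F t‖ ^ 2 := (continuous_expSum _ _ _).norm.pow 2
  -- For 0 ≤ u ≤ T the shifted window [-u, 2T - u] contains [0, T].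
  have hlower : T * ∫ t in (0 : ℝ)..T, ‖F t‖ ^ 2 ≤
      ∫ u in (0 : ℝ)..(2 * T), ∫ t in (0 : ℝ)..(2 * T), ‖F (t - u)‖ ^ 2 := by
    have hc2 : Continuous fun u => ∫ t in (0 : ℝ)..(2 * T), ‖F (t - u)‖ ^ 2 := by
      apply intervalIntegral.continuous_parametric_intervalIntegral_of_continuous'
      exact hcont.comp (by fun_prop)
    calc T * ∫ t in (0 : ℝ)..T, ‖F t‖ ^ 2
        = ∫ u in (0 : ℝ)..T, (∫ t in (0 : ℝ)..T, ‖F t‖ ^ 2) := by simp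
      _ ≤ ∫ u in (0 : ℝ)..T, ∫ t in (0 : ℝ)..(2 * T), ‖F (t - u)‖ ^ 2 := by
        refine intervalIntegral.integral_mono_on hT.le (by simp)
          (hc2.intervalIntegrable _ _) fun u hu => ?_
        rw [intervalIntegral.integral_comp_sub_right (fun t => ‖F t‖ ^ 2)]
        refine intervalIntegral.integral_mono_interval ?_ hT.le ?_ ?_
          (hcont.intervalIntegrable _ _)
        · linarith [hu.1]
        · linarith [hu.2]
        · exact Filter.Eventually.of_forall fun t => by positivity
      _ ≤ _ := by
        refine intervalIntegral.integral_mono_interval le_rfl hT.le (by linarith) ?_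
          (hc2.intervalIntegrable _ _)
        exact Filter.Eventually.of_forall fun u =>
          intervalIntegral.integral_nonneg (by linarith) fun t _ => by positivity
  have hexp := integral_integral_normSq_expSum s a lam (2 * T)
  rw [← hF] at hexp
  have hupper : ∫ u in (0 : ℝ)..(2 * T), ∫ t in (0 : ℝ)..(2 * T), ‖F (t - u)‖ ^ 2 ≤
      ∑ j ∈ s, ∑ k ∈ s, ‖a j‖ * ‖a k‖ * ‖expIntegral (2 * T) (lam j - lam k)‖ ^ 2 := by
    refine (le_abs_self _).trans ?_
    rw [← Real.norm_eq_abs, ← Complex.norm_real, hexp]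
    refine (norm_sum_le _ _).trans (Finset.sum_le_sum fun j _ => ?_)
    refine (norm_sum_le _ _).trans (Finset.sum_le_sum fun k _ => ?_)
    rw [norm_mul, norm_mul, Complex.norm_conj, Complex.norm_real, Real.norm_of_nonneg (by positivity)]
  -- Bins have length 2π/T, so two frequencies in the same bin form a close pair.
  set r : ι → ℤ := fun j => ⌊lam j * (T / (2 * Real.pi))⌋ with hr
  set φ : ℤ → ℝ := fun d => 1 / (1 + (d : ℝ) ^ 2) with hφ
  have hker := sum_mul_kernel_le s (fun j => ‖a j‖) r φ (fun d => by positivity)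
    (fun d => by simp [hφ]) hC
  have h1 : ∑ j ∈ s, ∑ k ∈ s, ‖a j‖ * ‖a k‖ * ‖expIntegral (2 * T) (lam j - lam k)‖ ^ 2 ≤
      16 * T ^ 2 * ∑ j ∈ s, ∑ k ∈ s, ‖a j‖ * ‖a k‖ * φ (r j - r k) := by
    rw [Finset.mul_sum]
    refine Finset.sum_le_sum fun j _ => ?_
    rw [Finset.mul_sum]
    refine Finset.sum_le_sum fun k _ => ?_
    have := normSq_expIntegral_le hT (lam j) (lam k)
    calc _ ≤ ‖a j‖ * ‖a k‖ * (16 * T ^ 2 * φ (r j - r k)) := by gcongr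
      _ = _ := by ring
  have h2 : ∑ j ∈ s, ∑ k ∈ s, (if r j = r k then ‖a j‖ * ‖a k‖ else 0) ≤
      closePairSum s (fun j => ‖a j‖) lam (2 * Real.pi / T) := by
    refine Finset.sum_le_sum fun j _ => Finset.sum_le_sum fun k _ => ?_
    by_cases hjk : r j = r k
    · have h3 := (Int.abs_sub_lt_one_of_floor_eq_floor hjk).le
      rw [← sub_mul, abs_mul, abs_of_pos (by positivity : 0 < T / (2 * Real.pi)),
        ← le_div_iff₀ (by positivity), one_div_div] at h3
      rw [if_pos hjk, if_pos h3]
    · rw [if_neg hjk]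
      split_ifs <;> positivity
  have h3 : T * ∫ t in (0 : ℝ)..T, ‖F t‖ ^ 2 ≤
      T * (16 * C * (T * closePairSum s (fun j => ‖a j‖) lam (2 * Real.pi / T))) := by
    calc _ ≤ _ := hlower.trans (hupper.trans h1)
      _ ≤ 16 * T ^ 2 * (C * closePairSum s (fun j => ‖a j‖) lam (2 * Real.pi / T)) := by
        gcongr
        exact hker.trans (mul_le_mul_of_nonneg_left h2 hC0.le)
      _ = _ := by ring
  exact le_of_mul_le_mul_left h3 hT

theorem closePairSum_mono {ι : Type*} {s : Finset ι} {b b' : ι → ℝ} (lam : ι → ℝ) (δ : ℝ)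
    (hb : ∀ j ∈ s, 0 ≤ b j) (hbb : ∀ j ∈ s, b j ≤ b' j) :
    closePairSum s b lam δ ≤ closePairSum s b' lam δ := by
  refine Finset.sum_le_sum fun j hj => Finset.sum_le_sum fun k hk => ?_
  split_ifs
  · exact mul_le_mul (hbb j hj) (hbb k hk) (hb k hk) ((hb j hj).trans (hbb j hj))
  · exact le_rfl

/-! ### Dirichlet polynomials as exponential sums, and part (i). -/

theorem expSum_mul_expSum {ι κ : Type*} (s : Finset ι) (s' : Finset κ) (a : ι → ℂ) (a' : κ → ℂ)
    (lam : ι → ℝ) (lam' : κ → ℝ) (t : ℝ) :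
    expSum s a lam t * expSum s' a' lam' t =
      expSum (s ×ˢ s') (fun p => a p.1 * a' p.2) (fun p => lam p.1 + lam' p.2) t := by
  unfold expSum
  rw [Finset.sum_mul_sum, Finset.sum_product]
  refine Finset.sum_congr rfl fun j _ => Finset.sum_congr rfl fun k _ => ?_
  rw [mul_mul_mul_comm, ← Complex.exp_add]
  congr 2
  push_cast
  ring

theorem natCast_cpow_neg_mul_I {n : ℕ} (hn : 0 < n) (t : ℝ) :
    (n : ℂ) ^ (-((t : ℂ) * Complex.I)) =
      Complex.exp (-((Real.log n * t : ℝ) : ℂ) * Complex.I) := by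
  rw [Complex.cpow_def_of_ne_zero (by exact_mod_cast hn.ne'), ← Complex.natCast_log]
  congr 1
  push_cast
  ring

theorem dirichletPoly_eq_expSum {S : Finset ℕ} (hS : ∀ m ∈ S, 0 < m) (a : ℕ → ℂ) (t : ℝ) :
    dirichletPoly S a (t * Complex.I) = expSum S a (fun n => Real.log n) t :=
  Finset.sum_congr rfl fun n hn => by rw [natCast_cpow_neg_mul_I (hS n hn)]

theorem realDirichletPoly_eq_expSum (N : ℕ) (q : ℕ → ℝ) (t : ℝ) :
    realDirichletPoly N q (t * Complex.I) =
      expSum (Finset.Icc 1 N) (fun n => (q n : ℂ)) (fun n => Real.log n) t :=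
  dirichletPoly_eq_expSum (fun _ hn => (Finset.mem_Icc.mp hn).1) _ t

theorem meanValueI_eq_integral_expSum {S : Finset ℕ} (hS : ∀ m ∈ S, 0 < m) (ε : ℕ → ℂ) (N : ℕ)
    (q : ℕ → ℝ) (T : ℝ) :
    meanValueI T (dirichletPoly S ε) (realDirichletPoly N q) =
      ∫ t in (0 : ℝ)..T, ‖expSum (S ×ˢ Finset.Icc 1 N) (fun p => ε p.1 * (q p.2 : ℂ))
        (fun p => Real.log p.1 + Real.log p.2) t‖ ^ 2 := by
  unfold meanValueI
  simp_rw [dirichletPoly_eq_expSum hS, realDirichletPoly_eq_expSum, expSum_mul_expSum]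

theorem closeSumJ_eq_closePairSum {S : Finset ℕ} (hS : ∀ m ∈ S, 0 < m) (N : ℕ) (q : ℕ → ℝ)
    (T : ℝ) :
    closeSumJ T S N q = closePairSum (S ×ˢ Finset.Icc 1 N) (fun p => q p.2)
      (fun p => Real.log p.1 + Real.log p.2) (2 * Real.pi / T) := by
  unfold closeSumJ closePairSum
  rw [Finset.sum_product]
  refine Finset.sum_congr rfl fun m₁ hm₁ => ?_
  rw [Finset.sum_comm]
  refine Finset.sum_congr rfl fun n₁ hn₁ => ?_
  rw [Finset.sum_product]
  refine Finset.sum_congr rfl fun m₂ hm₂ => Finset.sum_congr rfl fun n₂ hn₂ => ?_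
  have h : ∀ {n : ℕ}, n ∈ Finset.Icc 1 N → (n : ℝ) ≠ 0 := fun hn => by
    have := (Finset.mem_Icc.mp hn).1
    positivity
  have h' : ∀ {m : ℕ}, m ∈ S → (m : ℝ) ≠ 0 := fun hm => by exact_mod_cast (hS _ hm).ne'
  rw [Real.log_div (mul_ne_zero (h' hm₁) (h hn₁)) (mul_ne_zero (h' hm₂) (h hn₂)),
    Real.log_mul (h' hm₁) (h hn₁), Real.log_mul (h' hm₂) (h hn₂)]

theorem exists_meanValueI_le_closeSumJ : ∃ C : ℝ, 0 < C ∧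
    ∀ (T : ℝ) (S : Finset ℕ) (ε : ℕ → ℂ) (N : ℕ) (q : ℕ → ℝ),
      IsAdmissible T S ε → IsUnitWeight N q →
      meanValueI T (dirichletPoly S ε) (realDirichletPoly N q) ≤ C * (T * closeSumJ T S N q) := by
  obtain ⟨C, hC0, hC⟩ := exists_integral_le_closePairSum
  refine ⟨C, hC0, fun T S ε N q hS hq => ?_⟩
  have hT : 0 < T := by linarith [hS.twenty_le]
  rw [meanValueI_eq_integral_expSum hS.pos, closeSumJ_eq_closePairSum hS.pos]
  refine (hC _ _ _ T hT).trans ?_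
  gcongr
  refine closePairSum_mono _ _ (fun _ _ => norm_nonneg _) fun p hp => ?_
  obtain ⟨h1, h2⟩ := Finset.mem_product.mp hp
  have h3 := (hq.mem _ h2).1
  rw [norm_mul, Complex.norm_real, Real.norm_of_nonneg h3]
  exact mul_le_of_le_one_left h3 (hS.norm_le_one _ h1)

theorem closeSumJ_le_meanValueI {T : ℝ} {S : Finset ℕ} {ε : ℕ → ℂ} {N : ℕ} {q : ℕ → ℝ}
    (hS : IsAdmissible T S ε) (hq : ∀ n ∈ Finset.Icc 1 N, 0 ≤ q n) (hε : ∀ m ∈ S, ε m = 1) :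
    T * closeSumJ T S N q ≤ 64 * meanValueI T (dirichletPoly S ε) (realDirichletPoly N q) := by
  have hT : 0 < T := by linarith [hS.twenty_le]
  rw [meanValueI_eq_integral_expSum hS.pos, closeSumJ_eq_closePairSum hS.pos]
  refine (closePairSum_le_integral _ _ _ (fun p hp =>
    hq _ (Finset.mem_product.mp hp).2) hT).trans_eq ?_
  congr 2
  ext t
  congr 2
  refine Finset.sum_congr rfl fun p hp => ?_
  dsimp only
  rw [hε _ (Finset.mem_product.mp hp).1, one_mul]

theorem closeSumJ_mono {S : Finset ℕ} (hS : ∀ m ∈ S, 0 < m) {N N' : ℕ} (hN : N ≤ N')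
    {q q' : ℕ → ℝ} (hq : ∀ n ∈ Finset.Icc 1 N, 0 ≤ q n ∧ q n ≤ q' n)
    (hq' : ∀ n ∈ Finset.Icc 1 N', 0 ≤ q' n) (T : ℝ) :
    closeSumJ T S N q ≤ closeSumJ T S N' q' := by
  rw [closeSumJ_eq_closePairSum hS, closeSumJ_eq_closePairSum hS]
  refine (closePairSum_mono (b' := fun p : ℕ × ℕ => q' p.2) _ _
    (fun p hp => (hq _ (Finset.mem_product.mp hp).2).1)
    (fun p hp => (hq _ (Finset.mem_product.mp hp).2).2)).trans ?_
  have hsub : S ×ˢ Finset.Icc 1 N ⊆ S ×ˢ Finset.Icc 1 N' :=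
    Finset.product_subset_product_right (Finset.Icc_subset_Icc_right hN)
  have h0 : ∀ j ∈ S ×ˢ Finset.Icc 1 N', ∀ k ∈ S ×ˢ Finset.Icc 1 N',
      0 ≤ if |Real.log j.1 + Real.log j.2 - (Real.log k.1 + Real.log k.2)| ≤ 2 * Real.pi / T
        then q' j.2 * q' k.2 else 0 := by
    intro j hj k hk
    split_ifs
    · exact mul_nonneg (hq' _ (Finset.mem_product.mp hj).2) (hq' _ (Finset.mem_product.mp hk).2)
    · exact le_rfl
  refine (Finset.sum_le_sum fun j hj => Finset.sum_le_sum_of_subset_of_nonneg hsub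
    fun k hk _ => h0 j (hsub hj) k hk).trans ?_
  exact Finset.sum_le_sum_of_subset_of_nonneg hsub
    fun j hj _ => Finset.sum_nonneg fun k hk => h0 j hj k hk

/-! ### Spacing of logarithms of integers and of reduced fractions. -/

/-- Pigeonhole: a cell of length c holds at most one of the points. -/
theorem card_le_of_separated {ι : Type*} (s : Finset ι) (f : ι → ℝ) {c ρ δ : ℝ} (hc : 0 < c)
    (hδ : 0 ≤ δ) (hf : ∀ j ∈ s, |f j - ρ| ≤ δ)
    (hsep : ∀ j ∈ s, ∀ k ∈ s, j ≠ k → c ≤ |f j - f k|) :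
    (s.card : ℝ) ≤ 2 * δ / c + 1 := by
  have hmaps : ∀ j ∈ s, ⌊(f j - ρ + δ) / c⌋₊ ∈ Finset.range (⌊2 * δ / c⌋₊ + 1) := by
    intro j hj
    rw [Finset.mem_range, Nat.lt_add_one_iff]
    apply Nat.floor_le_floor
    have := (abs_le.mp (hf j hj)).2
    gcongr
    linarith
  have hnn : ∀ j ∈ s, 0 ≤ (f j - ρ + δ) / c := fun j hj => by
    have := (abs_le.mp (hf j hj)).1
    apply div_nonneg _ hc.le
    linarith
  have hinj : Set.InjOn (fun j => ⌊(f j - ρ + δ) / c⌋₊) s := by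
    intro j hj k hk hjk
    by_contra hne
    have h1 := hsep j hj k hk hne
    have h2 := Nat.floor_le (hnn j hj)
    have h3 := Nat.lt_floor_add_one ((f j - ρ + δ) / c)
    have h4 := Nat.floor_le (hnn k hk)
    have h5 := Nat.lt_floor_add_one ((f k - ρ + δ) / c)
    simp only at hjk
    rw [hjk] at h2 h3
    have h6 : |(f j - ρ + δ) / c - (f k - ρ + δ) / c| < 1 := by
      rw [abs_lt]
      constructor <;> linarith
    rw [← sub_div, abs_div, abs_of_pos hc, div_lt_one hc] at h6
    have h7 : f j - ρ + δ - (f k - ρ + δ) = f j - f k := by ring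
    rw [h7] at h6
    linarith
  have hcard := Finset.card_le_card_of_injOn _ hmaps hinj
  rw [Finset.card_range] at hcard
  have h1 : (s.card : ℝ) ≤ (⌊2 * δ / c⌋₊ : ℝ) + 1 := by exact_mod_cast hcard
  have h2 := Nat.floor_le (by positivity : 0 ≤ 2 * δ / c)
  linarith

/-- For v < u, log(u/v) ≥ 1 - v/u ≥ 1/u. -/
theorem one_div_le_abs_log_sub_log {u v Y : ℕ} (hu : 0 < u) (hv : 0 < v) (huv : u ≠ v)
    (huY : u ≤ Y) (hvY : v ≤ Y) : 1 / (Y : ℝ) ≤ |Real.log u - Real.log v| := by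
  wlog h : v < u generalizing u v
  · rw [abs_sub_comm]
    exact this hv hu huv.symm hvY huY (lt_of_le_of_ne (not_lt.mp h) huv)
  have hu' : (0 : ℝ) < u := by exact_mod_cast hu
  have hv' : (0 : ℝ) < v := by exact_mod_cast hv
  have huY' : (u : ℝ) ≤ Y := by exact_mod_cast huY
  have h' : (v : ℝ) + 1 ≤ u := by exact_mod_cast h
  refine le_trans ?_ (le_abs_self _)
  have h1 := Real.log_le_sub_one_of_pos (div_pos hv' hu')
  rw [Real.log_div hv'.ne' hu'.ne'] at h1
  have h2 : (v : ℝ) / u ≤ 1 - 1 / u := by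
    rw [le_sub_iff_add_le, ← add_div, div_le_one hu']
    exact h'
  have h3 : 1 / (Y : ℝ) ≤ 1 / u := one_div_le_one_div_of_le hu' huY'
  linarith

/-- Reduced fractions with numerator and denominator at most `X` are well spaced on a
logarithmic scale. -/
theorem card_coprime_close_le (F : Finset (ℕ × ℕ)) {X : ℕ} {ρ δ : ℝ} (hδ : 0 ≤ δ)
    (hX : 0 < X)
    (hF : ∀ p ∈ F, 0 < p.1 ∧ 0 < p.2 ∧ p.1 ≤ X ∧ p.2 ≤ X ∧ p.1.Coprime p.2 ∧
      |Real.log p.1 - Real.log p.2 - ρ| ≤ δ) :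
    (F.card : ℝ) ≤ 2 * δ * (X : ℝ) ^ 2 + 1 := by
  have h := card_le_of_separated F (fun p => Real.log p.1 - Real.log p.2)
    (c := 1 / ((X ^ 2 : ℕ) : ℝ)) (ρ := ρ) (by positivity) hδ
    (fun p hp => (hF p hp).2.2.2.2.2) ?_
  · refine h.trans_eq ?_
    push_cast
    rw [div_div_eq_mul_div, div_one]
  · intro p hp r hr hne
    obtain ⟨p1, p2, p3, p4, p5, -⟩ := hF p hp
    obtain ⟨r1, r2, r3, r4, r5, -⟩ := hF r hr
    -- Distinct reduced fractions have distinct cross products. These are integers at most X², so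
    -- their logarithms differ by at least 1/X².
    have hcross : p.1 * r.2 ≠ r.1 * p.2 := by
      intro heq
      have h1 : p.1 = r.1 := Nat.dvd_antisymm
        (p5.dvd_of_dvd_mul_right (Dvd.intro _ heq))
        (r5.dvd_of_dvd_mul_right (Dvd.intro _ heq.symm))
      have h2 : p.2 = r.2 := by
        rw [h1] at heq
        exact (Nat.eq_of_mul_eq_mul_left r1 heq).symm
      exact hne (Prod.ext h1 h2)
    have h1 := one_div_le_abs_log_sub_log (Nat.mul_pos p1 r2) (Nat.mul_pos r1 p2) hcross
      (Y := X ^ 2) (by rw [sq]; exact Nat.mul_le_mul p3 r4) (by rw [sq]; exact Nat.mul_le_mul r3 p4)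
    refine h1.trans_eq ?_
    have q1 : (p.1 : ℝ) ≠ 0 := by positivity
    have q2 : (p.2 : ℝ) ≠ 0 := by positivity
    have q3 : (r.1 : ℝ) ≠ 0 := by positivity
    have q4 : (r.2 : ℝ) ≠ 0 := by positivity
    push_cast
    rw [Real.log_mul q1 q4, Real.log_mul q3 q2]
    congr 1
    ring

/-- Logarithms of distinct integers up to T are 1/T-separated, so a window of radius 2π/T holds at
most 4π + 1 < 14 of them. -/
theorem closePairSum_log_le {T : ℝ} {S : Finset ℕ} {ε : ℕ → ℂ} (hS : IsAdmissible T S ε) :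
    closePairSum S (fun _ => 1) (fun n => Real.log n) (2 * Real.pi / T) ≤ 14 * S.card := by
  have hT : 0 < T := by linarith [hS.twenty_le]
  have hT1 : 0 < ⌊T⌋₊ := Nat.floor_pos.mpr (by linarith [hS.twenty_le])
  have hTle : (⌊T⌋₊ : ℝ) ≤ T := Nat.floor_le hT.le
  have hmul : (S.card : ℝ) * 14 = ∑ m ∈ S, (14 : ℝ) := by simp
  rw [mul_comm (14 : ℝ), hmul]
  refine Finset.sum_le_sum fun m hm => ?_
  dsimp only
  rw [← Finset.sum_filter, mul_one, Finset.sum_const, nsmul_one]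
  have h := card_le_of_separated (S.filter fun k : ℕ => |Real.log m - Real.log k| ≤ 2 * Real.pi / T)
    (fun k : ℕ => Real.log k) (c := 1 / (⌊T⌋₊ : ℝ)) (ρ := Real.log m) (δ := 2 * Real.pi / T)
    (by positivity) (by positivity)
    (fun j hj => by rw [abs_sub_comm]; exact (Finset.mem_filter.mp hj).2)
    (fun j hj k hk hjk => by
      have hj' := (Finset.mem_filter.mp hj).1
      have hk' := (Finset.mem_filter.mp hk).1
      exact one_div_le_abs_log_sub_log (hS.pos _ hj') (hS.pos _ hk') hjk
        (Nat.le_floor (hS.le _ hj')) (Nat.le_floor (hS.le _ hk')))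
  refine h.trans ?_
  have h1 : 2 * (2 * Real.pi / T) / (1 / (⌊T⌋₊ : ℝ)) ≤ 4 * Real.pi := by
    rw [div_div_eq_mul_div, div_one]
    calc 2 * (2 * Real.pi / T) * (⌊T⌋₊ : ℝ) ≤ 2 * (2 * Real.pi / T) * T := by gcongr
      _ = 4 * Real.pi := by field_simp; norm_num
  linarith [Real.pi_lt_d2]

/-- The mean value theorem for `∑_{m ∈ S} ε_m m^{-it}`. -/
theorem exists_integral_sq_dirichletPoly_le : ∃ C : ℝ, 0 < C ∧
    ∀ (T : ℝ) (S : Finset ℕ) (ε : ℕ → ℂ), IsAdmissible T S ε →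
      ∫ t in (0 : ℝ)..T, ‖dirichletPoly S ε (t * Complex.I)‖ ^ 2 ≤ C * (S.card * T) := by
  obtain ⟨C, hC0, hC⟩ := exists_integral_le_closePairSum
  refine ⟨C * 14, by positivity, fun T S ε hS => ?_⟩
  have hT : 0 < T := by linarith [hS.twenty_le]
  simp_rw [dirichletPoly_eq_expSum hS.pos]
  refine (hC S ε _ T hT).trans ?_
  have h1 := (closePairSum_mono (b := fun j => ‖ε j‖) (fun n : ℕ => Real.log n) (2 * Real.pi / T)
    (fun _ _ => norm_nonneg _) hS.norm_le_one).trans (closePairSum_log_le hS)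
  calc _ ≤ C * (T * (14 * S.card)) := by gcongr
    _ = _ := by ring

/-! ### Divisor and logarithm bounds. -/

/-- Compare the local factors e + 1 and p^{ηe}. If p ≥ 2^{1/η} then e + 1 ≤ 2^e ≤ p^{ηe}. Each of
the finitely many smaller primes loses at most a constant factor K. -/
theorem exists_card_divisors_le {η : ℝ} (hη : 0 < η) :
    ∃ C : ℝ, 0 < C ∧ ∀ n : ℕ, n ≠ 0 → (n.divisors.card : ℝ) ≤ C * (n : ℝ) ^ η := by
  have hl2 : 0 < Real.log 2 := Real.log_pos (by norm_num)
  set K : ℝ := 1 + 1 / (η * Real.log 2) with hK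
  have hK1 : 1 ≤ K := by
    rw [hK]
    have : 0 < 1 / (η * Real.log 2) := by positivity
    linarith
  set B : ℕ := ⌈(2 : ℝ) ^ (1 / η)⌉₊ with hB
  refine ⟨K ^ B, by positivity, fun n hn => ?_⟩
  have hlocal : ∀ p ∈ n.primeFactors, ((n.factorization p + 1 : ℕ) : ℝ) ≤
      (if p < B then K else 1) * ((p : ℝ) ^ n.factorization p) ^ η := by
    intro p hp
    have hp2 : (2 : ℝ) ≤ p := by exact_mod_cast (Nat.prime_of_mem_primeFactors hp).two_le
    set e := n.factorization p
    have hpe : ((p : ℝ) ^ e) ^ η = ((p : ℝ) ^ η) ^ e := by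
      rw [← Real.rpow_natCast, ← Real.rpow_mul (by linarith), mul_comm, Real.rpow_mul (by linarith),
        Real.rpow_natCast]
    rw [hpe]
    split_ifs with hpB
    · have h1 : (2 : ℝ) ^ η ≤ (p : ℝ) ^ η := Real.rpow_le_rpow (by norm_num) hp2 hη.le
      have h2 : ((2 : ℝ) ^ η) ^ e ≤ ((p : ℝ) ^ η) ^ e := pow_le_pow_left₀ (by positivity) h1 e
      have h3 : ((2 : ℝ) ^ η) ^ e = Real.exp (η * Real.log 2 * e) := by
        rw [← Real.rpow_natCast, ← Real.rpow_mul (by norm_num), Real.rpow_def_of_pos (by norm_num)]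
        ring_nf
      have h4 := Real.add_one_le_exp (η * Real.log 2 * e)
      have h5 : ((e + 1 : ℕ) : ℝ) ≤ K * (η * Real.log 2 * e + 1) := by
        have : K * (η * Real.log 2 * e + 1) =
            e + 1 + (η * Real.log 2 * e + 1 / (η * Real.log 2)) := by
          rw [hK]
          field_simp
          ring
        rw [this]
        push_cast
        have : 0 ≤ η * Real.log 2 * e + 1 / (η * Real.log 2) := by positivity
        linarith
      refine h5.trans ?_
      gcongr
      linarith
    · have h1 : (2 : ℝ) ≤ (p : ℝ) ^ η := by
        have h2 : (2 : ℝ) ^ (1 / η) ≤ p :=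
          (Nat.le_ceil _).trans (by exact_mod_cast not_lt.mp hpB)
        calc (2 : ℝ) = ((2 : ℝ) ^ (1 / η)) ^ η := by
              rw [← Real.rpow_mul (by norm_num), one_div_mul_cancel hη.ne', Real.rpow_one]
          _ ≤ _ := Real.rpow_le_rpow (by positivity) h2 hη.le
      rw [one_mul]
      calc ((e + 1 : ℕ) : ℝ) ≤ (2 : ℝ) ^ e := by exact_mod_cast Nat.lt_two_pow_self
        _ ≤ _ := pow_le_pow_left₀ (by norm_num) h1 e
  have hn' : (n : ℝ) = ∏ p ∈ n.primeFactors, (p : ℝ) ^ n.factorization p := by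
    conv_lhs => rw [← Nat.prod_factorization_pow_eq_self hn]
    rw [Finsupp.prod, Nat.support_factorization]
    push_cast
    rfl
  rw [Nat.card_divisors hn, Nat.cast_prod]
  calc ∏ p ∈ n.primeFactors, ((n.factorization p + 1 : ℕ) : ℝ)
      ≤ ∏ p ∈ n.primeFactors, ((if p < B then K else 1) * ((p : ℝ) ^ n.factorization p) ^ η) :=
        Finset.prod_le_prod (fun p _ => by positivity) hlocal
    _ = (∏ p ∈ n.primeFactors, if p < B then K else 1) * (n : ℝ) ^ η := by
        rw [Finset.prod_mul_distrib, Real.finsetProd_rpow _ _ (fun p _ => by positivity), ← hn']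
    _ ≤ K ^ B * (n : ℝ) ^ η := by
        gcongr
        rw [Finset.prod_ite, Finset.prod_const, Finset.prod_const_one, mul_one]
        refine pow_le_pow_right₀ hK1 ?_
        calc _ ≤ (Finset.range B).card := Finset.card_le_card fun p hp => by
              rw [Finset.mem_range]
              exact (Finset.mem_filter.mp hp).2
          _ = B := Finset.card_range B

theorem exists_log_add_one_le {η : ℝ} (hη : 0 < η) :
    ∃ C : ℝ, 0 < C ∧ ∀ n : ℕ, n ≠ 0 → (Nat.log 2 n : ℝ) + 1 ≤ C * (n : ℝ) ^ η := by
  have hl2 : 0 < Real.log 2 := Real.log_pos (by norm_num)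
  refine ⟨1 / (η * Real.log 2) + 1, by positivity, fun n hn => ?_⟩
  have hn1 : (1 : ℝ) ≤ n := by exact_mod_cast Nat.one_le_iff_ne_zero.mpr hn
  have h1 : (Nat.log 2 n : ℝ) * Real.log 2 ≤ (n : ℝ) ^ η / η := by
    refine le_trans ?_ (Real.log_le_rpow_div (by positivity) hη)
    rw [← Real.log_pow]
    exact Real.log_le_log (by positivity) (by exact_mod_cast Nat.pow_log_le_self 2 hn)
  have h2 : (1 : ℝ) ≤ (n : ℝ) ^ η := Real.one_le_rpow hn1 hη.le
  have h3 : (Nat.log 2 n : ℝ) ≤ 1 / (η * Real.log 2) * (n : ℝ) ^ η := by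
    rw [← le_div_iff₀ hl2] at h1
    refine h1.trans_eq ?_
    field_simp
  linarith

/-! ### Dyadic decomposition by the height of the reduced fraction. -/

/-- Pairs of positive integers at most `N` whose logarithmic ratio is within `δ` of `ρ`. -/
noncomputable def closeRatioPairs (N : ℕ) (ρ δ : ℝ) : Finset (ℕ × ℕ) :=
  (Finset.Icc 1 N ×ˢ Finset.Icc 1 N).filter fun p => |Real.log p.1 - Real.log p.2 - ρ| ≤ δ

/-- The coprime pairs in `closeRatioPairs` whose maximum lies in `[2^j, 2^{j+1})`. -/
noncomputable def reducedRatioPairs (j : ℕ) (ρ δ : ℝ) : Finset (ℕ × ℕ) :=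
  (closeRatioPairs (2 ^ (j + 1)) ρ δ).filter fun p =>
    p.1.Coprime p.2 ∧ Nat.log 2 (max p.1 p.2) = j

/-- Write (n₁, n₂) = d(a, b) with a, b coprime. The ratio depends only on (a, b), and if max(a, b) ≥
2^j then at most N/2^j values of d are possible. -/
theorem card_closeRatioPairs_le (N : ℕ) (ρ δ : ℝ) :
    (closeRatioPairs N ρ δ).card ≤
      ∑ j ∈ Finset.range (Nat.log 2 N + 1), N / 2 ^ j * (reducedRatioPairs j ρ δ).card := by
  classical
  have hsub : closeRatioPairs N ρ δ ⊆ (Finset.range (Nat.log 2 N + 1)).biUnion fun j =>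
      (Finset.Icc 1 (N / 2 ^ j) ×ˢ reducedRatioPairs j ρ δ).image
        fun x => (x.1 * x.2.1, x.1 * x.2.2) := by
    rintro ⟨n₁, n₂⟩ hn
    obtain ⟨hmem, hclose⟩ := Finset.mem_filter.mp hn
    obtain ⟨hm1, hm2⟩ := Finset.mem_product.mp hmem
    obtain ⟨h1, h1N⟩ := Finset.mem_Icc.mp hm1
    obtain ⟨h2, h2N⟩ := Finset.mem_Icc.mp hm2
    clear hm1 hm2 hmem hn
    simp only at h1 h1N h2 h2N hclose
    obtain ⟨d, a, b, hd, hab, rfl, rfl⟩ := Nat.exists_coprime' (Nat.gcd_pos_of_pos_left n₂ h1)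
    have ha : 0 < a := Nat.pos_of_ne_zero (by rintro rfl; simp at h1)
    have hb : 0 < b := Nat.pos_of_ne_zero (by rintro rfl; simp at h2)
    have hmax : max a b ≠ 0 := by omega
    have hdmax : d * max a b ≤ N := by
      rw [mul_comm]
      rcases le_total a b with h | h
      · rwa [max_eq_right h]
      · rwa [max_eq_left h]
    set j := Nat.log 2 (max a b) with hj
    have hj1 : 2 ^ j ≤ max a b := Nat.pow_log_le_self 2 hmax
    have hj2 : max a b < 2 ^ (j + 1) := Nat.lt_pow_succ_log_self (by norm_num) _
    rw [Finset.mem_biUnion]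
    refine ⟨j, ?_, ?_⟩
    · rw [Finset.mem_range, Nat.lt_add_one_iff]
      exact Nat.log_mono_right ((Nat.le_mul_of_pos_left _ hd).trans hdmax)
    · rw [Finset.mem_image]
      refine ⟨(d, (a, b)), ?_, by simp [mul_comm]⟩
      rw [Finset.mem_product, Finset.mem_Icc]
      refine ⟨⟨hd, ?_⟩, ?_⟩
      · rw [Nat.le_div_iff_mul_le (by positivity)]
        exact (Nat.mul_le_mul_left d hj1).trans hdmax
      · rw [reducedRatioPairs, closeRatioPairs, Finset.mem_filter, Finset.mem_filter,
          Finset.mem_product, Finset.mem_Icc, Finset.mem_Icc]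
        refine ⟨⟨⟨⟨ha, ?_⟩, hb, ?_⟩, ?_⟩, hab, rfl⟩
        · exact (le_max_left a b).trans hj2.le
        · exact (le_max_right a b).trans hj2.le
        · have ha' : (a : ℝ) ≠ 0 := by positivity
          have hb' : (b : ℝ) ≠ 0 := by positivity
          have hd' : (d : ℝ) ≠ 0 := by positivity
          push_cast at hclose
          rw [Real.log_mul ha' hd', Real.log_mul hb' hd', add_sub_add_right_eq_sub] at hclose
          exact hclose
  refine (Finset.card_le_card hsub).trans (Finset.card_biUnion_le.trans ?_)
  refine Finset.sum_le_sum fun j _ => Finset.card_image_le.trans ?_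
  rw [Finset.card_product, Nat.card_Icc, Nat.add_sub_cancel]

theorem card_reducedRatioPairs_le (j : ℕ) (ρ : ℝ) {δ : ℝ} (hδ : 0 ≤ δ) :
    ((reducedRatioPairs j ρ δ).card : ℝ) ≤ 8 * δ * 4 ^ j + 1 := by
  have h := card_coprime_close_le (reducedRatioPairs j ρ δ) (X := 2 ^ (j + 1)) (ρ := ρ) hδ
    (by positivity) fun p hp => by
      obtain ⟨h1, h2, -⟩ := Finset.mem_filter.mp hp
      obtain ⟨h3, h4⟩ := Finset.mem_filter.mp h1
      obtain ⟨h5, h6⟩ := Finset.mem_product.mp h3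
      exact ⟨(Finset.mem_Icc.mp h5).1, (Finset.mem_Icc.mp h6).1, (Finset.mem_Icc.mp h5).2,
        (Finset.mem_Icc.mp h6).2, h2, h4⟩
  refine h.trans_eq ?_
  have : (4 : ℝ) ^ j = (2 ^ j) ^ 2 := by
    rw [← pow_mul, mul_comm, pow_mul]
    norm_num
  rw [this]
  push_cast
  ring

theorem closeSumJ_one_eq {S : Finset ℕ} (hS : ∀ m ∈ S, 0 < m) (N : ℕ) (T : ℝ) :
    closeSumJ T S N (fun _ => 1) = ∑ m₁ ∈ S, ∑ m₂ ∈ S,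
      ((closeRatioPairs N (Real.log m₂ - Real.log m₁) (2 * Real.pi / T)).card : ℝ) := by
  unfold closeSumJ
  refine Finset.sum_congr rfl fun m₁ hm₁ => Finset.sum_congr rfl fun m₂ hm₂ => ?_
  rw [closeRatioPairs, Finset.card_filter, Nat.cast_sum, Finset.sum_product]
  refine Finset.sum_congr rfl fun n₁ hn₁ => Finset.sum_congr rfl fun n₂ hn₂ => ?_
  have h : ∀ {n : ℕ}, n ∈ Finset.Icc 1 N → (n : ℝ) ≠ 0 := fun hn => by
    have := (Finset.mem_Icc.mp hn).1
    positivity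
  have h' : ∀ {m : ℕ}, m ∈ S → (m : ℝ) ≠ 0 := fun hm => by exact_mod_cast (hS _ hm).ne'
  rw [Real.log_div (mul_ne_zero (h' hm₁) (h hn₁)) (mul_ne_zero (h' hm₂) (h hn₂)),
    Real.log_mul (h' hm₁) (h hn₁), Real.log_mul (h' hm₂) (h hn₂)]
  have hrw : Real.log m₁ + Real.log n₁ - (Real.log m₂ + Real.log n₂) =
    Real.log n₁ - Real.log n₂ - (Real.log m₂ - Real.log m₁) := by ring
  rw [hrw, mul_one]
  split_ifs <;> simp

/-- The pairs of height about 2^j are counted in two ways. Forgetting coprimality gives at most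
J(2^{j+1}); spacing gives at most R² + 51·4^j R²/T. The minimum keeps the first or the R², and the
terms 4^j/T form a geometric series dominated by 2^j ≈ N. Retaining J(2^{j+1}) is what makes the
later bootstrap possible. -/
theorem closeSumJ_one_le_dyadic {S : Finset ℕ} (hS : ∀ m ∈ S, 0 < m) {N : ℕ} (hN : 0 < N) {T : ℝ}
    (hT : 0 < T) :
    closeSumJ T S N (fun _ => 1) ≤ 102 * ((N : ℝ) ^ 2 * (S.card : ℝ) ^ 2 / T) +
      N * ∑ j ∈ Finset.range (Nat.log 2 N + 1),
        min (closeSumJ T S (2 ^ (j + 1)) fun _ => 1) ((S.card : ℝ) ^ 2) / 2 ^ j := by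
  set δ := 2 * Real.pi / T with hδ
  have hδ0 : 0 ≤ δ := by positivity
  set R : ℝ := (S.card : ℝ) with hR
  set K : ℕ → ℝ := fun j => ∑ m₁ ∈ S, ∑ m₂ ∈ S,
    ((reducedRatioPairs j (Real.log m₂ - Real.log m₁) δ).card : ℝ) with hK
  have hsum2 : ∀ c : ℝ, ∑ m₁ ∈ S, ∑ m₂ ∈ S, c = c * R ^ 2 := fun c => by
    simp only [Finset.sum_const, nsmul_eq_mul]
    ring
  have h1 : closeSumJ T S N (fun _ => 1) ≤
      ∑ j ∈ Finset.range (Nat.log 2 N + 1), (N : ℝ) / 2 ^ j * K j := by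
    rw [closeSumJ_one_eq hS]
    have : ∑ j ∈ Finset.range (Nat.log 2 N + 1), (N : ℝ) / 2 ^ j * K j =
        ∑ m₁ ∈ S, ∑ m₂ ∈ S, ∑ j ∈ Finset.range (Nat.log 2 N + 1), (N : ℝ) / 2 ^ j *
          ((reducedRatioPairs j (Real.log m₂ - Real.log m₁) δ).card : ℝ) := by
      simp_rw [hK, Finset.mul_sum]
      rw [Finset.sum_comm]
      exact Finset.sum_congr rfl fun m₁ _ => Finset.sum_comm
    rw [this]
    refine Finset.sum_le_sum fun m₁ _ => Finset.sum_le_sum fun m₂ _ => ?_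
    have h := card_closeRatioPairs_le N (Real.log m₂ - Real.log m₁) δ
    calc _ ≤ ((∑ j ∈ Finset.range (Nat.log 2 N + 1), N / 2 ^ j *
          (reducedRatioPairs j (Real.log m₂ - Real.log m₁) δ).card : ℕ) : ℝ) := by exact_mod_cast h
      _ ≤ _ := by
        push_cast
        refine Finset.sum_le_sum fun j _ => ?_
        gcongr
        refine Nat.cast_div_le.trans_eq ?_
        push_cast
        rfl
  have hK1 : ∀ j, K j ≤ closeSumJ T S (2 ^ (j + 1)) fun _ => 1 := by
    intro j
    rw [closeSumJ_one_eq hS]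
    refine Finset.sum_le_sum fun m₁ _ => Finset.sum_le_sum fun m₂ _ => ?_
    exact_mod_cast Finset.card_le_card (Finset.filter_subset _ _)
  have hK2 : ∀ j, K j ≤ (51 * 4 ^ j / T + 1) * R ^ 2 := by
    intro j
    rw [← hsum2]
    refine Finset.sum_le_sum fun m₁ _ => Finset.sum_le_sum fun m₂ _ => ?_
    refine (card_reducedRatioPairs_le j _ hδ0).trans ?_
    have : 8 * δ * 4 ^ j ≤ 51 * 4 ^ j / T := by
      rw [hδ, mul_div_assoc', div_mul_eq_mul_div]
      gcongr
      linarith [Real.pi_lt_d2]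
    linarith
  have hK3 : ∀ j, K j ≤ min (closeSumJ T S (2 ^ (j + 1)) fun _ => 1) (R ^ 2) +
      51 * 4 ^ j / T * R ^ 2 := by
    intro j
    have h0 : 0 ≤ 51 * 4 ^ j / T * R ^ 2 := by positivity
    rcases min_choice (closeSumJ T S (2 ^ (j + 1)) fun _ => 1) (R ^ 2) with h | h
    · rw [h]
      linarith [hK1 j]
    · rw [h]
      linarith [hK2 j]
  have hgeo : ∑ j ∈ Finset.range (Nat.log 2 N + 1), (2 : ℝ) ^ j ≤ 2 * N := by
    rw [geom_sum_eq (by norm_num)]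
    have : (2 : ℝ) ^ Nat.log 2 N ≤ N := by exact_mod_cast Nat.pow_log_le_self 2 hN.ne'
    rw [pow_succ]
    linarith
  refine h1.trans ?_
  calc ∑ j ∈ Finset.range (Nat.log 2 N + 1), (N : ℝ) / 2 ^ j * K j
      ≤ ∑ j ∈ Finset.range (Nat.log 2 N + 1),
        (N * (min (closeSumJ T S (2 ^ (j + 1)) fun _ => 1) (R ^ 2) / 2 ^ j) +
          51 * N * R ^ 2 / T * 2 ^ j) := by
        refine Finset.sum_le_sum fun j _ => ?_
        calc _ ≤ (N : ℝ) / 2 ^ j * (min (closeSumJ T S (2 ^ (j + 1)) fun _ => 1) (R ^ 2) +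
              51 * 4 ^ j / T * R ^ 2) := by
              gcongr
              exact hK3 j
          _ = _ := by
            have : (4 : ℝ) ^ j = 2 ^ j * 2 ^ j := by
              rw [← mul_pow]
              norm_num
            rw [this]
            field_simp
    _ = N * ∑ j ∈ Finset.range (Nat.log 2 N + 1),
          min (closeSumJ T S (2 ^ (j + 1)) fun _ => 1) (R ^ 2) / 2 ^ j +
        51 * N * R ^ 2 / T * ∑ j ∈ Finset.range (Nat.log 2 N + 1), (2 : ℝ) ^ j := by
        rw [Finset.sum_add_distrib, Finset.mul_sum, Finset.mul_sum]
    _ ≤ N * ∑ j ∈ Finset.range (Nat.log 2 N + 1),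
          min (closeSumJ T S (2 ^ (j + 1)) fun _ => 1) (R ^ 2) / 2 ^ j +
        51 * N * R ^ 2 / T * (2 * N) := by gcongr
    _ = _ := by ring

/-! ### Cauchy–Schwarz: passing from length X to length X². -/

theorem sum_comp_le_card_mul_sum {ι κ : Type*} [DecidableEq κ] {s : Finset ι} {s' : Finset κ}
    {g : ι → κ} (hg : ∀ j ∈ s, g j ∈ s') {D : ℝ}
    (hD : ∀ k ∈ s', ((s.filter fun j => g j = k).card : ℝ) ≤ D) {f : κ → ℝ}
    (hf : ∀ k ∈ s', 0 ≤ f k) : ∑ j ∈ s, f (g j) ≤ D * ∑ k ∈ s', f k := by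
  rw [← Finset.sum_fiberwise_of_maps_to hg, Finset.mul_sum]
  refine Finset.sum_le_sum fun k hk => ?_
  have : ∑ j ∈ s with g j = k, f (g j) = ((s.filter fun j => g j = k).card : ℝ) * f k := by
    rw [← nsmul_eq_mul, ← Finset.sum_const]
    exact Finset.sum_congr rfl fun j hj => by rw [(Finset.mem_filter.mp hj).2]
  rw [this]
  exact mul_le_mul_of_nonneg_right (hD k hk) (hf k hk)

theorem closePairSum_one_le_of_mapsTo {ι κ : Type*} [DecidableEq κ] {s : Finset ι} {s' : Finset κ}
    {g : ι → κ} (hg : ∀ j ∈ s, g j ∈ s') {D : ℝ} (hD0 : 0 ≤ D)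
    (hD : ∀ k ∈ s', ((s.filter fun j => g j = k).card : ℝ) ≤ D) {lam : ι → ℝ} {lam' : κ → ℝ}
    (hlam : ∀ j ∈ s, lam j = lam' (g j)) (δ : ℝ) :
    closePairSum s (fun _ => 1) lam δ ≤ D ^ 2 * closePairSum s' (fun _ => 1) lam' δ := by
  have h0 : ∀ x y : κ, (0 : ℝ) ≤ if |lam' x - lam' y| ≤ δ then 1 * 1 else 0 := by
    intro x y
    split_ifs <;> norm_num
  unfold closePairSum
  calc _ = ∑ j ∈ s, ∑ k ∈ s, if |lam' (g j) - lam' (g k)| ≤ δ then (1 : ℝ) * 1 else 0 :=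
        Finset.sum_congr rfl fun j hj => Finset.sum_congr rfl fun k hk => by
          rw [hlam j hj, hlam k hk]
    _ ≤ ∑ j ∈ s, D * ∑ y ∈ s', if |lam' (g j) - lam' y| ≤ δ then (1 : ℝ) * 1 else 0 :=
        Finset.sum_le_sum fun j _ => sum_comp_le_card_mul_sum
          (f := fun y => if |lam' (g j) - lam' y| ≤ δ then (1 : ℝ) * 1 else 0) hg hD
          fun y _ => h0 _ y
    _ = D * ∑ j ∈ s, ∑ y ∈ s', if |lam' (g j) - lam' y| ≤ δ then (1 : ℝ) * 1 else 0 := by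
        rw [Finset.mul_sum]
    _ ≤ D * (D * ∑ x ∈ s', ∑ y ∈ s', if |lam' x - lam' y| ≤ δ then (1 : ℝ) * 1 else 0) := by
        gcongr
        exact sum_comp_le_card_mul_sum
          (f := fun x => ∑ y ∈ s', if |lam' x - lam' y| ≤ δ then (1 : ℝ) * 1 else 0) hg hD
          fun x _ => Finset.sum_nonneg fun y _ => h0 x y
    _ = _ := by ring

/-- Multiplying the last two coordinates preserves the frequency, and a product a arises from at
most as many factorisations as it has divisors. Each member of a pair loses a factor D. -/
theorem closePairSum_mul_mul_le {S : Finset ℕ} (hS : ∀ m ∈ S, 0 < m) {X : ℕ} {D : ℝ}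
    (hD : ∀ a ∈ Finset.Icc 1 (X ^ 2), (a.divisors.card : ℝ) ≤ D) (hD0 : 0 ≤ D) (T : ℝ) :
    closePairSum ((S ×ˢ Finset.Icc 1 X) ×ˢ Finset.Icc 1 X) (fun _ => 1)
      (fun p => Real.log p.1.1 + Real.log p.1.2 + Real.log p.2) (2 * Real.pi / T) ≤
      D ^ 2 * closeSumJ T S (X ^ 2) fun _ => 1 := by
  rw [closeSumJ_eq_closePairSum hS]
  refine closePairSum_one_le_of_mapsTo (g := fun p => (p.1.1, p.1.2 * p.2)) ?_ hD0 ?_ ?_ _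
  · intro p hp
    simp only [Finset.mem_product, Finset.mem_Icc] at hp ⊢
    refine ⟨hp.1.1, Nat.mul_pos hp.1.2.1 hp.2.1, ?_⟩
    rw [sq]
    exact Nat.mul_le_mul hp.1.2.2 hp.2.2
  · rintro ⟨m, a⟩ hk
    obtain ⟨hm, ha⟩ := Finset.mem_product.mp hk
    refine le_trans ?_ (hD a ha)
    have ha0 : a ≠ 0 := Nat.one_le_iff_ne_zero.mp (Finset.mem_Icc.mp ha).1
    norm_cast
    refine Finset.card_le_card_of_injOn (fun p => p.1.2) ?_ ?_
    · intro p hp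
      obtain ⟨-, hp2⟩ := Finset.mem_filter.mp (Finset.mem_coe.mp hp)
      rw [Finset.mem_coe, Nat.mem_divisors]
      exact ⟨Dvd.intro _ (Prod.ext_iff.mp hp2).2, ha0⟩
    · intro p hp r hr hpr
      obtain ⟨hp1, hp2⟩ := Finset.mem_filter.mp (Finset.mem_coe.mp hp)
      obtain ⟨hr1, hr2⟩ := Finset.mem_filter.mp (Finset.mem_coe.mp hr)
      simp only [Prod.mk.injEq] at hp2 hr2 hpr
      simp only [Finset.mem_product, Finset.mem_Icc] at hp1
      refine Prod.ext (Prod.ext (hp2.1.trans hr2.1.symm) hpr) ?_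
      refine Nat.eq_of_mul_eq_mul_left hp1.1.2.1 ?_
      rw [hp2.2, hpr, hr2.2]
  · intro p hp
    simp only [Finset.mem_product, Finset.mem_Icc] at hp
    have h1 : (p.1.2 : ℝ) ≠ 0 := by have := hp.1.2.1; positivity
    have h2 : (p.2 : ℝ) ≠ 0 := by have := hp.2.1; positivity
    push_cast
    rw [Real.log_mul h1 h2, add_assoc]

/-- This is Cauchy–Schwarz with the parameter θ left free: |Q|² ≤ θ|Q|⁴/2 + 1/(2θ) is integrated
against |M|², where all ε_m = 1. The fourth-power term is an exponential sum over m x y, controlled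
by J(X²), and the last term is the mean value of |M|². -/
theorem exists_closeSumJ_le_closeSumJ_sq : ∃ C : ℝ, 0 < C ∧
    ∀ (T : ℝ) (S : Finset ℕ), IsAdmissible T S (fun _ => 1) → ∀ X : ℕ, 0 < X → ∀ D : ℝ,
      (∀ a ∈ Finset.Icc 1 (X ^ 2), (a.divisors.card : ℝ) ≤ D) → ∀ θ : ℝ, 0 < θ →
      closeSumJ T S X (fun _ => 1) ≤
        θ * (C * D ^ 2 * closeSumJ T S (X ^ 2) fun _ => 1) + C * S.card / θ := by
  obtain ⟨C₁, hC₁, h₁⟩ := exists_integral_le_closePairSum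
  obtain ⟨C₂, hC₂, h₂⟩ := exists_integral_sq_dirichletPoly_le
  refine ⟨32 * (C₁ + C₂), by positivity, fun T S hS X hX D hD θ hθ => ?_⟩
  have hT : 0 < T := by linarith [hS.twenty_le]
  have hD0 : 0 ≤ D := (Nat.cast_nonneg _).trans
    (hD 1 (Finset.mem_Icc.mpr ⟨le_rfl, Nat.one_le_pow _ _ hX⟩))
  set J₂ := closeSumJ T S (X ^ 2) fun _ => 1 with hJ₂
  have hJ₂0 : 0 ≤ J₂ := by
    rw [hJ₂, closeSumJ_eq_closePairSum hS.pos]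
    exact closePairSum_nonneg (fun _ _ => zero_le_one) _ _
  have h3 := closeSumJ_le_meanValueI hS (N := X) (q := fun _ => 1) (fun _ _ => zero_le_one) (fun _ _ => rfl)
  set A := expSum S (fun _ => (1 : ℂ)) (fun n => Real.log n) with hA
  set Q := expSum (Finset.Icc 1 X) (fun _ => ((1 : ℝ) : ℂ)) (fun n => Real.log n) with hQ
  have hAc : Continuous A := continuous_expSum _ _ _
  have hQc : Continuous Q := continuous_expSum _ _ _
  have hI₁ : meanValueI T (dirichletPoly S fun _ => 1) (realDirichletPoly X fun _ => 1) =
      ∫ t in (0 : ℝ)..T, ‖A t * Q t‖ ^ 2 := by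
    unfold meanValueI
    simp_rw [dirichletPoly_eq_expSum hS.pos, realDirichletPoly_eq_expSum]
    rfl
  have hI₀ : ∫ t in (0 : ℝ)..T, ‖A t‖ ^ 2 ≤ C₂ * (S.card * T) := by
    refine le_trans (le_of_eq ?_) (h₂ T S _ hS)
    simp_rw [dirichletPoly_eq_expSum hS.pos]
    rfl
  have hI₂ : ∫ t in (0 : ℝ)..T, ‖A t * Q t * Q t‖ ^ 2 ≤ C₁ * (T * (D ^ 2 * J₂)) := by
    simp_rw [hA, hQ, expSum_mul_expSum]
    refine (h₁ _ _ _ T hT).trans ?_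
    gcongr
    simp only [Complex.ofReal_one, mul_one, norm_one]
    exact closePairSum_mul_mul_le hS.pos hD hD0 T
  have hpt : ∫ t in (0 : ℝ)..T, ‖A t * Q t‖ ^ 2 ≤
      ∫ t in (0 : ℝ)..T, (θ / 2 * ‖A t * Q t * Q t‖ ^ 2 + 1 / (2 * θ) * ‖A t‖ ^ 2) := by
    refine intervalIntegral.integral_mono_on hT.le ?_ ?_ fun t _ => ?_
    · apply Continuous.intervalIntegrable
      fun_prop
    · apply Continuous.intervalIntegrable
      fun_prop
    · simp only [norm_mul, mul_pow]
      have : θ / 2 * (‖A t‖ ^ 2 * ‖Q t‖ ^ 2 * ‖Q t‖ ^ 2) + 1 / (2 * θ) * ‖A t‖ ^ 2 -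
          ‖A t‖ ^ 2 * ‖Q t‖ ^ 2 = ‖A t‖ ^ 2 / (2 * θ) * (θ * ‖Q t‖ ^ 2 - 1) ^ 2 := by
        field_simp
        ring
      have h0 : 0 ≤ ‖A t‖ ^ 2 / (2 * θ) * (θ * ‖Q t‖ ^ 2 - 1) ^ 2 := by positivity
      linarith
  rw [intervalIntegral.integral_add (by apply Continuous.intervalIntegrable; fun_prop)
    (by apply Continuous.intervalIntegrable; fun_prop), intervalIntegral.integral_const_mul,
    intervalIntegral.integral_const_mul] at hpt
  rw [hI₁] at h3
  have h4 : T * closeSumJ T S X (fun _ => 1) ≤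
      T * (32 * C₁ * θ * D ^ 2 * J₂ + 32 * C₂ * S.card / θ) := by
    calc _ ≤ 64 * (θ / 2 * (C₁ * (T * (D ^ 2 * J₂))) + 1 / (2 * θ) * (C₂ * (S.card * T))) := by
          refine h3.trans ?_
          gcongr
          refine hpt.trans ?_
          gcongr
      _ = _ := by
        field_simp
        ring
  refine (le_of_mul_le_mul_left h4 hT).trans ?_
  have h5 : 0 ≤ θ * D ^ 2 * J₂ := by positivity
  have h6 : 0 ≤ (S.card : ℝ) / θ := by positivity
  have e1 : θ * (32 * (C₁ + C₂) * D ^ 2 * J₂) + 32 * (C₁ + C₂) * S.card / θ =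
    32 * C₁ * θ * D ^ 2 * J₂ + 32 * C₂ * S.card / θ + 32 * C₂ * (θ * D ^ 2 * J₂) +
      32 * C₁ * (S.card / θ) := by ring
  rw [e1]
  have : 0 ≤ 32 * C₂ * (θ * D ^ 2 * J₂) := by positivity
  have : 0 ≤ 32 * C₁ * (S.card / θ) := by positivity
  linarith

/-- For a, b > 0 the choice θ = a/(2b) makes θb equal to a/2, which avoids square roots. If b = 0, a
large θ forces a = 0. -/
theorem sq_le_of_forall_le_mul_add_div {a b c : ℝ} (ha : 0 ≤ a) (hb : 0 ≤ b) (hc : 0 ≤ c)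
    (h : ∀ θ : ℝ, 0 < θ → a ≤ θ * b + c / θ) : a ^ 2 ≤ 4 * (b * c) := by
  rcases ha.eq_or_lt with rfl | ha
  · rw [zero_pow two_ne_zero]
    positivity
  rcases hb.eq_or_lt with rfl | hb
  · have h1 := h ((2 * c + 1) / a) (by positivity)
    rw [mul_zero, zero_add, div_div_eq_mul_div, le_div_iff₀ (by positivity)] at h1
    nlinarith [mul_nonneg hc ha.le]
  · have h1 := h (a / (2 * b)) (by positivity)
    have h2 : a / (2 * b) * b + c / (a / (2 * b)) = a / 2 + 2 * (b * c) / a := by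
      field_simp
    rw [h2] at h1
    have h3 : a / 2 ≤ 2 * (b * c) / a := by linarith
    rw [le_div_iff₀ ha] at h3
    nlinarith

/-! ### The self-improving bound and part (iii). -/

theorem IsAdmissible.card_le {T : ℝ} {S : Finset ℕ} {ε : ℕ → ℂ} (hS : IsAdmissible T S ε) :
    (S.card : ℝ) ≤ T := by
  have hT : 0 ≤ T := by linarith [hS.twenty_le]
  have hsub : S ⊆ Finset.Icc 1 ⌊T⌋₊ := fun m hm =>
    Finset.mem_Icc.mpr ⟨hS.pos m hm, Nat.le_floor (hS.le m hm)⟩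
  have h := Finset.card_le_card hsub
  rw [Nat.card_Icc, Nat.add_sub_cancel] at h
  exact (Nat.cast_le.mpr h).trans (Nat.floor_le hT)

theorem closeSumJ_one_nonneg {S : Finset ℕ} (hS : ∀ m ∈ S, 0 < m) (N : ℕ) (T : ℝ) :
    0 ≤ closeSumJ T S N fun _ => 1 := by
  rw [closeSumJ_eq_closePairSum hS]
  exact closePairSum_nonneg (fun _ _ => zero_le_one) _ _

/-- Under the hypothesis every dyadic block contributes at most 2HR to the sum, so only the number
of blocks, log₂ N + 1, is lost. -/
theorem closeSumJ_one_le_of_dyadic_bound {S : Finset ℕ} (hS : ∀ m ∈ S, 0 < m) {N : ℕ} (hN : 0 < N)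
    {T : ℝ} (hT : 0 < T) {H : ℝ}
    (hH : ∀ j : ℕ, min (closeSumJ T S (2 ^ j) fun _ => 1) ((S.card : ℝ) ^ 2) ≤
      H * S.card * 2 ^ j) :
    closeSumJ T S N (fun _ => 1) ≤ 102 * ((N : ℝ) ^ 2 * (S.card : ℝ) ^ 2 / T) +
      2 * N * (Nat.log 2 N + 1) * (H * S.card) := by
  refine (closeSumJ_one_le_dyadic hS hN hT).trans ?_
  have h : ∑ j ∈ Finset.range (Nat.log 2 N + 1),
      min (closeSumJ T S (2 ^ (j + 1)) fun _ => 1) ((S.card : ℝ) ^ 2) / 2 ^ j ≤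
      ∑ j ∈ Finset.range (Nat.log 2 N + 1), 2 * (H * S.card) := by
    refine Finset.sum_le_sum fun j _ => ?_
    rw [div_le_iff₀ (by positivity)]
    refine (hH (j + 1)).trans_eq ?_
    ring
  rw [Finset.sum_const, Finset.card_range, nsmul_eq_mul] at h
  push_cast at h
  have h2 := mul_le_mul_of_nonneg_left h (Nat.cast_nonneg (α := ℝ) N)
  linarith

/-- The self-improving step: an optimal dyadic bound `H` attained at `X` is small. -/
theorem le_of_sq_le_mul_add {H X R T P E : ℝ} (hH : 0 < H) (hX : 0 < X) (hR : 0 < R) (hT : 0 < T)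
    (hP : 0 ≤ P) (hE : 0 ≤ E) (hHX : H * X ≤ R)
    (h : H ^ 2 ≤ (P * (X ^ 2 * R / T) + E * H) / 2) :
    H ≤ E + (1 + P) * (R ^ 3 / T) ^ (1 / 4 : ℝ) := by
  set y := (R ^ 3 / T) ^ (1 / 4 : ℝ) with hy
  have hy0 : 0 ≤ y := by positivity
  have hy4 : y ^ 4 = R ^ 3 / T := by
    rw [hy, ← Real.rpow_natCast, ← Real.rpow_mul (by positivity)]
    norm_num
  -- If the term EH dominates, divide by H. Otherwise multiply by H² once more, so that X appears
  -- only through HX ≤ R.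
  rcases le_total (P * (X ^ 2 * R / T)) (E * H) with h1 | h1
  · have h2 : H * H ≤ E * H := by nlinarith
    have := le_of_mul_le_mul_right h2 hH
    have : 0 ≤ (1 + P) * y := by positivity
    linarith
  · have h2 : H ^ 2 ≤ P * (X ^ 2 * R / T) := by linarith
    have h3 : H ^ 4 ≤ P * (R ^ 3 / T) := by
      calc H ^ 4 = H ^ 2 * H ^ 2 := by ring
        _ ≤ H ^ 2 * (P * (X ^ 2 * R / T)) := by gcongr
        _ = P * ((H * X) ^ 2 * R / T) := by ring
        _ ≤ P * (R ^ 2 * R / T) := by gcongr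
        _ = _ := by ring
    have h4 : H ^ 4 ≤ ((1 + P) * y) ^ 4 := by
      rw [mul_pow, hy4]
      refine h3.trans ?_
      gcongr
      calc P ≤ 1 + P := by linarith
        _ = (1 + P) ^ 1 := (pow_one _).symm
        _ ≤ (1 + P) ^ 4 := pow_le_pow_right₀ (by linarith) (by norm_num)
    have h5 := le_of_pow_le_pow_left₀ (by norm_num) (by positivity) h4
    linarith

/-- H is chosen extremal: the maximum of min(J(2^j), R²)/(R 2^j) over 2^j ≤ R, or 1 if that is
larger. At the maximising X = 2^j the lower bound J(X) ≥ HRX meets the Cauchy–Schwarz bound for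
J(X)², whose right side is estimated through the same H. -/
theorem exists_dyadic_bound {η : ℝ} (hη : 0 < η) : ∃ C : ℝ, 0 < C ∧
    ∀ (T : ℝ) (S : Finset ℕ), IsAdmissible T S (fun _ => 1) → S.Nonempty → ∃ H : ℝ,
      (∀ j : ℕ, min (closeSumJ T S (2 ^ j) fun _ => 1) ((S.card : ℝ) ^ 2) ≤
        H * S.card * 2 ^ j) ∧ 0 ≤ H ∧
      H ≤ C * T ^ η * (1 + ((S.card : ℝ) ^ 3 / T) ^ (1 / 4 : ℝ)) := by
  obtain ⟨C, hC, hCS⟩ := exists_closeSumJ_le_closeSumJ_sq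
  obtain ⟨Cd, hCd, hdiv⟩ := exists_card_divisors_le (η := η / 8) (by positivity)
  obtain ⟨Cl, hCl, hlog⟩ := exists_log_add_one_le (η := η / 4) (by positivity)
  refine ⟨1 + 16 * C ^ 2 * Cd ^ 2 * Cl + 816 * C ^ 2 * Cd ^ 2, by positivity,
    fun T S hS hne => ?_⟩
  have hT1 : 1 ≤ T := by linarith [hS.twenty_le]
  have hT : 0 < T := by linarith
  set R : ℝ := (S.card : ℝ) with hR
  have hRT : R ≤ T := hS.card_le
  have hR1 : 1 ≤ R := by
    rw [hR]
    exact_mod_cast hne.card_pos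
  have hR0 : 0 < R := by linarith
  set y := (R ^ 3 / T) ^ (1 / 4 : ℝ) with hy
  have hy0 : 0 ≤ y := by positivity
  have hTη : 1 ≤ T ^ η := Real.one_le_rpow hT1 hη.le
  set m : ℕ → ℝ := fun j => min (closeSumJ T S (2 ^ j) fun _ => 1) (R ^ 2) with hm
  have hm0 : ∀ j, 0 ≤ m j := fun j => le_min (closeSumJ_one_nonneg hS.pos _ _) (by positivity)
  set L := Nat.log 2 S.card + 1 with hL
  have hL2 : R ≤ 2 ^ L := by
    have := Nat.lt_pow_succ_log_self (b := 2) (by norm_num) S.card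
    rw [hR]
    exact_mod_cast this.le
  obtain ⟨j₀, hj₀, hmax⟩ := Finset.exists_max_image (Finset.range L) (fun j => m j / (R * 2 ^ j))
    ⟨0, by simp [hL]⟩
  rw [Finset.mem_range] at hj₀
  set h₀ := m j₀ / (R * 2 ^ j₀) with hh₀
  -- Beyond 2^j ≥ R the trivial bound R² is already at most R 2^j, so the maximum need only be taken
  -- over finitely many j.
  have hbig : ∀ j, L ≤ j → m j ≤ 1 * R * 2 ^ j := by
    intro j hj
    calc m j ≤ R ^ 2 := min_le_right _ _
      _ = 1 * R * R := by ring
      _ ≤ 1 * R * 2 ^ j := by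
        gcongr
        exact hL2.trans (pow_le_pow_right₀ (by norm_num) hj)
  have hall : ∀ H : ℝ, 1 ≤ H → h₀ ≤ H → ∀ j, m j ≤ H * R * 2 ^ j := by
    intro H h1 h2 j
    rcases le_or_gt L j with hj | hj
    · refine (hbig j hj).trans ?_
      gcongr
    · have h3 := (hmax j (Finset.mem_range.mpr hj)).trans h2
      rw [div_le_iff₀ (by positivity)] at h3
      linarith
  rcases le_or_gt h₀ 1 with hle | hgt
  · refine ⟨1, hall 1 le_rfl hle, zero_le_one, ?_⟩
    have h1 : 1 ≤ 1 + 16 * C ^ 2 * Cd ^ 2 * Cl + 816 * C ^ 2 * Cd ^ 2 := by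
      have : 0 ≤ 16 * C ^ 2 * Cd ^ 2 * Cl + 816 * C ^ 2 * Cd ^ 2 := by positivity
      linarith
    exact one_le_mul_of_one_le_of_one_le (one_le_mul_of_one_le_of_one_le h1 hTη) (by linarith)
  · refine ⟨h₀, hall h₀ hgt.le le_rfl, by linarith, ?_⟩
    set X : ℕ := 2 ^ j₀ with hX
    have hX0 : 0 < X := by positivity
    have hXR : (X : ℝ) ≤ R := by
      have h1 : X ≤ 2 ^ Nat.log 2 S.card := Nat.pow_le_pow_right (by norm_num) (by omega)
      rw [hR]
      exact_mod_cast h1.trans (Nat.pow_log_le_self 2 hne.card_pos.ne')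
    have hX2T : ((X ^ 2 : ℕ) : ℝ) ≤ T ^ 2 := by
      push_cast
      exact pow_le_pow_left₀ (by positivity) (hXR.trans hRT) 2
    have hXR' : (0 : ℝ) < X := by exact_mod_cast hX0
    have hTpow : ∀ κ : ℝ, (T ^ 2) ^ κ = T ^ (2 * κ) := fun κ => by
      rw [← Real.rpow_natCast, ← Real.rpow_mul hT.le]
      norm_num
    -- The exponents are split so that D² and ℓ each cost T^{η/2}; their product then costs T^η.
    -- Here X² ≤ T² because X ≤ R ≤ T.
    set D : ℝ := Cd * T ^ (η / 4) with hD
    have hdivX : ∀ a ∈ Finset.Icc 1 (X ^ 2), (a.divisors.card : ℝ) ≤ D := by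
      intro a ha
      obtain ⟨ha1, ha2⟩ := Finset.mem_Icc.mp ha
      refine (hdiv a (by omega)).trans ?_
      rw [hD]
      gcongr
      calc (a : ℝ) ^ (η / 8) ≤ (T ^ 2) ^ (η / 8) := by
            gcongr
            exact (Nat.cast_le.mpr ha2).trans hX2T
        _ = T ^ (η / 4) := by rw [hTpow]; ring_nf
    set ℓ : ℝ := (Nat.log 2 (X ^ 2) : ℝ) + 1 with hℓ
    have hℓ0 : 0 ≤ ℓ := by positivity
    have hℓT : ℓ ≤ Cl * T ^ (η / 2) := by
      refine (hlog (X ^ 2) (by positivity)).trans ?_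
      gcongr
      calc ((X ^ 2 : ℕ) : ℝ) ^ (η / 4) ≤ (T ^ 2) ^ (η / 4) := by gcongr
        _ = T ^ (η / 2) := by rw [hTpow]; ring_nf
    have hD2 : D ^ 2 = Cd ^ 2 * T ^ (η / 2) := by
      rw [hD, mul_pow, ← Real.rpow_natCast (T ^ (η / 4)), ← Real.rpow_mul hT.le]
      norm_num
      left
      ring_nf
    set J₁ := closeSumJ T S X fun _ => 1 with hJ₁
    set J₂ := closeSumJ T S (X ^ 2) fun _ => 1 with hJ₂
    have hJ₁0 : 0 ≤ J₁ := closeSumJ_one_nonneg hS.pos _ _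
    have hJ₂0 : 0 ≤ J₂ := closeSumJ_one_nonneg hS.pos _ _
    have hsq := sq_le_of_forall_le_mul_add_div hJ₁0 (by positivity) (by positivity)
      (hCS T S hS X hX0 D hdivX)
    have hJ₂le := closeSumJ_one_le_of_dyadic_bound hS.pos (N := X ^ 2) (by positivity) hT
      (hall h₀ hgt.le le_rfl)
    have hHm : h₀ * (R * X) = m j₀ := by
      rw [hh₀, hX]
      push_cast
      field_simp
    have hmJ : m j₀ ≤ J₁ := min_le_left _ _
    have hmR : m j₀ ≤ R ^ 2 := min_le_right _ _
    have hHX : h₀ * X ≤ R := by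
      have : R * (h₀ * X) ≤ R * R := by
        calc R * (h₀ * X) = h₀ * (R * X) := by ring
          _ ≤ R * R := by rw [hHm]; linarith [hmR]
      exact le_of_mul_le_mul_left this hR0
    -- Insert the dyadic bound for J(X²) into J(X)² ≤ 4C²D²R J(X²) and divide by R²X².
    have hkey : h₀ ^ 2 ≤ (816 * C ^ 2 * D ^ 2 * ((X : ℝ) ^ 2 * R / T) +
        16 * C ^ 2 * D ^ 2 * ℓ * h₀) / 2 := by
      have h1 : (h₀ * (R * X)) ^ 2 ≤ J₁ ^ 2 := by
        rw [hHm]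
        exact pow_le_pow_left₀ (hm0 _) hmJ 2
      have h2 : (R ^ 2 * X ^ 2) * h₀ ^ 2 ≤ (R ^ 2 * X ^ 2) *
          ((816 * C ^ 2 * D ^ 2 * ((X : ℝ) ^ 2 * R / T) +
            16 * C ^ 2 * D ^ 2 * ℓ * h₀) / 2) := by
        calc (R ^ 2 * X ^ 2) * h₀ ^ 2 = (h₀ * (R * X)) ^ 2 := by ring
          _ ≤ 4 * (C * D ^ 2 * J₂ * (C * R)) := h1.trans hsq
          _ ≤ 4 * (C * D ^ 2 * (102 * (((X ^ 2 : ℕ) : ℝ) ^ 2 * R ^ 2 / T) +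
              2 * ((X ^ 2 : ℕ) : ℝ) * ℓ * (h₀ * R)) * (C * R)) := by gcongr
          _ = _ := by
            push_cast
            ring
      exact le_of_mul_le_mul_left h2 (by positivity)
    have hfin := le_of_sq_le_mul_add (by linarith) hXR' hR0 hT (by positivity) (by positivity)
      hHX hkey
    have hE : 16 * C ^ 2 * D ^ 2 * ℓ ≤ 16 * C ^ 2 * Cd ^ 2 * Cl * T ^ η := by
      calc _ ≤ 16 * C ^ 2 * (Cd ^ 2 * T ^ (η / 2)) * (Cl * T ^ (η / 2)) := by
            rw [hD2]
            gcongr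
        _ = 16 * C ^ 2 * Cd ^ 2 * Cl * (T ^ (η / 2) * T ^ (η / 2)) := by ring
        _ = _ := by rw [← Real.rpow_add hT, add_halves]
    have hP : 816 * C ^ 2 * D ^ 2 ≤ 816 * C ^ 2 * Cd ^ 2 * T ^ η := by
      rw [hD2, mul_assoc _ (Cd ^ 2)]
      gcongr
      linarith
    refine hfin.trans ?_
    calc _ ≤ 16 * C ^ 2 * Cd ^ 2 * Cl * T ^ η +
          (T ^ η + 816 * C ^ 2 * Cd ^ 2 * T ^ η) * y := by gcongr
      _ ≤ (1 + 16 * C ^ 2 * Cd ^ 2 * Cl + 816 * C ^ 2 * Cd ^ 2) * T ^ η * (1 + y) := by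
        have h1 : 0 ≤ (1 + 816 * C ^ 2 * Cd ^ 2) * T ^ η := by positivity
        have h2 : 0 ≤ 16 * C ^ 2 * Cd ^ 2 * Cl * T ^ η * y := by positivity
        linarith

theorem IsAdmissible.one {T : ℝ} {S : Finset ℕ} {ε : ℕ → ℂ} (hS : IsAdmissible T S ε) :
    IsAdmissible T S fun _ => 1 :=
  ⟨hS.twenty_le, hS.pos, hS.le, fun _ _ => by simp⟩

theorem exists_meanValueI_le_unconditional {η : ℝ} (hη : 0 < η) : ∃ C : ℝ, 0 < C ∧
    ∀ (T : ℝ) (S : Finset ℕ) (ε : ℕ → ℂ) (N : ℕ) (q : ℕ → ℝ),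
      IsAdmissible T S ε → IsUnitWeight N q →
      meanValueI T (dirichletPoly S ε) (realDirichletPoly N q) ≤
        C * ((N : ℝ) ^ 2 * (S.card : ℝ) ^ 2 +
          ((N : ℝ) * T) ^ η * ((N : ℝ) * S.card * T +
            (N : ℝ) * (S.card : ℝ) ^ (7 / 4 : ℝ) * T ^ (3 / 4 : ℝ))) := by
  obtain ⟨C₁, hC₁, h₁⟩ := exists_meanValueI_le_closeSumJ
  obtain ⟨C₂, hC₂, h₂⟩ := exists_dyadic_bound hη
  obtain ⟨C₃, hC₃, h₃⟩ := exists_log_add_one_le hη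
  refine ⟨C₁ * (102 + 2 * C₂ * C₃), by positivity, fun T S ε N q hS hq => ?_⟩
  have hT : 0 < T := by linarith [hS.twenty_le]
  have hN0 := hq.pos
  have hN : (0 : ℝ) < N := by exact_mod_cast hq.pos
  refine (h₁ T S ε N q hS hq).trans ?_
  rw [mul_assoc]
  refine mul_le_mul_of_nonneg_left ?_ hC₁.le
  rcases S.eq_empty_or_nonempty with rfl | hne
  · simp only [closeSumJ, Finset.sum_empty, mul_zero]
    positivity
  obtain ⟨H, hH, hH0, hHle⟩ := h₂ T S hS.one hne
  have hJ := (closeSumJ_mono hS.pos le_rfl (q' := fun _ => 1) hq.mem (fun _ _ => zero_le_one)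
    T).trans (closeSumJ_one_le_of_dyadic_bound hS.pos hN0 hT hH)
  set R : ℝ := (S.card : ℝ) with hR
  have hR0 : 0 < R := by
    rw [hR]
    exact_mod_cast hne.card_pos
  -- This converts the bound for H into the secondary term of (iii).
  have hroot : T * R * (R ^ 3 / T) ^ (1 / 4 : ℝ) = R ^ (7 / 4 : ℝ) * T ^ (3 / 4 : ℝ) := by
    rw [Real.div_rpow (by positivity) hT.le, ← Real.rpow_natCast, ← Real.rpow_mul hR0.le]
    have e1 : R ^ (7 / 4 : ℝ) = R * R ^ (((3 : ℕ) : ℝ) * (1 / 4)) := by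
      rw [← Real.rpow_one_add' hR0.le (by norm_num)]
      norm_num
    have e2 : T = T ^ (3 / 4 : ℝ) * T ^ (1 / 4 : ℝ) := by
      rw [← Real.rpow_add hT]
      norm_num
    rw [e1]
    nth_rewrite 1 [e2]
    have : T ^ (1 / 4 : ℝ) ≠ 0 := by positivity
    field_simp
  have hprod : ((N : ℝ) * T) ^ η = (N : ℝ) ^ η * T ^ η := Real.mul_rpow hN.le hT.le
  calc T * closeSumJ T S N q
      ≤ T * (102 * ((N : ℝ) ^ 2 * R ^ 2 / T) + 2 * N * (C₃ * (N : ℝ) ^ η) *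
          (C₂ * T ^ η * (1 + (R ^ 3 / T) ^ (1 / 4 : ℝ)) * R)) := by
        refine mul_le_mul_of_nonneg_left (hJ.trans ?_) hT.le
        gcongr
        exact h₃ N hN0.ne'
    _ = 102 * ((N : ℝ) ^ 2 * R ^ 2) + 2 * C₂ * C₃ * (((N : ℝ) * T) ^ η *
          (N * R * T + N * (T * R * (R ^ 3 / T) ^ (1 / 4 : ℝ)))) := by
        rw [hprod]
        field_simp
    _ = 102 * ((N : ℝ) ^ 2 * R ^ 2) + 2 * C₂ * C₃ * (((N : ℝ) * T) ^ η *
          (N * R * T + N * R ^ (7 / 4 : ℝ) * T ^ (3 / 4 : ℝ))) := by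
        rw [hroot, ← mul_assoc (N : ℝ) (R ^ _)]
    _ ≤ _ := by
        have h4 : 0 ≤ (N : ℝ) ^ 2 * R ^ 2 := by positivity
        have h5 : 0 ≤ ((N : ℝ) * T) ^ η *
          (N * R * T + N * R ^ (7 / 4 : ℝ) * T ^ (3 / 4 : ℝ)) := by positivity
        have h6 : 0 ≤ C₂ * C₃ := by positivity
        nlinarith [mul_nonneg h6 h4]

/-- In the ranges `N ≥ T^{2/3}` or `R ≤ T^{1/3}` the secondary term is dominated. -/
theorem secondary_term_le {η N T R : ℝ} (hη : 0 < η) (hN : 1 ≤ N) (hT : 1 ≤ T) (hR : 1 ≤ R)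
    (h : T ^ (2 / 3 : ℝ) ≤ N ∨ R ≤ T ^ (1 / 3 : ℝ)) :
    (N * T) ^ (η / 4) * (N * R * T + N * R ^ (7 / 4 : ℝ) * T ^ (3 / 4 : ℝ)) ≤
      N ^ 2 * R ^ 2 + 2 * ((N * T) ^ η * (N * R * T)) := by
  have hT0 : 0 < T := by linarith
  have hR0 : 0 < R := by linarith
  have hN0 : 0 < N := by linarith
  set Y := (N * T) ^ (η / 4) with hY
  have hNT : 1 ≤ N * T := one_le_mul_of_one_le_of_one_le hN hT
  have hY1 : 1 ≤ Y := Real.one_le_rpow hNT (by positivity)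
  have hY4 : (N * T) ^ η = Y ^ 4 := by
    rw [hY, ← Real.rpow_natCast, ← Real.rpow_mul (by positivity)]
    norm_num
  -- Z is normalised so that the secondary term is Z³·NRT. If Z ≤ Y, then YZ³ ≤ Y⁴, a permissible
  -- power of NT. If Z ≥ Y and N ≥ T^{2/3}, then YZ³·NRT ≤ Z⁴T·NR = R T^{2/3}·NR ≤ N²R². If R ≤
  -- T^{1/3}, then Z ≤ 1.
  set Z := (R / T ^ (1 / 3 : ℝ)) ^ (1 / 4 : ℝ) with hZ
  have hZ0 : 0 ≤ Z := by positivity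
  have hZ4 : Z ^ 4 * T ^ (1 / 3 : ℝ) = R := by
    rw [hZ, ← Real.rpow_natCast, ← Real.rpow_mul (by positivity)]
    norm_num
    field_simp
  have hZ3 : N * R ^ (7 / 4 : ℝ) * T ^ (3 / 4 : ℝ) = Z ^ 3 * (N * R * T) := by
    rw [hZ, ← Real.rpow_natCast, ← Real.rpow_mul (by positivity),
      Real.div_rpow hR0.le (by positivity), ← Real.rpow_mul hT0.le]
    have e1 : R ^ (7 / 4 : ℝ) = R * R ^ (1 / 4 * ((3 : ℕ) : ℝ)) := by
      rw [← Real.rpow_one_add' hR0.le (by norm_num)]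
      norm_num
    have e2 : T = T ^ (3 / 4 : ℝ) * T ^ (1 / 3 * (1 / 4 * ((3 : ℕ) : ℝ))) := by
      rw [← Real.rpow_add hT0]
      norm_num
    rw [e1]
    conv_rhs => rw [mul_comm (N * R) T]; enter [2, 1]; rw [e2]
    have : T ^ (1 / 3 * (1 / 4 * ((3 : ℕ) : ℝ))) ≠ 0 := by positivity
    field_simp
  rw [hZ3, hY4]
  have hA : 0 < N * R * T := by positivity
  have hYY : Y ≤ Y ^ 4 := by
    calc Y = Y ^ 1 := (pow_one _).symm
      _ ≤ Y ^ 4 := pow_le_pow_right₀ hY1 (by norm_num)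
  have h1 : Y * (N * R * T) ≤ Y ^ 4 * (N * R * T) := by gcongr
  have h2 : Y * (Z ^ 3 * (N * R * T)) ≤ N ^ 2 * R ^ 2 + Y ^ 4 * (N * R * T) := by
    rcases le_total Z Y with hZY | hYZ
    · have h3 : Y * (Z ^ 3 * (N * R * T)) ≤ Y ^ 4 * (N * R * T) := by
        calc _ ≤ Y * (Y ^ 3 * (N * R * T)) := by gcongr
          _ = _ := by ring
      have : 0 ≤ N ^ 2 * R ^ 2 := by positivity
      linarith
    · rcases h with hNl | hRl
      · have h3 : Y * (Z ^ 3 * (N * R * T)) ≤ N ^ 2 * R ^ 2 := by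
          have hTT : T = T ^ (1 / 3 : ℝ) * T ^ (2 / 3 : ℝ) := by
            rw [← Real.rpow_add hT0]
            norm_num
          calc _ ≤ Z * (Z ^ 3 * (N * R * T)) := by gcongr
            _ = (Z ^ 4 * T) * (N * R) := by ring
            _ ≤ (R * N) * (N * R) := by
              refine mul_le_mul_of_nonneg_right ?_ (by positivity)
              calc Z ^ 4 * T = (Z ^ 4 * T ^ (1 / 3 : ℝ)) * T ^ (2 / 3 : ℝ) := by
                    rw [mul_assoc, ← hTT]
                _ ≤ R * N := by
                  rw [hZ4]
                  exact mul_le_mul_of_nonneg_left hNl hR0.le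
            _ = _ := by ring
        have : 0 ≤ Y ^ 4 * (N * R * T) := by positivity
        linarith
      · have hZ1 : Z ≤ 1 := by
          refine Real.rpow_le_one (by positivity) ?_ (by norm_num)
          rwa [div_le_one (by positivity)]
        have h3 : Y * (Z ^ 3 * (N * R * T)) ≤ Y * (1 * (N * R * T)) := by
          gcongr
          exact pow_le_one₀ hZ0 hZ1
        have : 0 ≤ N ^ 2 * R ^ 2 := by positivity
        linarith
  linarith

theorem exists_meanValueI_le_of_range {η : ℝ} (hη : 0 < η) : ∃ C : ℝ, 0 < C ∧
    ∀ (T : ℝ) (S : Finset ℕ) (ε : ℕ → ℂ) (N : ℕ) (q : ℕ → ℝ),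
      IsAdmissible T S ε → IsUnitWeight N q →
      (T ^ (2 / 3 : ℝ) ≤ (N : ℝ) ∨ (S.card : ℝ) ≤ T ^ (1 / 3 : ℝ)) →
      meanValueI T (dirichletPoly S ε) (realDirichletPoly N q) ≤
        C * ((N : ℝ) ^ 2 * (S.card : ℝ) ^ 2 +
          ((N : ℝ) * T) ^ η * ((N : ℝ) * S.card * T)) := by
  -- Starting from η/4 leaves the factor Y⁴ = (NT)^η available for absorbing Z³.
  obtain ⟨C, hC, h⟩ := exists_meanValueI_le_unconditional (η := η / 4) (by positivity)
  refine ⟨2 * C, by positivity, fun T S ε N q hS hq hr => ?_⟩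
  refine (h T S ε N q hS hq).trans ?_
  have hN1 : (1 : ℝ) ≤ N := by exact_mod_cast hq.pos
  have hT1 : 1 ≤ T := by linarith [hS.twenty_le]
  rw [mul_comm 2 C, mul_assoc C 2]
  refine mul_le_mul_of_nonneg_left ?_ hC.le
  rcases S.eq_empty_or_nonempty with rfl | hne
  · norm_num
  have := secondary_term_le hη hN1 hT1
    (by exact_mod_cast hne.card_pos : (1 : ℝ) ≤ (S.card : ℝ)) hr
  linarith

/-! ### Powers of prime sums and part (iv). -/

theorem closePairSum_one_eq_card {ι : Type*} (s : Finset ι) (lam : ι → ℝ) (δ : ℝ) :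
    closePairSum s (fun _ => 1) lam δ =
      (((s ×ˢ s).filter fun w => |lam w.1 - lam w.2| ≤ δ).card : ℝ) := by
  rw [closePairSum, Finset.card_filter, Nat.cast_sum, Finset.sum_product]
  refine Finset.sum_congr rfl fun j _ => Finset.sum_congr rfl fun k _ => ?_
  split_ifs <;> simp

/-- The number `m` together with `k`-tuples of elements of `P`. -/
def tupleIndex (S P : Finset ℕ) (k : ℕ) : Finset (ℕ × (Fin k → ℕ)) :=
  S ×ˢ Fintype.piFinset fun _ => P

/-- The logarithm of `m x_1 ⋯ x_k`. -/
noncomputable def tupleLog {k : ℕ} (w : ℕ × (Fin k → ℕ)) : ℝ :=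
  Real.log w.1 + ∑ i, Real.log (w.2 i)

theorem mem_tupleIndex {S P : Finset ℕ} {k : ℕ} {w : ℕ × (Fin k → ℕ)} :
    w ∈ tupleIndex S P k ↔ w.1 ∈ S ∧ ∀ i, w.2 i ∈ P := by
  rw [tupleIndex, Finset.mem_product, Fintype.mem_piFinset]

theorem expSum_mul_expSum_pow (S P : Finset ℕ) (ε : ℕ → ℂ) (k : ℕ) (t : ℝ) :
    expSum S ε (fun m => Real.log m) t * expSum P (fun _ => 1) (fun p => Real.log p) t ^ k =
      expSum (tupleIndex S P k) (fun w => ε w.1) tupleLog t := by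
  have h : expSum P (fun _ => 1) (fun p => Real.log p) t ^ k =
      expSum (Fintype.piFinset fun _ : Fin k => P) (fun _ => 1)
        (fun x => ∑ i, Real.log (x i)) t := by
    have h1 : expSum P (fun _ => 1) (fun p => Real.log p) t ^ k =
        ∏ _i : Fin k, expSum P (fun _ => 1) (fun p => Real.log p) t := by simp
    rw [h1]
    unfold expSum
    rw [Finset.prod_univ_sum]
    refine Finset.sum_congr rfl fun x _ => ?_
    simp only [one_mul]
    rw [← Complex.exp_sum]
    congr 1
    rw [Finset.sum_mul]
    push_cast
    rw [← Finset.sum_neg_distrib, Finset.sum_mul]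
  rw [h, expSum_mul_expSum]
  simp only [mul_one]
  rfl

/-- Deleting the common entry subtracts the same logarithm on both sides, so closeness survives. The
deleted entry and the two shortened tuples determine the original pair. -/
theorem card_closePairs_common_le (S P : Finset ℕ) (n : ℕ) (δ : ℝ) (i l : Fin (n + 1)) :
    ((tupleIndex S P (n + 1) ×ˢ tupleIndex S P (n + 1)).filter fun w =>
      |tupleLog w.1 - tupleLog w.2| ≤ δ ∧ w.1.2 i = w.2.2 l).card ≤
    P.card * ((tupleIndex S P n ×ˢ tupleIndex S P n).filter fun w =>
      |tupleLog w.1 - tupleLog w.2| ≤ δ).card := by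
  rw [← Finset.card_product]
  refine Finset.card_le_card_of_injOn
    (fun w => (w.1.2 i, ((w.1.1, i.removeNth w.1.2), (w.2.1, l.removeNth w.2.2)))) ?_ ?_
  · intro w hw
    obtain ⟨hmem, hclose, heq⟩ := Finset.mem_filter.mp (Finset.mem_coe.mp hw)
    obtain ⟨hw1, hw2⟩ := Finset.mem_product.mp hmem
    rw [mem_tupleIndex] at hw1 hw2
    rw [Finset.mem_coe, Finset.mem_product, Finset.mem_filter, Finset.mem_product, mem_tupleIndex,
      mem_tupleIndex]
    refine ⟨hw1.2 i, ⟨⟨hw1.1, fun j => hw1.2 _⟩, hw2.1, fun j => hw2.2 _⟩, ?_⟩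
    have h1 : tupleLog w.1 = tupleLog (w.1.1, i.removeNth w.1.2) + Real.log (w.1.2 i) := by
      simp only [tupleLog, Fin.sum_univ_succAbove _ i, Fin.removeNth]
      ring
    have h2 : tupleLog w.2 = tupleLog (w.2.1, l.removeNth w.2.2) + Real.log (w.2.2 l) := by
      simp only [tupleLog, Fin.sum_univ_succAbove _ l, Fin.removeNth]
      ring
    rw [h1, h2, heq, add_sub_add_right_eq_sub] at hclose
    exact hclose
  · intro w hw v hv hwv
    obtain ⟨-, -, heqw⟩ := Finset.mem_filter.mp (Finset.mem_coe.mp hw)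
    obtain ⟨-, -, heqv⟩ := Finset.mem_filter.mp (Finset.mem_coe.mp hv)
    simp only [Prod.mk.injEq] at hwv
    obtain ⟨h0, ⟨h1, h2⟩, h3, h4⟩ := hwv
    have h5 : w.1.2 = v.1.2 := by
      rw [← Fin.insertNth_self_removeNth i w.1.2, ← Fin.insertNth_self_removeNth i v.1.2, h0, h2]
    have h6 : w.2.2 = v.2.2 := by
      rw [← Fin.insertNth_self_removeNth l w.2.2, ← Fin.insertNth_self_removeNth l v.2.2, ← heqw,
        ← heqv, h0, h4]
    exact Prod.ext (Prod.ext h1 h5) (Prod.ext h3 h6)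

/-- By unique factorisation every entry of a second tuple with the same product is an entry of the
first, leaving at most k choices for each of k places. -/
theorem card_tuples_prod_eq_le {P : Finset ℕ} (hP : ∀ p ∈ P, p.Prime) (k a : ℕ) :
    ((Fintype.piFinset fun _ : Fin k => P).filter fun x => ∏ i, x i = a).card ≤ k ^ k := by
  rcases Finset.eq_empty_or_nonempty
    ((Fintype.piFinset fun _ : Fin k => P).filter fun x => ∏ i, x i = a) with h | ⟨x₀, hx₀⟩
  · rw [h]
    simp
  obtain ⟨hx₀P, hx₀a⟩ := Finset.mem_filter.mp hx₀
  rw [Fintype.mem_piFinset] at hx₀P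
  have hprime : ∀ i, (x₀ i).Prime := fun i => hP _ (hx₀P i)
  have hsub : ((Fintype.piFinset fun _ : Fin k => P).filter fun x => ∏ i, x i = a) ⊆
      Fintype.piFinset fun _ : Fin k => Finset.univ.image x₀ := by
    intro x hx
    obtain ⟨hxP, hxa⟩ := Finset.mem_filter.mp hx
    rw [Fintype.mem_piFinset] at hxP ⊢
    intro i
    have hd : x i ∣ ∏ j, x₀ j := by
      rw [hx₀a, ← hxa]
      exact Finset.dvd_prod_of_mem _ (Finset.mem_univ i)
    obtain ⟨j, -, hj⟩ := (Nat.prime_iff.mp (hP _ (hxP i))).exists_mem_finset_dvd hd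
    rw [Finset.mem_image]
    exact ⟨j, Finset.mem_univ j, ((Nat.prime_dvd_prime_iff_eq (hP _ (hxP i)) (hprime j)).mp hj).symm⟩
  refine (Finset.card_le_card hsub).trans ?_
  rw [Fintype.card_piFinset_const]
  refine Nat.pow_le_pow_left ?_ k
  exact Finset.card_image_le.trans (by simp)

/-- Tuples of primes without a common entry have coprime products, so the spacing of reduced
fractions counts the pairs of products. Each product comes from at most k^k tuples. -/
theorem card_disjoint_close_tuples_le {P : Finset ℕ} (hP : ∀ p ∈ P, p.Prime) {k N : ℕ}
    (hN : 0 < N) (hPN : ∀ x ∈ Fintype.piFinset fun _ : Fin k => P, ∏ i, x i ≤ N) {δ : ℝ}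
    (hδ : 0 ≤ δ) (ρ : ℝ) :
    ((((Fintype.piFinset fun _ : Fin k => P) ×ˢ (Fintype.piFinset fun _ : Fin k => P)).filter
      fun z => |∑ i, Real.log (z.1 i) - ∑ i, Real.log (z.2 i) - ρ| ≤ δ ∧
        ∀ i l, z.1 i ≠ z.2 l).card : ℝ) ≤
      (k ^ k * k ^ k : ℕ) * (2 * δ * (N : ℝ) ^ 2 + 1) := by
  classical
  set V := ((Fintype.piFinset fun _ : Fin k => P) ×ˢ (Fintype.piFinset fun _ : Fin k => P)).filter
      fun z => |∑ i, Real.log (z.1 i) - ∑ i, Real.log (z.2 i) - ρ| ≤ δ ∧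
        ∀ i l, z.1 i ≠ z.2 l with hV
  set g : (Fin k → ℕ) × (Fin k → ℕ) → ℕ × ℕ := fun z => (∏ i, z.1 i, ∏ i, z.2 i) with hg
  have h1 : V.card ≤ k ^ k * k ^ k * (V.image g).card := by
    refine Finset.card_le_mul_card_image V _ fun c _ => ?_
    calc _ ≤ (((Fintype.piFinset fun _ : Fin k => P).filter fun x => ∏ i, x i = c.1) ×ˢ
          ((Fintype.piFinset fun _ : Fin k => P).filter fun x => ∏ i, x i = c.2)).card := by
          refine Finset.card_le_card fun z hz => ?_
          obtain ⟨hz1, hz2⟩ := Finset.mem_filter.mp hz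
          obtain ⟨hz3, -⟩ := Finset.mem_filter.mp hz1
          obtain ⟨hz4, hz5⟩ := Finset.mem_product.mp hz3
          rw [Finset.mem_product, Finset.mem_filter, Finset.mem_filter]
          exact ⟨⟨hz4, (Prod.ext_iff.mp hz2).1⟩, hz5, (Prod.ext_iff.mp hz2).2⟩
      _ ≤ _ := by
        rw [Finset.card_product]
        exact Nat.mul_le_mul (card_tuples_prod_eq_le hP k _) (card_tuples_prod_eq_le hP k _)
  have h2 : ((V.image g).card : ℝ) ≤ 2 * δ * (N : ℝ) ^ 2 + 1 := by
    refine card_coprime_close_le _ (ρ := ρ) hδ hN ?_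
    intro p hp
    obtain ⟨z, hz, rfl⟩ := Finset.mem_image.mp hp
    obtain ⟨hz1, hz2, hz3⟩ := Finset.mem_filter.mp hz
    obtain ⟨hz4, hz5⟩ := Finset.mem_product.mp hz1
    have hp1 : ∀ i, (z.1 i).Prime := fun i => hP _ (Fintype.mem_piFinset.mp hz4 i)
    have hp2 : ∀ i, (z.2 i).Prime := fun i => hP _ (Fintype.mem_piFinset.mp hz5 i)
    have hpos1 : 0 < ∏ i, z.1 i := Finset.prod_pos fun i _ => (hp1 i).pos
    have hpos2 : 0 < ∏ i, z.2 i := Finset.prod_pos fun i _ => (hp2 i).pos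
    refine ⟨hpos1, hpos2, hPN _ hz4, hPN _ hz5, ?_, ?_⟩
    · change (∏ i, z.1 i).Coprime (∏ i, z.2 i)
      refine Nat.Coprime.prod_left fun i _ => Nat.Coprime.prod_right fun l _ => ?_
      exact (Nat.coprime_primes (hp1 i) (hp2 l)).mpr (hz3 i l)
    · rw [hg]
      push_cast
      rw [Real.log_prod (fun i _ => by exact_mod_cast (hp1 i).ne_zero),
        Real.log_prod (fun i _ => by exact_mod_cast (hp2 i).ne_zero)]
      exact hz2
  calc (V.card : ℝ) ≤ (k ^ k * k ^ k * (V.image g).card : ℕ) := by exact_mod_cast h1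
    _ = (k ^ k * k ^ k : ℕ) * ((V.image g).card : ℝ) := by push_cast; ring
    _ ≤ _ := by gcongr

theorem card_disjoint_closePairs_le (S : Finset ℕ) {P : Finset ℕ} (hP : ∀ p ∈ P, p.Prime)
    {k N : ℕ} (hN : 0 < N) (hPN : ∀ x ∈ Fintype.piFinset fun _ : Fin k => P, ∏ i, x i ≤ N) {δ : ℝ}
    (hδ : 0 ≤ δ) :
    (((tupleIndex S P k ×ˢ tupleIndex S P k).filter fun w =>
      |tupleLog w.1 - tupleLog w.2| ≤ δ ∧ ∀ i l, w.1.2 i ≠ w.2.2 l).card : ℝ) ≤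
    (S.card : ℝ) ^ 2 * ((k ^ k * k ^ k : ℕ) * (2 * δ * (N : ℝ) ^ 2 + 1)) := by
  classical
  set W := (tupleIndex S P k ×ˢ tupleIndex S P k).filter fun w =>
      |tupleLog w.1 - tupleLog w.2| ≤ δ ∧ ∀ i l, w.1.2 i ≠ w.2.2 l with hW
  have hmaps : ∀ w ∈ W, (w.1.1, w.2.1) ∈ S ×ˢ S := by
    intro w hw
    obtain ⟨h1, h2⟩ := Finset.mem_product.mp (Finset.mem_filter.mp hw).1
    exact Finset.mem_product.mpr ⟨(mem_tupleIndex.mp h1).1, (mem_tupleIndex.mp h2).1⟩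
  rw [Finset.card_eq_sum_card_fiberwise 
    (f := fun w : (ℕ × (Fin k → ℕ)) × (ℕ × (Fin k → ℕ)) => (w.1.1, w.2.1)) (t := S ×ˢ S)
    (fun w hw => hmaps w hw), Nat.cast_sum]
  have hc : (S.card : ℝ) ^ 2 * ((k ^ k * k ^ k : ℕ) * (2 * δ * (N : ℝ) ^ 2 + 1)) =
      ∑ _c ∈ S ×ˢ S, (k ^ k * k ^ k : ℕ) * (2 * δ * (N : ℝ) ^ 2 + 1) := by
    rw [Finset.sum_const, Finset.card_product, nsmul_eq_mul]
    push_cast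
    ring
  rw [hc]
  refine Finset.sum_le_sum fun c _ => ?_
  refine le_trans ?_ (card_disjoint_close_tuples_le hP hN hPN hδ (Real.log c.2 - Real.log c.1))
  norm_cast
  refine Finset.card_le_card_of_injOn (fun w => (w.1.2, w.2.2)) ?_ ?_
  · intro w hw
    obtain ⟨hw1, hw2⟩ := Finset.mem_filter.mp (Finset.mem_coe.mp hw)
    obtain ⟨hw3, hw4, hw5⟩ := Finset.mem_filter.mp hw1
    obtain ⟨hw6, hw7⟩ := Finset.mem_product.mp hw3
    rw [Finset.mem_coe, Finset.mem_filter, Finset.mem_product]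
    refine ⟨⟨(Finset.mem_product.mp hw6).2, (Finset.mem_product.mp hw7).2⟩, ?_, hw5⟩
    rw [← hw2]
    refine le_trans (le_of_eq ?_) hw4
    congr 1
    simp only [tupleLog]
    ring
  · intro w hw v hv hwv
    have hw2 := (Finset.mem_filter.mp (Finset.mem_coe.mp hw)).2
    have hv2 := (Finset.mem_filter.mp (Finset.mem_coe.mp hv)).2
    have h := hw2.trans hv2.symm
    simp only [Prod.mk.injEq] at h hwv
    exact Prod.ext (Prod.ext h.1 hwv.1) (Prod.ext h.2 hwv.2)

/-- Either the two tuples share no prime, or they agree at one of (n+1)² pairs of positions and that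
prime is cancelled. -/
theorem closePairSum_tuple_succ_le (S : Finset ℕ) {P : Finset ℕ} (hP : ∀ p ∈ P, p.Prime)
    {n N : ℕ} (hN : 0 < N)
    (hPN : ∀ x ∈ Fintype.piFinset fun _ : Fin (n + 1) => P, ∏ i, x i ≤ N) {δ : ℝ} (hδ : 0 ≤ δ) :
    closePairSum (tupleIndex S P (n + 1)) (fun _ => 1) tupleLog δ ≤
      (S.card : ℝ) ^ 2 * (((n + 1) ^ (n + 1) * (n + 1) ^ (n + 1) : ℕ) *
        (2 * δ * (N : ℝ) ^ 2 + 1)) +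
      (n + 1 : ℝ) ^ 2 * P.card * closePairSum (tupleIndex S P n) (fun _ => 1) tupleLog δ := by
  classical
  rw [closePairSum_one_eq_card, closePairSum_one_eq_card]
  have hdis := card_disjoint_closePairs_le S hP hN hPN hδ
  set c := (S.card : ℝ) ^ 2 * (((n + 1) ^ (n + 1) * (n + 1) ^ (n + 1) : ℕ) *
        (2 * δ * (N : ℝ) ^ 2 + 1)) with hc
  clear_value c
  set U := tupleIndex S P (n + 1) ×ˢ tupleIndex S P (n + 1) with hU
  set A := U.filter fun w => |tupleLog w.1 - tupleLog w.2| ≤ δ ∧ ∀ i l, w.1.2 i ≠ w.2.2 l with hA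
  set E : Fin (n + 1) × Fin (n + 1) → Finset ((ℕ × (Fin (n + 1) → ℕ)) × (ℕ × (Fin (n + 1) → ℕ))) :=
    fun c => U.filter fun w => |tupleLog w.1 - tupleLog w.2| ≤ δ ∧ w.1.2 c.1 = w.2.2 c.2 with hE
  have hsub : (U.filter fun w => |tupleLog w.1 - tupleLog w.2| ≤ δ) ⊆
      A ∪ Finset.univ.biUnion E := by
    intro w hw
    obtain ⟨hw1, hw2⟩ := Finset.mem_filter.mp hw
    rw [Finset.mem_union, Finset.mem_biUnion]
    by_cases h : ∀ i l, w.1.2 i ≠ w.2.2 l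
    · exact Or.inl (Finset.mem_filter.mpr ⟨hw1, hw2, h⟩)
    · push Not at h
      obtain ⟨i, l, hil⟩ := h
      exact Or.inr ⟨(i, l), Finset.mem_univ _, Finset.mem_filter.mpr ⟨hw1, hw2, hil⟩⟩
  have h1 := (Finset.card_le_card hsub).trans (Finset.card_union_le _ _)
  have h2 := Finset.card_biUnion_le_card_mul Finset.univ E _
    fun c _ => card_closePairs_common_le S P n δ c.1 c.2
  rw [Finset.card_univ, Fintype.card_prod, Fintype.card_fin] at h2
  have h3 := h1.trans (Nat.add_le_add_left h2 _)
  have h4 := Nat.cast_le (α := ℝ).mpr h3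
  rw [Nat.cast_add, Nat.cast_mul, Nat.cast_mul, Nat.cast_mul, Nat.cast_add, Nat.cast_one] at h4
  refine h4.trans ((add_le_add hdis le_rfl).trans_eq ?_)
  ring

/-- A Young inequality whose leading term has coefficient 1/2, so that it can be absorbed on the
left. The cases are A ≤ y/2 and y ≤ 2A. -/
theorem mul_pow_le_half_add {A y : ℝ} (hA : 0 ≤ A) (hy : 0 ≤ y) (n : ℕ) :
    A * y ^ n ≤ y ^ (n + 1) / 2 + 2 ^ n * A ^ (n + 1) := by
  rcases le_total A (y / 2) with h | h
  · have h1 : A * y ^ n ≤ y / 2 * y ^ n := by gcongr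
    have h2 : 0 ≤ 2 ^ n * A ^ (n + 1) := by positivity
    have h3 : y / 2 * y ^ n = y ^ (n + 1) / 2 := by ring
    linarith
  · have h1 : A * y ^ n ≤ A * (2 * A) ^ n := by
      gcongr
      linarith
    have h2 : 0 ≤ y ^ (n + 1) / 2 := by positivity
    have h3 : A * (2 * A) ^ n = 2 ^ n * A ^ (n + 1) := by
      rw [mul_pow]
      ring
    linarith

/-- The mean value estimate for powers of sums over primes. -/
theorem exists_integral_prime_pow_le (n : ℕ) : ∃ C : ℝ, 0 < C ∧
    ∀ (T : ℝ) (S : Finset ℕ) (ε : ℕ → ℂ) (P : Finset ℕ) (N : ℕ), IsAdmissible T S ε → 0 < N →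
      (∀ p ∈ P, p.Prime) → (∀ x ∈ Fintype.piFinset fun _ : Fin (n + 1) => P, ∏ i, x i ≤ N) →
      ((P.card : ℝ) ^ (n + 1) ≤ N) →
      ∫ t in (0 : ℝ)..T, ‖expSum S ε (fun m => Real.log m) t *
          expSum P (fun _ => 1) (fun p => Real.log p) t ^ (n + 1)‖ ^ 2 ≤
        C * ((N : ℝ) ^ 2 * (S.card : ℝ) ^ 2 + (S.card : ℝ) ^ 2 * T + (N : ℝ) * S.card * T) := by
  obtain ⟨C₁, hC₁, h₁⟩ := exists_integral_le_closePairSum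
  obtain ⟨C₂, hC₂, h₂⟩ := exists_integral_sq_dirichletPoly_le
  set κ : ℝ := (((n + 1) ^ (n + 1) * (n + 1) ^ (n + 1) : ℕ) : ℝ) with hκ
  have hκ0 : 0 < κ := by
    rw [hκ]
    positivity
  clear_value κ
  -- B₀|P| is the factor in front of I n after passing from I (n+1) to close pairs, cancelling a
  -- prime, and returning with the constant 64.
  set B₀ : ℝ := C₁ * (n + 1 : ℝ) ^ 2 * 64 with hB₀
  have hB₀0 : 0 < B₀ := by positivity
  clear_value B₀
  set C₃ : ℝ := 2 ^ n * B₀ ^ (n + 1) * C₂ with hC₃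
  have hC₃0 : 0 < C₃ := by positivity
  refine ⟨64 * C₁ * (2 * (C₁ * κ * 13 + C₃)), by positivity, fun T S ε P N hS hN hP hPN hcard => ?_⟩
  have hT : 0 < T := by linarith [hS.twenty_le]
  have hS1 := hS.one
  set R : ℝ := (S.card : ℝ) with hR
  have hR0 : 0 ≤ R := by positivity
  set δ := 2 * Real.pi / T with hδ
  have hδ0 : 0 ≤ δ := by positivity
  set A := expSum S (fun _ => (1 : ℂ)) (fun m => Real.log m) with hA
  set B := expSum P (fun _ => 1) (fun p => Real.log p) with hB
  have hAc : Continuous A := continuous_expSum _ _ _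
  have hBc : Continuous B := continuous_expSum _ _ _
  set J : ℕ → ℝ := fun k => closePairSum (tupleIndex S P k) (fun _ => 1) tupleLog δ with hJ
  set I : ℕ → ℝ := fun k => ∫ t in (0 : ℝ)..T, ‖A t * B t ^ k‖ ^ 2 with hI
  have hupper : ∀ ε' : ℕ → ℂ, (∀ m ∈ S, ‖ε' m‖ ≤ 1) → ∀ k : ℕ,
      ∫ t in (0 : ℝ)..T, ‖expSum S ε' (fun m => Real.log m) t * B t ^ k‖ ^ 2 ≤
        C₁ * (T * J k) := by
    intro ε' hε' k
    simp_rw [hB, expSum_mul_expSum_pow]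
    refine (h₁ _ _ _ T hT).trans ?_
    gcongr
    exact closePairSum_mono _ _ (fun _ _ => norm_nonneg _)
      fun w hw => hε' _ (mem_tupleIndex.mp hw).1
  have hlower : ∀ k, T * J k ≤ 64 * I k := by
    intro k
    simp_rw [hI, hA, hB, expSum_mul_expSum_pow]
    refine (closePairSum_le_integral _ _ _ (fun _ _ => zero_le_one) hT).trans_eq ?_
    simp only [Complex.ofReal_one]
  have hI0 : I 0 ≤ C₂ * (R * T) := by
    have h := h₂ T S _ hS1
    simp_rw [dirichletPoly_eq_expSum hS.pos] at h
    simpa [hI, hA] using h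
  have hrec : J (n + 1) ≤ R ^ 2 * (κ * (2 * δ * (N : ℝ) ^ 2 + 1)) +
      (n + 1 : ℝ) ^ 2 * P.card * J n := by
    have h := closePairSum_tuple_succ_le S hP hN hPN hδ0
    rw [hκ]
    exact h
  -- Applied with y = |B(t)|², this goes directly from the exponent n to n + 1 and 0, so no
  -- induction on the exponent is needed.
  have hyoung : B₀ * P.card * I n ≤ I (n + 1) / 2 +
      2 ^ n * (B₀ * P.card) ^ (n + 1) * I 0 := by
    have hmono : ∫ t in (0 : ℝ)..T, B₀ * P.card * ‖A t * B t ^ n‖ ^ 2 ≤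
        ∫ t in (0 : ℝ)..T, (1 / 2 * ‖A t * B t ^ (n + 1)‖ ^ 2 +
          2 ^ n * (B₀ * P.card) ^ (n + 1) * ‖A t * B t ^ 0‖ ^ 2) := by
      refine intervalIntegral.integral_mono_on hT.le
        (by apply Continuous.intervalIntegrable; fun_prop)
        (by apply Continuous.intervalIntegrable; fun_prop) fun t _ => ?_
      have h := mul_pow_le_half_add (A := B₀ * P.card) (y := ‖B t‖ ^ 2) (by positivity)
        (by positivity) n
      have h2 := mul_le_mul_of_nonneg_left h (sq_nonneg ‖A t‖)
      have e : ∀ k : ℕ, ‖A t * B t ^ k‖ ^ 2 = ‖A t‖ ^ 2 * (‖B t‖ ^ 2) ^ k := fun k => by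
        rw [norm_mul, norm_pow, mul_pow, pow_right_comm]
      rw [e, e, e, pow_zero]
      linarith
    rw [intervalIntegral.integral_add (by apply Continuous.intervalIntegrable; fun_prop)
      (by apply Continuous.intervalIntegrable; fun_prop), intervalIntegral.integral_const_mul,
      intervalIntegral.integral_const_mul, intervalIntegral.integral_const_mul] at hmono
    simp only [hI]
    linarith
  have hdis : C₁ * T * (R ^ 2 * (κ * (2 * δ * (N : ℝ) ^ 2 + 1))) ≤
      C₁ * κ * 13 * ((N : ℝ) ^ 2 * R ^ 2 + R ^ 2 * T) := by
    have h4 : C₁ * T * (R ^ 2 * (κ * (2 * δ * (N : ℝ) ^ 2 + 1))) =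
        C₁ * κ * R ^ 2 * (4 * Real.pi * (N : ℝ) ^ 2 + T) := by
      rw [hδ]
      field_simp
      ring
    rw [h4]
    have h5 : 4 * Real.pi * (N : ℝ) ^ 2 + T ≤ 13 * ((N : ℝ) ^ 2 + T) := by
      nlinarith [Real.pi_lt_d2, sq_nonneg (N : ℝ)]
    calc _ ≤ C₁ * κ * R ^ 2 * (13 * ((N : ℝ) ^ 2 + T)) := by gcongr
      _ = _ := by ring
  have hIn : I (n + 1) ≤ C₁ * κ * 13 * ((N : ℝ) ^ 2 * R ^ 2 + R ^ 2 * T) +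
      B₀ * P.card * I n := by
    calc I (n + 1) ≤ C₁ * (T * J (n + 1)) := hupper _ hS1.norm_le_one (n + 1)
      _ ≤ C₁ * (T * (R ^ 2 * (κ * (2 * δ * (N : ℝ) ^ 2 + 1)) +
          (n + 1 : ℝ) ^ 2 * P.card * J n)) := by gcongr
      _ = C₁ * T * (R ^ 2 * (κ * (2 * δ * (N : ℝ) ^ 2 + 1))) +
          C₁ * (n + 1 : ℝ) ^ 2 * P.card * (T * J n) := by ring
      _ ≤ C₁ * κ * 13 * ((N : ℝ) ^ 2 * R ^ 2 + R ^ 2 * T) +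
          C₁ * (n + 1 : ℝ) ^ 2 * P.card * (64 * I n) :=
        add_le_add hdis (mul_le_mul_of_nonneg_left (hlower n) (by positivity))
      _ = _ := by
        rw [hB₀]
        ring
  -- The hypothesis |P|^{n+1} ≤ N enters here and produces the term NRT.
  have hlast : 2 ^ n * (B₀ * P.card) ^ (n + 1) * I 0 ≤ C₃ * (N * R * T) := by
    calc _ ≤ 2 ^ n * (B₀ * P.card) ^ (n + 1) * (C₂ * (R * T)) := by gcongr
      _ = C₃ * (((P.card : ℝ) ^ (n + 1)) * (R * T)) := by
        rw [hC₃, mul_pow]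
        ring
      _ ≤ C₃ * (N * (R * T)) := by gcongr
      _ = _ := by ring
  have hI1 : I (n + 1) ≤ 2 * (C₁ * κ * 13 + C₃) *
      ((N : ℝ) ^ 2 * R ^ 2 + R ^ 2 * T + N * R * T) := by
    have h6 : 0 ≤ C₁ * κ * 13 * (N * R * T) := by positivity
    have h7 : 0 ≤ C₃ * ((N : ℝ) ^ 2 * R ^ 2 + R ^ 2 * T) := by positivity
    linarith
  calc _ ≤ C₁ * (T * J (n + 1)) := hupper ε hS.norm_le_one (n + 1)
    _ ≤ C₁ * (64 * (2 * (C₁ * κ * 13 + C₃) *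
        ((N : ℝ) ^ 2 * R ^ 2 + R ^ 2 * T + N * R * T))) :=
      mul_le_mul_of_nonneg_left ((hlower (n + 1)).trans
        (mul_le_mul_of_nonneg_left hI1 (by norm_num))) hC₁.le
    _ = _ := by ring

theorem exists_meanValueI_primePowerPoly_le {k : ℕ} (hk : 0 < k) : ∃ C : ℝ, 0 < C ∧
    ∀ (T : ℝ) (S : Finset ℕ) (ε : ℕ → ℂ) (N : ℕ), IsAdmissible T S ε → 0 < N →
      meanValueI T (dirichletPoly S ε) (primePowerPoly N k) ≤
        C * ((N : ℝ) ^ 2 * (S.card : ℝ) ^ 2 + (S.card : ℝ) ^ 2 * T +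
          (N : ℝ) * S.card * T) := by
  obtain ⟨n, rfl⟩ := Nat.exists_eq_add_one.mpr hk
  obtain ⟨C, hC, h⟩ := exists_integral_prime_pow_le n
  refine ⟨C, hC, fun T S ε N hS hN => ?_⟩
  have hT : 0 < T := by linarith [hS.twenty_le]
  set z : ℝ := (N : ℝ) ^ (1 / ((n + 1 : ℕ) : ℝ)) with hz
  have hz0 : 0 ≤ z := by positivity
  have hzN : z ^ (n + 1) = N := by
    rw [hz, one_div]
    exact Real.rpow_inv_natCast_pow (by positivity) (by positivity)
  set P := (Finset.Icc 1 N).filter (fun p : ℕ => p.Prime ∧ z / 2 < (p : ℝ) ∧ (p : ℝ) ≤ z) with hPdef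
  have hP : ∀ p ∈ P, p.Prime := fun p hp => (Finset.mem_filter.mp hp).2.1
  have hPz : ∀ p ∈ P, (p : ℝ) ≤ z := fun p hp => (Finset.mem_filter.mp hp).2.2.2
  have hPN : ∀ x ∈ Fintype.piFinset fun _ : Fin (n + 1) => P, ∏ i, x i ≤ N := by
    intro x hx
    have h1 : ((∏ i, x i : ℕ) : ℝ) ≤ N := by
      push_cast
      calc ∏ i, (x i : ℝ) ≤ ∏ _i : Fin (n + 1), z := Finset.prod_le_prod
            (fun i _ => by positivity) fun i _ => hPz _ (Fintype.mem_piFinset.mp hx i)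
        _ = N := by simp [hzN]
    exact_mod_cast h1
  have hcard : (P.card : ℝ) ^ (n + 1) ≤ N := by
    rw [← hzN]
    refine pow_le_pow_left₀ (by positivity) ?_ _
    have hsub : P ⊆ Finset.Icc 1 ⌊z⌋₊ := fun p hp =>
      Finset.mem_Icc.mpr ⟨(hP p hp).pos, Nat.le_floor (hPz p hp)⟩
    have h1 := Finset.card_le_card hsub
    rw [Nat.card_Icc, Nat.add_sub_cancel] at h1
    exact (Nat.cast_le.mpr h1).trans (Nat.floor_le hz0)
  refine le_trans ?_ (h T S ε P N hS hN hP hPN hcard)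
  unfold meanValueI
  have hQ : ∀ t : ℝ, primePowerPoly N (n + 1) (t * Complex.I) =
      (1 / ((n + 1).factorial : ℂ)) *
        expSum P (fun _ => 1) (fun p => Real.log p) t ^ (n + 1) := by
    intro t
    unfold primePowerPoly expSum
    congr 2
    refine Finset.sum_congr rfl fun p hp => ?_
    rw [natCast_cpow_neg_mul_I (hP p hp).pos, one_mul]
  have hfac : ‖(1 / ((n + 1).factorial : ℂ))‖ ≤ 1 := by
    rw [norm_div, norm_one, Complex.norm_natCast]
    refine div_le_one_of_le₀ ?_ (by positivity)
    exact_mod_cast Nat.one_le_iff_ne_zero.mpr (Nat.factorial_ne_zero _)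
  simp_rw [hQ, dirichletPoly_eq_expSum hS.pos]
  have c1 := continuous_expSum S ε fun m => Real.log m
  have c2 := continuous_expSum P (fun _ => 1) fun p => Real.log p
  refine intervalIntegral.integral_mono_on hT.le
    (by apply Continuous.intervalIntegrable; fun_prop)
    (by apply Continuous.intervalIntegrable; fun_prop) fun t _ => ?_
  rw [mul_left_comm, norm_mul]
  gcongr
  exact mul_le_of_le_one_left (norm_nonneg _) hfac

/-! ### A series for ζ(s) - 1/(s-1) in the half-plane Re s > 0. -/

/-- The Euler–Maclaurin difference `(n+1)^{-s} - ∫_{n+1}^{n+2} u^{-s} du`. -/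
noncomputable def zetaTerm (n : ℕ) (s : ℂ) : ℂ :=
  ((n + 1 : ℝ) : ℂ) ^ (-s) - ∫ u in (n + 1 : ℝ)..(n + 2 : ℝ), (u : ℂ) ^ (-s)

/-- The entire function `(s - 1)` times `zetaTerm n s`. -/
noncomputable def zetaTermEntire (n : ℕ) (s : ℂ) : ℂ :=
  (s - 1) * ((n + 1 : ℝ) : ℂ) ^ (-s) + ((n + 2 : ℝ) : ℂ) ^ (1 - s) - ((n + 1 : ℝ) : ℂ) ^ (1 - s)

theorem zetaTermEntire_eq (n : ℕ) {s : ℂ} (hs : s ≠ 1) :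
    zetaTermEntire n s = (s - 1) * zetaTerm n s := by
  have h0 : (0 : ℝ) ∉ Set.uIcc (n + 1 : ℝ) (n + 2 : ℝ) := by
    rw [Set.uIcc_of_le (by linarith)]
    intro h
    have := h.1
    linarith [(Nat.cast_nonneg n : (0 : ℝ) ≤ n)]
  have hs1 : -s ≠ -1 := fun h => hs (neg_injective h)
  have hs2 : s - 1 ≠ 0 := sub_ne_zero.mpr hs
  have hs3 : -s + 1 ≠ 0 := fun h => hs2 (by rw [← neg_eq_zero, neg_sub, sub_eq_neg_add, h])
  rw [zetaTerm, integral_cpow (Or.inr ⟨hs1, h0⟩), zetaTermEntire, neg_add_eq_sub]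
  have hs4 : (1 : ℂ) - s ≠ 0 := by rwa [← neg_add_eq_sub]
  field_simp
  ring

theorem differentiable_zetaTermEntire (n : ℕ) : Differentiable ℂ (zetaTermEntire n) := by
  have h1 : ((n + 1 : ℝ) : ℂ) ≠ 0 := by
    rw [Complex.ofReal_ne_zero]
    positivity
  have h2 : ((n + 2 : ℝ) : ℂ) ≠ 0 := by
    rw [Complex.ofReal_ne_zero]
    positivity
  unfold zetaTermEntire
  intro s
  have d1 : DifferentiableAt ℂ (fun s : ℂ => ((n + 1 : ℝ) : ℂ) ^ (-s)) s :=
    DifferentiableAt.const_cpow (by fun_prop) (Or.inl h1)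
  have d2 : DifferentiableAt ℂ (fun s : ℂ => ((n + 2 : ℝ) : ℂ) ^ (1 - s)) s :=
    DifferentiableAt.const_cpow (by fun_prop) (Or.inl h2)
  have d3 : DifferentiableAt ℂ (fun s : ℂ => ((n + 1 : ℝ) : ℂ) ^ (1 - s)) s :=
    DifferentiableAt.const_cpow (by fun_prop) (Or.inl h1)
  exact (((differentiableAt_id.sub_const 1).mul d1).add d2).sub d3

/-- The term is the average of (n+1)^{-s} - u^{-s} over a unit interval. The mean value inequality
gains a factor |s|/(n+1), which makes the series converge for Re s > 0. -/
theorem norm_zetaTerm_le (n : ℕ) {s : ℂ} (hs : 0 < s.re) :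
    ‖zetaTerm n s‖ ≤ ‖s‖ * (n + 1 : ℝ) ^ (-s.re - 1) := by
  have hn : (0 : ℝ) < n + 1 := by positivity
  have hs0 : -s ≠ 0 := by
    intro h
    rw [neg_eq_zero] at h
    rw [h] at hs
    simp at hs
  have hcont : ContinuousOn (fun u : ℝ => (u : ℂ) ^ (-s)) (Set.uIcc (n + 1 : ℝ) (n + 2 : ℝ)) := by
    intro u hu
    rw [Set.uIcc_of_le (by linarith)] at hu
    exact (Complex.continuousAt_ofReal_cpow_const _ _
      (Or.inr (by linarith [hu.1]))).continuousWithinAt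
  have hrw : zetaTerm n s = ∫ u in (n + 1 : ℝ)..(n + 2 : ℝ),
      (((n + 1 : ℝ) : ℂ) ^ (-s) - (u : ℂ) ^ (-s)) := by
    rw [intervalIntegral.integral_sub (by simp) hcont.intervalIntegrable,
      intervalIntegral.integral_const, zetaTerm]
    congr 1
    have : (n + 2 : ℝ) - (n + 1) = 1 := by ring
    rw [this, one_smul]
  rw [hrw]
  have hle := intervalIntegral.norm_integral_le_of_norm_le_const (a := (n + 1 : ℝ))
    (b := (n + 2 : ℝ)) (C := ‖s‖ * (n + 1 : ℝ) ^ (-s.re - 1))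
    (f := fun u : ℝ => ((n + 1 : ℝ) : ℂ) ^ (-s) - (u : ℂ) ^ (-s)) ?_
  · refine hle.trans_eq ?_
    have : (n + 2 : ℝ) - (n + 1) = 1 := by ring
    rw [this, abs_one, mul_one]
  · intro u hu
    rw [Set.uIoc_of_le (by linarith)] at hu
    have hconv : Convex ℝ (Set.Icc (n + 1 : ℝ) (n + 2 : ℝ)) := convex_Icc _ _
    have hder : ∀ x ∈ Set.Icc (n + 1 : ℝ) (n + 2 : ℝ), HasDerivWithinAt
        (fun u : ℝ => (u : ℂ) ^ (-s)) (-s * (x : ℂ) ^ (-s - 1)) (Set.Icc (n + 1 : ℝ) (n + 2 : ℝ)) x := by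
      intro x hx
      have hx0 : x ≠ 0 := by linarith [hx.1]
      have h := (differentiableAt_id.ofReal_cpow_const hx0 hs0).hasDerivAt (x := x)
      have h2 := Complex.deriv_ofReal_cpow_const hx0 hs0
      simp only [id] at h
      rw [h2] at h
      exact h.hasDerivWithinAt
    have hbd : ∀ x ∈ Set.Icc (n + 1 : ℝ) (n + 2 : ℝ), ‖-s * (x : ℂ) ^ (-s - 1)‖ ≤
        ‖s‖ * (n + 1 : ℝ) ^ (-s.re - 1) := by
      intro x hx
      have hx0 : 0 < x := by linarith [hx.1]
      rw [norm_mul, norm_neg, Complex.norm_cpow_eq_rpow_re_of_pos hx0]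
      gcongr
      simp only [Complex.sub_re, Complex.neg_re, Complex.one_re]
      exact Real.rpow_le_rpow_of_nonpos hn hx.1 (by linarith)
    have h := hconv.norm_image_sub_le_of_norm_hasDerivWithin_le hder hbd
      (x := u) (y := (n + 1 : ℝ)) ⟨hu.1.le, hu.2⟩ ⟨le_rfl, by linarith⟩
    refine h.trans ?_
    have h1 : ‖(n + 1 : ℝ) - u‖ ≤ 1 := by
      rw [Real.norm_eq_abs, abs_le]
      constructor <;> linarith [hu.1, hu.2]
    exact mul_le_of_le_one_right (by positivity) h1

theorem norm_zetaTermEntire_le (n : ℕ) {s : ℂ} (hs : 0 < s.re) :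
    ‖zetaTermEntire n s‖ ≤ ‖s - 1‖ * (‖s‖ * (n + 1 : ℝ) ^ (-s.re - 1)) := by
  by_cases h : s = 1
  · rw [h, zetaTermEntire]
    simp
  · rw [zetaTermEntire_eq n h, norm_mul]
    gcongr
    exact norm_zetaTerm_le n hs

theorem summable_add_one_rpow {σ : ℝ} (hσ : 0 < σ) :
    Summable fun n : ℕ => (n + 1 : ℝ) ^ (-σ - 1) := by
  have h := (summable_nat_add_iff (f := fun n : ℕ => (n : ℝ) ^ (-σ - 1)) 1).mpr
    (Real.summable_nat_rpow.mpr (by linarith))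
  simpa using h

theorem summable_zetaTermEntire {s : ℂ} (hs : 0 < s.re) :
    Summable fun n => zetaTermEntire n s :=
  Summable.of_norm_bounded (((summable_add_one_rpow hs).mul_left _).mul_left _)
    fun n => norm_zetaTermEntire_le n hs

theorem differentiableOn_tsum_zetaTermEntire :
    DifferentiableOn ℂ (fun s => ∑' n, zetaTermEntire n s) {s | 0 < s.re} := by
  intro s hs
  have hs' : 0 < s.re := hs
  set U : Set ℂ := {z | s.re / 2 < z.re} ∩ Metric.ball 0 (‖s‖ + 1) with hU
  have hUo : IsOpen U :=
    (isOpen_lt continuous_const Complex.continuous_re).inter Metric.isOpen_ball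
  have hsU : s ∈ U := by
    refine ⟨?_, ?_⟩
    · change s.re / 2 < s.re
      linarith
    · rw [Metric.mem_ball, dist_zero_right]
      linarith
  have hu : Summable fun n : ℕ => (‖s‖ + 2) * ((‖s‖ + 1) * (n + 1 : ℝ) ^ (-(s.re / 2) - 1)) :=
    ((summable_add_one_rpow (by linarith)).mul_left _).mul_left _
  have h := Complex.differentiableOn_tsum_of_summable_norm hu
    (fun n => (differentiable_zetaTermEntire n).differentiableOn) hUo fun n w hw => by
      have hw1 : s.re / 2 < w.re := hw.1
      have hw2 : ‖w‖ < ‖s‖ + 1 := by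
        have := hw.2
        rwa [Metric.mem_ball, dist_zero_right] at this
      refine (norm_zetaTermEntire_le n (by linarith)).trans ?_
      have h1 : ‖w - 1‖ ≤ ‖s‖ + 2 := by
        refine (norm_sub_le _ _).trans ?_
        rw [norm_one]
        linarith
      gcongr
      linarith [(Nat.cast_nonneg n : (0 : ℝ) ≤ n)]
  exact (h.differentiableAt (hUo.mem_nhds hsU)).differentiableWithinAt

/-- The differences of (n+1)^{1-s} telescope and their boundary term tends to 0, leaving (s-1)ζ(s) -
1. -/
theorem tsum_zetaTermEntire_of_one_lt_re {s : ℂ} (hs : 1 < s.re) :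
    ∑' n, zetaTermEntire n s = (s - 1) * riemannZeta₀ s := by
  have hs1 : s ≠ 1 := by
    rintro rfl
    simp at hs
  have hs2 : s - 1 ≠ 0 := sub_ne_zero.mpr hs1
  have hsum := (summable_zetaTermEntire (by linarith : 0 < s.re)).hasSum.tendsto_sum_nat
  have hz : HasSum (fun n : ℕ => ((n + 1 : ℝ) : ℂ) ^ (-s)) (riemannZeta s) := by
    rw [zeta_eq_tsum_one_div_nat_add_one_cpow hs]
    have hsm : Summable fun n : ℕ => 1 / ((n + 1 : ℂ)) ^ s := by
      have := (summable_nat_add_iff (f := fun n : ℕ => 1 / (n : ℂ) ^ s) 1).mpr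
        (Complex.summable_one_div_nat_cpow.mpr hs)
      simpa using this
    convert hsm.hasSum using 2 with n
    rw [Complex.cpow_neg, one_div]
    push_cast
    rfl
  have hpartial : ∀ M : ℕ, ∑ n ∈ Finset.range M, zetaTermEntire n s =
      (s - 1) * ∑ n ∈ Finset.range M, ((n + 1 : ℝ) : ℂ) ^ (-s) +
        ((M + 1 : ℝ) : ℂ) ^ (1 - s) - 1 := by
    intro M
    induction M with
    | zero => simp
    | succ M ih =>
      rw [Finset.sum_range_succ, Finset.sum_range_succ, ih, zetaTermEntire]
      have : ((M + 1 : ℕ) : ℝ) + 1 = M + 2 := by push_cast; ring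
      rw [this]
      ring
  have hto0 : Filter.Tendsto (fun M : ℕ => ((M + 1 : ℝ) : ℂ) ^ (1 - s)) Filter.atTop (nhds 0) := by
    rw [tendsto_zero_iff_norm_tendsto_zero]
    have h1 : ∀ M : ℕ, ‖((M + 1 : ℝ) : ℂ) ^ (1 - s)‖ = (M + 1 : ℝ) ^ (-(s.re - 1)) := by
      intro M
      rw [Complex.norm_cpow_eq_rpow_re_of_pos (by positivity)]
      simp
    simp_rw [h1]
    have h2 : Filter.Tendsto (fun M : ℕ => (M + 1 : ℝ)) Filter.atTop Filter.atTop :=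
      Filter.tendsto_atTop_add_const_right _ _ tendsto_natCast_atTop_atTop
    exact (tendsto_rpow_neg_atTop (by linarith)).comp h2
  have hlim := ((hz.tendsto_sum_nat.const_mul (s - 1)).add hto0).sub_const 1
  simp_rw [hpartial] at hsum
  rw [tendsto_nhds_unique hsum hlim, riemannZeta_eq_inv_sub_add hs1]
  field_simp
  ring

/-- Both sides are analytic in Re s > 0 and agree for Re s > 1, so the identity theorem applies. The
factor s - 1 makes every term an explicit entire function, so s = 1 needs no separate treatment. -/
theorem tsum_zetaTermEntire {s : ℂ} (hs : 0 < s.re) :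
    ∑' n, zetaTermEntire n s = (s - 1) * riemannZeta₀ s := by
  have hopen : IsOpen {z : ℂ | 0 < z.re} := isOpen_lt continuous_const Complex.continuous_re
  have h1 : AnalyticOnNhd ℂ (fun s => ∑' n, zetaTermEntire n s) {z : ℂ | 0 < z.re} :=
    differentiableOn_tsum_zetaTermEntire.analyticOnNhd hopen
  have h2 : AnalyticOnNhd ℂ (fun s => (s - 1) * riemannZeta₀ s) {z : ℂ | 0 < z.re} := by
    refine DifferentiableOn.analyticOnNhd (Differentiable.differentiableOn ?_) hopen
    exact (differentiable_id.sub_const 1).mul differentiable_riemannZeta₀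
  have hconn : IsPreconnected {z : ℂ | 0 < z.re} := (convex_halfSpace_re_gt 0).isPreconnected
  refine h1.eqOn_of_preconnected_of_eventuallyEq h2 hconn (z₀ := 2) (by simp) ?_ hs
  have hnhds : {z : ℂ | 1 < z.re} ∈ nhds (2 : ℂ) :=
    (isOpen_lt continuous_const Complex.continuous_re).mem_nhds (by simp)
  filter_upwards [hnhds] with z hz
  exact tsum_zetaTermEntire_of_one_lt_re hz

theorem hasSum_zetaTerm {s : ℂ} (hs : 0 < s.re) (hs1 : s ≠ 1) :
    HasSum (fun n => zetaTerm n s) (riemannZeta₀ s) := by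
  have hs2 : s - 1 ≠ 0 := sub_ne_zero.mpr hs1
  have h := (summable_zetaTermEntire hs).hasSum
  rw [tsum_zetaTermEntire hs] at h
  have h2 := h.mul_left (s - 1)⁻¹
  rw [inv_mul_cancel_left₀ hs2] at h2
  have e : (fun n => zetaTerm n s) = fun n => (s - 1)⁻¹ * zetaTermEntire n s :=
    funext fun n => by rw [zetaTermEntire_eq n hs1, inv_mul_cancel_left₀ hs2]
  rw [e]
  exact h2

/-! ### The Riesz weight and its Mellin transform. -/

/-- The weight `(1 - x)^2` on `x ≤ 1`, extended by zero. -/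
noncomputable def rieszWeight (x : ℝ) : ℝ := max (1 - x) 0 ^ 2

/-- The Mellin transform of `rieszWeight`. -/
noncomputable def rieszMellin (z : ℂ) : ℂ := 2 / (z * (z + 1) * (z + 2))

theorem continuous_rieszWeight : Continuous rieszWeight := by
  unfold rieszWeight
  fun_prop

theorem rieszWeight_of_one_le {x : ℝ} (hx : 1 ≤ x) : rieszWeight x = 0 := by
  rw [rieszWeight, max_eq_right (by linarith)]
  norm_num

theorem rieszWeight_of_le_one {x : ℝ} (hx : x ≤ 1) : rieszWeight x = (1 - x) ^ 2 := by
  rw [rieszWeight, max_eq_left (by linarith)]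

theorem rieszWeight_nonneg (x : ℝ) : 0 ≤ rieszWeight x := by
  unfold rieszWeight
  positivity

/-- The Mellin integral of (1-x)² over (0,1) is the Beta integral B(z, 3). -/
theorem betaIntegral_three {z : ℂ} (hz : 0 < z.re) : Complex.betaIntegral z 3 = rieszMellin z := by
  have h := Complex.betaIntegral_eval_nat_add_one_right hz 2
  have h3 : ((2 : ℕ) : ℂ) + 1 = 3 := by norm_num
  rw [h3] at h
  rw [h, rieszMellin, Finset.prod_range_succ, Finset.prod_range_succ, Finset.prod_range_one]
  norm_num [Nat.factorial]

theorem rieszWeight_integrand_eq (z : ℂ) {t : ℝ} (ht : t ∈ Set.Ioc (0 : ℝ) 1) :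
    (t : ℂ) ^ (z - 1) * (1 - (t : ℂ)) ^ ((3 : ℂ) - 1) =
      (t : ℂ) ^ (z - 1) • (rieszWeight t : ℂ) := by
  rw [rieszWeight_of_le_one ht.2, smul_eq_mul]
  have : (3 : ℂ) - 1 = ((2 : ℕ) : ℂ) := by norm_num
  rw [this, Complex.cpow_natCast]
  push_cast
  rfl

theorem mellinConvergent_rieszWeight {z : ℂ} (hz : 0 < z.re) :
    MellinConvergent (fun x => (rieszWeight x : ℂ)) z := by
  have h := Complex.betaIntegral_convergent hz (v := 3) (by simp)
  rw [intervalIntegrable_iff_integrableOn_Ioc_of_le zero_le_one] at h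
  have h1 : MeasureTheory.IntegrableOn (fun t : ℝ => (t : ℂ) ^ (z - 1) • (rieszWeight t : ℂ))
      (Set.Ioc 0 1) :=
    h.congr_fun (fun t ht => rieszWeight_integrand_eq z ht) measurableSet_Ioc
  have h2 : MeasureTheory.IntegrableOn (fun t : ℝ => (t : ℂ) ^ (z - 1) • (rieszWeight t : ℂ))
      (Set.Ioi 1) := by
    refine MeasureTheory.IntegrableOn.congr_fun (f := fun _ => 0)
      MeasureTheory.integrableOn_zero (fun t ht => ?_) measurableSet_Ioi
    have ht' : 1 ≤ t := le_of_lt ht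
    simp [rieszWeight_of_one_le ht']
  have h3 := h1.union h2
  rwa [Set.Ioc_union_Ioi_eq_Ioi zero_le_one] at h3

theorem mellin_rieszWeight {z : ℂ} (hz : 0 < z.re) :
    mellin (fun x => (rieszWeight x : ℂ)) z = rieszMellin z := by
  rw [← betaIntegral_three hz, mellin, Complex.betaIntegral,
    intervalIntegral.integral_of_le zero_le_one]
  rw [MeasureTheory.setIntegral_congr_fun measurableSet_Ioc
    fun t ht => rieszWeight_integrand_eq z ht]
  refine MeasureTheory.setIntegral_eq_of_subset_of_forall_sdiff_eq_zero measurableSet_Ioi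
    (fun t ht => ht.1) fun t ht => ?_
  have ht' : 1 ≤ t := by
    by_contra h
    exact ht.2 ⟨ht.1, (not_le.mp h).le⟩
  simp [rieszWeight_of_one_le ht']

/-- The decay is cubic. The factor (1+|y|)^{-1} is kept apart to offset linear growth in y of the
zeta terms, while (1+y²)^{-1} remains for integrability. -/
theorem norm_rieszMellin_le (y : ℝ) :
    ‖rieszMellin (1 / 2 + y * Complex.I)‖ ≤ 8 * ((1 + |y|)⁻¹ * (1 + y ^ 2)⁻¹) := by
  have hnorm : ∀ a : ℝ, ‖((a : ℂ) + y * Complex.I)‖ ^ 2 = a ^ 2 + y ^ 2 := by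
    intro a
    rw [Complex.sq_norm, Complex.normSq_add_mul_I]
  set z : ℂ := 1 / 2 + y * Complex.I with hz
  have e0 : ‖z‖ ^ 2 = (1 / 2) ^ 2 + y ^ 2 := by
    rw [← hnorm, hz]
    push_cast
    rfl
  have e1 : ‖z + 1‖ ^ 2 = (3 / 2) ^ 2 + y ^ 2 := by
    rw [← hnorm, hz]
    push_cast
    ring_nf
  have e2 : ‖z + 2‖ ^ 2 = (5 / 2) ^ 2 + y ^ 2 := by
    rw [← hnorm, hz]
    push_cast
    ring_nf
  have b1 : (1 + y ^ 2) / 2 ≤ ‖z‖ * ‖z + 1‖ := by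
    refine le_of_sq_le_sq ?_ (by positivity)
    rw [mul_pow, e0, e1]
    nlinarith [sq_nonneg y, sq_nonneg (y ^ 2)]
  have b2 : (1 + |y|) / 2 ≤ ‖z + 2‖ := by
    refine le_of_sq_le_sq ?_ (by positivity)
    rw [e2]
    nlinarith [sq_nonneg (1 - |y|), sq_abs y]
  rw [rieszMellin, norm_div, norm_mul, norm_mul]
  have h2 : ‖(2 : ℂ)‖ = 2 := by norm_num
  rw [h2, ← mul_inv, ← div_eq_mul_inv, div_le_div_iff₀ (by nlinarith [abs_nonneg y, sq_nonneg y]) (by positivity)]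
  have h3 : (1 + y ^ 2) / 2 * ((1 + |y|) / 2) ≤ ‖z‖ * ‖z + 1‖ * ‖z + 2‖ := by gcongr
  linarith

theorem continuous_rieszMellin :
    Continuous fun y : ℝ => rieszMellin (1 / 2 + y * Complex.I) := by
  unfold rieszMellin
  refine Continuous.div (by fun_prop) (by fun_prop) fun y => ?_
  have h : ∀ a : ℝ, 0 < a → ((a : ℂ) + y * Complex.I) ≠ 0 := by
    intro a ha h0
    have := congrArg Complex.re h0
    simp at this
    linarith
  refine mul_ne_zero (mul_ne_zero ?_ ?_) ?_
  · convert h (1 / 2) (by norm_num) using 2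
    push_cast
    rfl
  · convert h (3 / 2) (by norm_num) using 1
    push_cast
    ring
  · convert h (5 / 2) (by norm_num) using 1
    push_cast
    ring

theorem integrable_rieszMellin :
    MeasureTheory.Integrable fun y : ℝ => rieszMellin (1 / 2 + y * Complex.I) := by
  refine (integrable_inv_one_add_sq.const_mul 8).mono'
    continuous_rieszMellin.aestronglyMeasurable (Filter.Eventually.of_forall fun y => ?_)
  refine (norm_rieszMellin_le y).trans ?_
  have h : (1 + |y|)⁻¹ ≤ 1 := inv_le_one_of_one_le₀ (by linarith [abs_nonneg y])
  have h2 : 0 ≤ (1 + y ^ 2)⁻¹ := by positivity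
  have := mul_le_of_le_one_left h2 h
  linarith

theorem rieszWeight_eq_integral {x : ℝ} (hx : 0 < x) :
    (rieszWeight x : ℂ) = (1 / (2 * Real.pi) : ℝ) *
      ∫ y : ℝ, (x : ℂ) ^ (-(1 / 2 + y * Complex.I)) * rieszMellin (1 / 2 + y * Complex.I) := by
  have hσ : ∀ y : ℝ, ((1 / 2 : ℝ) : ℂ) + y * Complex.I = 1 / 2 + y * Complex.I := fun y => by
    push_cast
    rfl
  have hre : ∀ y : ℝ, 0 < (((1 / 2 : ℝ) : ℂ) + y * Complex.I).re := fun y => by simp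
  have h := mellinInv_mellin_eq (1 / 2) (fun x => (rieszWeight x : ℂ)) hx
    (mellinConvergent_rieszWeight (by simp)) ?_
    (Complex.continuous_ofReal.comp continuous_rieszWeight).continuousAt
  · rw [← h, mellinInv]
    simp_rw [mellin_rieszWeight (hre _), hσ, smul_eq_mul, Complex.real_smul]
  · refine integrable_rieszMellin.congr (Filter.Eventually.of_forall fun y => ?_)
    simp only
    rw [mellin_rieszWeight (hre y), hσ]

/-! ### Smoothed sums of n^{-it} through ζ on the critical line. -/

/-- The smoothly weighted summand `w(u / X) u^{-it}`. -/
noncomputable def rieszSummand (X : ℕ) (t u : ℝ) : ℂ :=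
  (rieszWeight (u / X) : ℂ) * (u : ℂ) ^ (-((t : ℂ) * Complex.I))

/-- The Mellin kernel `X^z W(z)` on the line `z = 1/2 + iy`. -/
noncomputable def rieszKernel (X : ℕ) (y : ℝ) : ℂ :=
  (((X : ℝ)⁻¹ : ℝ) : ℂ) ^ (-(1 / 2 + y * Complex.I)) * rieszMellin (1 / 2 + y * Complex.I)

theorem continuous_rieszKernel {X : ℕ} (hX : 0 < X) : Continuous (rieszKernel X) := by
  have h : (((X : ℝ)⁻¹ : ℝ) : ℂ) ≠ 0 := by
    rw [Complex.ofReal_ne_zero]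
    positivity
  refine Continuous.mul ?_ continuous_rieszMellin
  exact Continuous.const_cpow (by fun_prop) (Or.inl h)

theorem norm_rieszKernel_le {X : ℕ} (hX : 0 < X) (y : ℝ) :
    ‖rieszKernel X y‖ ≤ 8 * (X : ℝ) ^ (1 / 2 : ℝ) * ((1 + |y|)⁻¹ * (1 + y ^ 2)⁻¹) := by
  have hX' : (0 : ℝ) < X := by exact_mod_cast hX
  rw [rieszKernel, norm_mul, Complex.norm_cpow_eq_rpow_re_of_pos (by positivity)]
  have h1 : (-(1 / 2 + (y : ℂ) * Complex.I)).re = -(1 / 2) := by simp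
  rw [h1, Real.inv_rpow hX'.le, Real.rpow_neg hX'.le, inv_inv]
  calc _ ≤ (X : ℝ) ^ (1 / 2 : ℝ) * (8 * ((1 + |y|)⁻¹ * (1 + y ^ 2)⁻¹)) := by
        gcongr
        exact norm_rieszMellin_le y
    _ = _ := by ring

theorem norm_rieszKernel_le_inv {X : ℕ} (hX : 0 < X) (y : ℝ) :
    ‖rieszKernel X y‖ ≤ 8 * (X : ℝ) ^ (1 / 2 : ℝ) * (1 + y ^ 2)⁻¹ := by
  refine (norm_rieszKernel_le hX y).trans ?_
  have h : (1 + |y|)⁻¹ ≤ 1 := inv_le_one_of_one_le₀ (by linarith [abs_nonneg y])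
  have h2 : 0 ≤ (1 + y ^ 2)⁻¹ := by positivity
  gcongr
  exact mul_le_of_le_one_left h2 h

theorem integrable_rieszKernel_mul {X : ℕ} (hX : 0 < X) (t : ℝ) {u : ℝ} (hu : 1 ≤ u) :
    MeasureTheory.Integrable fun y : ℝ =>
      rieszKernel X y * (u : ℂ) ^ (-(1 / 2 + y * Complex.I + t * Complex.I)) := by
  have hu0 : (u : ℂ) ≠ 0 := by
    rw [Complex.ofReal_ne_zero]
    linarith
  have hc : Continuous fun y : ℝ => (u : ℂ) ^ (-(1 / 2 + y * Complex.I + t * Complex.I)) :=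
    Continuous.const_cpow (by fun_prop) (Or.inl hu0)
  refine (integrable_inv_one_add_sq.const_mul (8 * (X : ℝ) ^ (1 / 2 : ℝ))).mono'
    ((continuous_rieszKernel hX).mul hc).aestronglyMeasurable
    (Filter.Eventually.of_forall fun y => ?_)
  rw [norm_mul, Complex.norm_cpow_eq_rpow_re_of_pos (by linarith)]
  refine (mul_le_of_le_one_right (norm_nonneg _) ?_).trans (norm_rieszKernel_le_inv hX y)
  exact Real.rpow_le_one_of_one_le_of_nonpos hu (by simp)

theorem rieszSummand_eq_integral {X : ℕ} (hX : 0 < X) (t : ℝ) {u : ℝ} (hu : 0 < u) :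
    rieszSummand X t u = (1 / (2 * Real.pi) : ℝ) *
      ∫ y : ℝ, rieszKernel X y * (u : ℂ) ^ (-(1 / 2 + y * Complex.I + t * Complex.I)) := by
  have hX' : (0 : ℝ) < X := by exact_mod_cast hX
  rw [rieszSummand, rieszWeight_eq_integral (by positivity), mul_assoc,
    ← MeasureTheory.integral_mul_const]
  congr 2
  ext y
  rw [rieszKernel, div_eq_mul_inv, Complex.ofReal_mul,
    Complex.mul_cpow_ofReal_nonneg hu.le (by positivity), neg_add (1 / 2 + (y : ℂ) * Complex.I),
    Complex.cpow_add _ _ (by rw [Complex.ofReal_ne_zero]; exact hu.ne')]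
  ring

/-- Fubini is justified because |u^{-1/2}| ≤ 1 for u ≥ 1 and the kernel is integrable. Together with
the pointwise formula this expresses sum minus integral through `zetaTerm` with no shift of contour.
-/
theorem integral_rieszSummand_eq {X : ℕ} (hX : 0 < X) (t : ℝ) {a b : ℝ} (ha : 1 ≤ a)
    (hab : a ≤ b) :
    MeasureTheory.Integrable (fun y : ℝ => rieszKernel X y *
      ∫ u in a..b, (u : ℂ) ^ (-(1 / 2 + y * Complex.I + t * Complex.I))) ∧
    ∫ u in a..b, rieszSummand X t u = (1 / (2 * Real.pi) : ℝ) *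
      ∫ y : ℝ, rieszKernel X y *
        ∫ u in a..b, (u : ℂ) ^ (-(1 / 2 + y * Complex.I + t * Complex.I)) := by
  set μ := (MeasureTheory.volume : MeasureTheory.Measure ℝ).restrict (Set.Ioc a b) with hμ
  set f : ℝ → ℝ → ℂ := fun u y =>
    rieszKernel X y * (u : ℂ) ^ (-(1 / 2 + y * Complex.I + t * Complex.I)) with hf
  have hmeas : Measurable (Function.uncurry f) := by
    have h1 : Measurable fun p : ℝ × ℝ => rieszKernel X p.2 :=
      (continuous_rieszKernel hX).measurable.comp measurable_snd
    have h2 : Measurable fun p : ℝ × ℝ =>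
        (p.1 : ℂ) ^ (-(1 / 2 + p.2 * Complex.I + t * Complex.I)) := by
      refine Measurable.pow (by fun_prop) (by fun_prop)
    exact h1.mul h2
  have hint : MeasureTheory.Integrable (Function.uncurry f) (μ.prod MeasureTheory.volume) := by
    have hb : MeasureTheory.Integrable (fun p : ℝ × ℝ =>
        8 * (X : ℝ) ^ (1 / 2 : ℝ) * (1 + p.2 ^ 2)⁻¹) (μ.prod MeasureTheory.volume) :=
      MeasureTheory.Integrable.comp_snd
        (integrable_inv_one_add_sq.const_mul (8 * (X : ℝ) ^ (1 / 2 : ℝ))) μ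
    refine hb.mono' hmeas.aestronglyMeasurable ?_
    have hae : ∀ᵐ p ∂(μ.prod (MeasureTheory.volume : MeasureTheory.Measure ℝ)),
        p.1 ∈ Set.Ioc a b := by
      have h1 : ∀ᵐ u ∂μ, u ∈ Set.Ioc a b := MeasureTheory.ae_restrict_mem measurableSet_Ioc
      exact MeasureTheory.Measure.quasiMeasurePreserving_fst.ae h1
    filter_upwards [hae] with p hp
    have hp1 : 1 ≤ p.1 := ha.trans hp.1.le
    simp only [Function.uncurry, hf]
    rw [norm_mul, Complex.norm_cpow_eq_rpow_re_of_pos (by linarith)]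
    refine (mul_le_of_le_one_right (norm_nonneg _) ?_).trans (norm_rieszKernel_le_inv hX p.2)
    exact Real.rpow_le_one_of_one_le_of_nonpos hp1 (by simp)
  have hinner : ∀ y : ℝ, ∫ u, f u y ∂μ = rieszKernel X y *
      ∫ u in a..b, (u : ℂ) ^ (-(1 / 2 + y * Complex.I + t * Complex.I)) := by
    intro y
    rw [intervalIntegral.integral_of_le hab, ← MeasureTheory.integral_const_mul]
  constructor
  · refine hint.integral_prod_right.congr (Filter.Eventually.of_forall fun y => ?_)
    exact hinner y
  · rw [intervalIntegral.integral_of_le hab]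
    have h1 : ∫ u in Set.Ioc a b, rieszSummand X t u =
        ∫ u, (1 / (2 * Real.pi) : ℝ) * ∫ y, f u y ∂MeasureTheory.volume ∂μ :=
      MeasureTheory.setIntegral_congr_fun measurableSet_Ioc fun u hu =>
        rieszSummand_eq_integral hX t (by linarith [hu.1])
    rw [h1, MeasureTheory.integral_const_mul, MeasureTheory.integral_integral_swap hint]
    simp_rw [hinner]

theorem rieszSummand_sub_integral_eq {X : ℕ} (hX : 0 < X) (t : ℝ) (n : ℕ) :
    MeasureTheory.Integrable (fun y : ℝ => rieszKernel X y *
      zetaTerm n (1 / 2 + y * Complex.I + t * Complex.I)) ∧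
    rieszSummand X t (n + 1) - ∫ u in (n + 1 : ℝ)..(n + 2 : ℝ), rieszSummand X t u =
      (1 / (2 * Real.pi) : ℝ) *
        ∫ y : ℝ, rieszKernel X y * zetaTerm n (1 / 2 + y * Complex.I + t * Complex.I) := by
  have hn : (1 : ℝ) ≤ n + 1 := by linarith [(Nat.cast_nonneg n : (0 : ℝ) ≤ n)]
  obtain ⟨h1, h2⟩ := integral_rieszSummand_eq hX t hn (by linarith : (n + 1 : ℝ) ≤ n + 2)
  have h3 := integrable_rieszKernel_mul hX t hn
  simp_rw [zetaTerm, mul_sub]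
  refine ⟨h3.sub h1, ?_⟩
  rw [MeasureTheory.integral_sub h3 h1, mul_sub, ← h2, ← rieszSummand_eq_integral hX t (by linarith)]

theorem half_line_ne_one (y t : ℝ) : (1 / 2 + (y : ℂ) * Complex.I + t * Complex.I) ≠ 1 := by
  intro h
  have := congrArg Complex.re h
  norm_num at this

theorem half_line_re (y t : ℝ) : (1 / 2 + (y : ℂ) * Complex.I + t * Complex.I).re = 1 / 2 := by
  norm_num

theorem norm_half_line_le (y t : ℝ) :
    ‖(1 / 2 + (y : ℂ) * Complex.I + t * Complex.I)‖ ≤ (1 + |t|) * (1 + |y|) := by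
  have h1 := norm_add₃_le (a := (1 / 2 : ℂ)) (b := (y : ℂ) * Complex.I) (c := (t : ℂ) * Complex.I)
  rw [norm_mul, norm_mul, Complex.norm_I, Complex.norm_real, Complex.norm_real, mul_one, mul_one,
    Real.norm_eq_abs, Real.norm_eq_abs] at h1
  have h2 : ‖(1 / 2 : ℂ)‖ = 1 / 2 := by norm_num
  rw [h2] at h1
  nlinarith [mul_nonneg (abs_nonneg t) (abs_nonneg y)]

/-- The difference between the weighted sum and the weighted integral, expressed through
the zeta function on the critical line. -/
theorem sum_rieszSummand_sub_integral_eq {X : ℕ} (hX : 0 < X) (t : ℝ) :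
    ∑ n ∈ Finset.range X,
        (rieszSummand X t (n + 1) - ∫ u in (n + 1 : ℝ)..(n + 2 : ℝ), rieszSummand X t u) =
      (1 / (2 * Real.pi) : ℝ) *
        ∫ y : ℝ, rieszKernel X y * riemannZeta₀ (1 / 2 + y * Complex.I + t * Complex.I) := by
  have hX' : (0 : ℝ) < X := by exact_mod_cast hX
  set d : ℕ → ℂ := fun n =>
    rieszSummand X t (n + 1) - ∫ u in (n + 1 : ℝ)..(n + 2 : ℝ), rieszSummand X t u with hd
  have hvanish : ∀ u : ℝ, (X : ℝ) ≤ u → rieszSummand X t u = 0 := by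
    intro u hu
    rw [rieszSummand, rieszWeight_of_one_le ((one_le_div hX').mpr hu)]
    simp
  -- The weight vanishes from X onwards, so the infinite Euler–Maclaurin series reduces to its first
  -- X terms.
  have hd0 : ∀ n ∉ Finset.range X, d n = 0 := by
    intro n hn
    rw [Finset.mem_range, not_lt] at hn
    have hn' : (X : ℝ) ≤ n := by exact_mod_cast hn
    simp only [hd]
    rw [hvanish _ (by linarith), intervalIntegral.integral_congr (g := fun _ => 0)]
    · simp
    · intro u hu
      rw [Set.uIcc_of_le (by linarith)] at hu
      exact hvanish u (by linarith [hu.1])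
  have hsum : HasSum d (∑ n ∈ Finset.range X, d n) := hasSum_sum_of_ne_finset_zero hd0
  set c : ℝ := ∑' n : ℕ, (n + 1 : ℝ) ^ (-(1 / 2 : ℝ) - 1) with hc
  have hsm := summable_add_one_rpow (σ := 1 / 2) (by norm_num)
  have hlim : Filter.Tendsto (fun M : ℕ => ∫ y : ℝ, ∑ n ∈ Finset.range M, rieszKernel X y *
      zetaTerm n (1 / 2 + y * Complex.I + t * Complex.I)) Filter.atTop
      (nhds (∫ y : ℝ, rieszKernel X y *
        riemannZeta₀ (1 / 2 + y * Complex.I + t * Complex.I))) := by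
    -- The partial sums of the zeta series grow at most like (1+|t|)(1+|y|). The factor 1+|y|
    -- cancels against the kernel, leaving a multiple of (1+y²)^{-1} as the dominating function.
    refine MeasureTheory.tendsto_integral_of_dominated_convergence
      (fun y => (8 * (X : ℝ) ^ (1 / 2 : ℝ) * (1 + |t|) * c) * (1 + y ^ 2)⁻¹) ?_
      (integrable_inv_one_add_sq.const_mul _) ?_ ?_
    · intro M
      exact (MeasureTheory.integrable_finsetSum _
        fun n _ => (rieszSummand_sub_integral_eq hX t n).1).aestronglyMeasurable
    · intro M
      refine Filter.Eventually.of_forall fun y => ?_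
      set s : ℂ := 1 / 2 + y * Complex.I + t * Complex.I with hs
      rw [← Finset.mul_sum, norm_mul]
      have h1 : ‖∑ n ∈ Finset.range M, zetaTerm n s‖ ≤ (1 + |t|) * (1 + |y|) * c := by
        refine (norm_sum_le _ _).trans ?_
        calc ∑ n ∈ Finset.range M, ‖zetaTerm n s‖
            ≤ ∑ n ∈ Finset.range M, ‖s‖ * (n + 1 : ℝ) ^ (-(1 / 2 : ℝ) - 1) := by
              refine Finset.sum_le_sum fun n _ => ?_
              have h := norm_zetaTerm_le n (s := s) (by rw [hs, half_line_re]; norm_num)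
              rwa [hs, half_line_re, ← hs] at h
          _ = ‖s‖ * ∑ n ∈ Finset.range M, (n + 1 : ℝ) ^ (-(1 / 2 : ℝ) - 1) := by
              rw [Finset.mul_sum]
          _ ≤ (1 + |t|) * (1 + |y|) * c := by
              refine mul_le_mul (norm_half_line_le y t) ?_
                (Finset.sum_nonneg fun n _ => by positivity) (by positivity)
              exact hsm.sum_le_tsum _ fun n _ => by positivity
      have hc0 : 0 ≤ c := tsum_nonneg fun n => by positivity
      calc _ ≤ (8 * (X : ℝ) ^ (1 / 2 : ℝ) * ((1 + |y|)⁻¹ * (1 + y ^ 2)⁻¹)) *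
            ((1 + |t|) * (1 + |y|) * c) := by
            gcongr
            exact norm_rieszKernel_le hX y
        _ = _ := by
          have : 1 + |y| ≠ 0 := by positivity
          field_simp
    · refine Filter.Eventually.of_forall fun y => ?_
      have h := (hasSum_zetaTerm (s := 1 / 2 + y * Complex.I + t * Complex.I)
        (by rw [half_line_re]; norm_num) (half_line_ne_one y t)).tendsto_sum_nat
      have h2 := h.const_mul (rieszKernel X y)
      simpa only [Finset.mul_sum] using h2
  have hpartial : ∀ M : ℕ, ∑ n ∈ Finset.range M, d n = (1 / (2 * Real.pi) : ℝ) *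
      ∫ y : ℝ, ∑ n ∈ Finset.range M, rieszKernel X y *
        zetaTerm n (1 / 2 + y * Complex.I + t * Complex.I) := by
    intro M
    rw [MeasureTheory.integral_finsetSum _
      fun n _ => (rieszSummand_sub_integral_eq hX t n).1, Finset.mul_sum]
    exact Finset.sum_congr rfl fun n _ => (rieszSummand_sub_integral_eq hX t n).2
  have h1 := hsum.tendsto_sum_nat
  simp_rw [hpartial] at h1
  rw [← hpartial] at h1
  exact tendsto_nhds_unique h1 (hlim.const_mul _)

theorem norm_integral_cpow_le {X : ℝ} (hX : 1 ≤ X) (t : ℝ) (j : ℕ) :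
    ‖∫ u in (1 : ℝ)..X, (u : ℂ) ^ ((j : ℂ) - t * Complex.I)‖ ≤ 4 * X ^ (j + 1) / (1 + |t|) := by
  have hre : ((j : ℂ) - t * Complex.I).re = j := by simp
  have hj : (0 : ℝ) ≤ j := Nat.cast_nonneg j
  rw [integral_cpow (Or.inl (by rw [hre]; linarith)), norm_div]
  have hden : (1 + |t|) / 2 ≤ ‖(j : ℂ) - t * Complex.I + 1‖ := by
    have h1 := Complex.abs_re_le_norm ((j : ℂ) - t * Complex.I + 1)
    have h2 := Complex.abs_im_le_norm ((j : ℂ) - t * Complex.I + 1)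
    have e1 : ((j : ℂ) - t * Complex.I + 1).re = j + 1 := by simp
    have e2 : ((j : ℂ) - t * Complex.I + 1).im = -t := by simp
    rw [e1, abs_of_pos (by linarith)] at h1
    rw [e2, abs_neg] at h2
    linarith
  have hnum : ‖(X : ℂ) ^ ((j : ℂ) - t * Complex.I + 1) -
      ((1 : ℝ) : ℂ) ^ ((j : ℂ) - t * Complex.I + 1)‖ ≤ 2 * X ^ (j + 1) := by
    refine (norm_sub_le _ _).trans ?_
    rw [Complex.ofReal_one, Complex.one_cpow, norm_one,
      Complex.norm_cpow_eq_rpow_re_of_pos (by linarith)]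
    have e1 : ((j : ℂ) - t * Complex.I + 1).re = ((j + 1 : ℕ) : ℝ) := by simp
    rw [e1, Real.rpow_natCast]
    linarith [one_le_pow₀ hX (n := j + 1)]
  calc _ ≤ (2 * X ^ (j + 1)) / ((1 + |t|) / 2) := by gcongr
    _ = _ := by
      field_simp
      norm_num

/-- Expand (1 - u/X)². The three powers contribute 4X, 8X and 4X, each over 1 + |t|. -/
theorem norm_integral_rieszSummand_le {X : ℕ} (hX : 0 < X) (t : ℝ) :
    ‖∫ u in (1 : ℝ)..X, rieszSummand X t u‖ ≤ 16 * X / (1 + |t|) := by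
  have hX' : (0 : ℝ) < X := by exact_mod_cast hX
  have hX1 : (1 : ℝ) ≤ X := by exact_mod_cast hX
  set F : ℕ → ℝ → ℂ := fun j u => (u : ℂ) ^ ((j : ℂ) - t * Complex.I) with hF
  have hFi : ∀ j, IntervalIntegrable (F j) MeasureTheory.volume 1 X := by
    intro j
    apply ContinuousOn.intervalIntegrable
    intro u hu
    rw [Set.uIcc_of_le hX1] at hu
    exact (Complex.continuousAt_ofReal_cpow_const _ _
      (Or.inr (by linarith [hu.1]))).continuousWithinAt
  have hexp : ∫ u in (1 : ℝ)..X, rieszSummand X t u =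
      ∫ u in (1 : ℝ)..X, (F 0 u - (2 / X : ℂ) * F 1 u + (1 / X ^ 2 : ℂ) * F 2 u) := by
    refine intervalIntegral.integral_congr fun u hu => ?_
    rw [Set.uIcc_of_le hX1] at hu
    have hu0 : (u : ℂ) ≠ 0 := by
      rw [Complex.ofReal_ne_zero]
      linarith [hu.1]
    have hX0 : (X : ℂ) ≠ 0 := by exact_mod_cast hX.ne'
    simp only [hF]
    rw [rieszSummand, rieszWeight_of_le_one ((div_le_one hX').mpr hu.2)]
    simp only [sub_eq_add_neg ((_ : ℕ) : ℂ), Complex.cpow_add _ _ hu0, Complex.cpow_natCast]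
    push_cast
    field_simp
    ring
  rw [hexp, intervalIntegral.integral_add ((hFi 0).sub ((hFi 1).const_mul _))
    ((hFi 2).const_mul _), intervalIntegral.integral_sub (hFi 0) ((hFi 1).const_mul _),
    intervalIntegral.integral_const_mul, intervalIntegral.integral_const_mul]
  have b0 := norm_integral_cpow_le hX1 t 0
  have b1 := norm_integral_cpow_le hX1 t 1
  have b2 := norm_integral_cpow_le hX1 t 2
  have n1 : ‖(2 / X : ℂ)‖ = 2 / X := by simp
  have n2 : ‖(1 / X ^ 2 : ℂ)‖ = 1 / (X : ℝ) ^ 2 := by simp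
  calc _ ≤ ‖∫ u in (1 : ℝ)..X, F 0 u‖ + ‖(2 / X : ℂ)‖ * ‖∫ u in (1 : ℝ)..X, F 1 u‖ +
        ‖(1 / X ^ 2 : ℂ)‖ * ‖∫ u in (1 : ℝ)..X, F 2 u‖ := by
        rw [← norm_mul, ← norm_mul]
        exact (norm_add_le _ _).trans (add_le_add_left (norm_sub_le _ _) _)
    _ ≤ 4 * (X : ℝ) ^ (0 + 1) / (1 + |t|) + 2 / X * (4 * (X : ℝ) ^ (1 + 1) / (1 + |t|)) +
        1 / (X : ℝ) ^ 2 * (4 * (X : ℝ) ^ (2 + 1) / (1 + |t|)) := by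
        rw [n1, n2]
        gcongr
    _ = _ := by
        field_simp
        ring

theorem sum_integral_rieszSummand {X : ℕ} (hX : 0 < X) (t : ℝ) :
    ∑ n ∈ Finset.range X, ∫ u in (n + 1 : ℝ)..(n + 2 : ℝ), rieszSummand X t u =
      ∫ u in (1 : ℝ)..X, rieszSummand X t u := by
  have hX' : (0 : ℝ) < X := by exact_mod_cast hX
  have hX1 : (1 : ℝ) ≤ X := by exact_mod_cast hX
  have hint : ∀ a b : ℝ, 1 ≤ a → a ≤ b →
      IntervalIntegrable (rieszSummand X t) MeasureTheory.volume a b := by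
    intro a b ha hab
    apply ContinuousOn.intervalIntegrable
    intro u hu
    rw [Set.uIcc_of_le hab] at hu
    have h1 : ContinuousAt (fun u : ℝ => (rieszWeight (u / X) : ℂ)) u :=
      (Complex.continuous_ofReal.comp (continuous_rieszWeight.comp
        (continuous_id.div_const _))).continuousAt
    exact (h1.mul (Complex.continuousAt_ofReal_cpow_const _ _
      (Or.inr (by linarith [hu.1])))).continuousWithinAt
  have hadj := intervalIntegral.sum_integral_adjacent_intervals (n := X)
    (f := rieszSummand X t) (μ := MeasureTheory.volume) (a := fun n : ℕ => (n + 1 : ℝ))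
    fun n _ => by
      push_cast
      exact hint _ _ (by linarith [(Nat.cast_nonneg n : (0 : ℝ) ≤ n)]) (by linarith)
  have hcast : ∀ n : ℕ, (((n + 1 : ℕ) : ℝ) + 1) = n + 2 := fun n => by
    push_cast
    ring
  simp only [hcast, Nat.cast_zero, zero_add] at hadj
  rw [hadj, ← intervalIntegral.integral_add_adjacent_intervals (hint 1 X le_rfl hX1)
    (hint X (X + 1) hX1 (by linarith))]
  have hzero : ∫ u in (X : ℝ)..(X + 1 : ℝ), rieszSummand X t u = 0 := by
    rw [intervalIntegral.integral_congr (g := fun _ => 0)]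
    · simp
    · intro u hu
      rw [Set.uIcc_of_le (by linarith)] at hu
      simp only [rieszSummand]
      rw [rieszWeight_of_one_le ((one_le_div hX').mpr hu.1)]
      simp
  rw [hzero, add_zero]

/-- The restriction δ ≤ 1 makes the growth in y at most linear, which the reserved decay of the
kernel can absorb. -/
theorem one_add_abs_add_rpow_le {δ : ℝ} (hδ : 0 ≤ δ) (hδ1 : δ ≤ 1) (y t : ℝ) :
    (1 + |y + t|) ^ δ ≤ (1 + |t|) ^ δ * (1 + |y|) := by
  have h1 : 1 + |y + t| ≤ (1 + |t|) * (1 + |y|) := by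
    nlinarith [abs_add_le y t, mul_nonneg (abs_nonneg t) (abs_nonneg y)]
  calc (1 + |y + t|) ^ δ ≤ ((1 + |t|) * (1 + |y|)) ^ δ := by gcongr
    _ = (1 + |t|) ^ δ * (1 + |y|) ^ δ := Real.mul_rpow (by positivity) (by positivity)
    _ ≤ (1 + |t|) ^ δ * (1 + |y|) := by
      gcongr
      calc (1 + |y|) ^ δ ≤ (1 + |y|) ^ (1 : ℝ) :=
            Real.rpow_le_rpow_of_exponent_le (by linarith [abs_nonneg y]) hδ1
        _ = _ := Real.rpow_one _

/-- A bound for `ζ` on the critical line yields a bound for smoothly weighted Dirichlet sums. -/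
theorem norm_sum_rieszSummand_le {B δ : ℝ} (hδ : 0 ≤ δ) (hδ1 : δ ≤ 1) (hB0 : 0 ≤ B)
    (hB : ∀ v : ℝ, ‖riemannZeta₀ (1 / 2 + v * Complex.I)‖ ≤ B * (1 + |v|) ^ δ) {X : ℕ}
    (hX : 0 < X) (t : ℝ) :
    ‖∑ n ∈ Finset.range X, rieszSummand X t (n + 1)‖ ≤
      16 * X / (1 + |t|) + 4 * B * (X : ℝ) ^ (1 / 2 : ℝ) * (1 + |t|) ^ δ := by
  have h := sum_rieszSummand_sub_integral_eq hX t
  rw [Finset.sum_sub_distrib, sum_integral_rieszSummand hX, sub_eq_iff_eq_add'] at h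
  rw [h]
  refine (norm_add_le _ _).trans (add_le_add (norm_integral_rieszSummand_le hX t) ?_)
  rw [norm_mul, Complex.norm_real, Real.norm_of_nonneg (by positivity)]
  have hbound : ‖∫ y : ℝ, rieszKernel X y *
      riemannZeta₀ (1 / 2 + y * Complex.I + t * Complex.I)‖ ≤
      ∫ y : ℝ, (8 * B * (X : ℝ) ^ (1 / 2 : ℝ) * (1 + |t|) ^ δ) * (1 + y ^ 2)⁻¹ := by
    refine MeasureTheory.norm_integral_le_of_norm_le (integrable_inv_one_add_sq.const_mul _)
      (Filter.Eventually.of_forall fun y => ?_)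
    have hz : ‖riemannZeta₀ (1 / 2 + y * Complex.I + t * Complex.I)‖ ≤
        B * ((1 + |t|) ^ δ * (1 + |y|)) := by
      have h1 := hB (y + t)
      rw [Complex.ofReal_add, add_mul, ← add_assoc] at h1
      refine h1.trans ?_
      gcongr
      exact one_add_abs_add_rpow_le hδ hδ1 y t
    rw [norm_mul]
    calc _ ≤ (8 * (X : ℝ) ^ (1 / 2 : ℝ) * ((1 + |y|)⁻¹ * (1 + y ^ 2)⁻¹)) *
          (B * ((1 + |t|) ^ δ * (1 + |y|))) := by
          gcongr
          exact norm_rieszKernel_le hX y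
      _ = _ := by
          have : 1 + |y| ≠ 0 := by positivity
          field_simp
  rw [MeasureTheory.integral_const_mul, integral_univ_inv_one_add_sq] at hbound
  calc _ ≤ 1 / (2 * Real.pi) *
        (8 * B * (X : ℝ) ^ (1 / 2 : ℝ) * (1 + |t|) ^ δ * Real.pi) := by gcongr
    _ = _ := by
      field_simp
      ring

theorem realDirichletPoly_rieszWeight (X : ℕ) (t : ℝ) :
    realDirichletPoly X (fun n => rieszWeight (n / X)) (t * Complex.I) =
      ∑ n ∈ Finset.range X, rieszSummand X t (n + 1) := by
  have h : Finset.Icc 1 X = Finset.Ico 1 (X + 1) := by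
    ext n
    simp
  rw [realDirichletPoly, dirichletPoly, h, Finset.sum_Ico_eq_sum_range, Nat.add_sub_cancel]
  refine Finset.sum_congr rfl fun n _ => ?_
  rw [rieszSummand]
  push_cast
  rw [add_comm (1 : ℝ), add_comm (1 : ℂ)]

/-! ### Part (ii) under the Lindelöf Hypothesis. -/

/-- Large positive ordinates come from the hypothesis, large negative ones by conjugation, and the
rest by compactness. The polar part 1/(s-1) has modulus at most 2 on the critical line. -/
theorem LindelofHypothesis.exists_bound (hL : LindelofHypothesis) {δ : ℝ} (hδ : 0 < δ) :
    ∃ B : ℝ, 0 ≤ B ∧ ∀ v : ℝ, ‖riemannZeta₀ (1 / 2 + v * Complex.I)‖ ≤ B * (1 + |v|) ^ δ := by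
  obtain ⟨c, hc⟩ := (hL δ hδ).bound
  obtain ⟨t₀, ht₀⟩ := Filter.eventually_atTop.mp hc
  set t₁ := max t₀ 1 with ht₁
  have hcont : Continuous fun v : ℝ => riemannZeta₀ (1 / 2 + v * Complex.I) :=
    differentiable_riemannZeta₀.continuous.comp (by fun_prop)
  obtain ⟨K, hK⟩ := (isCompact_Icc (a := -t₁) (b := t₁)).exists_bound_of_continuousOn
    hcont.continuousOn
  have hne : ∀ v : ℝ, (1 / 2 + (v : ℂ) * Complex.I) ≠ 1 := by
    intro v h
    have := congrArg Complex.re h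
    norm_num at this
  have hinv : ∀ v : ℝ, ‖((1 / 2 + (v : ℂ) * Complex.I) - 1)⁻¹‖ ≤ 2 := by
    intro v
    have h1 := Complex.abs_re_le_norm ((1 / 2 + (v : ℂ) * Complex.I) - 1)
    have e1 : ((1 / 2 + (v : ℂ) * Complex.I) - 1).re = -(1 / 2) := by norm_num
    rw [e1] at h1
    norm_num at h1
    rw [norm_inv]
    refine inv_le_of_inv_le₀ (by norm_num) ?_
    linarith
  have hζ : ∀ v : ℝ, t₁ ≤ v → ‖riemannZeta (1 / 2 + v * Complex.I)‖ ≤ |c| * (1 + |v|) ^ δ := by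
    intro v hv
    have hv1 : 1 ≤ v := (le_max_right _ _).trans hv
    refine (ht₀ v ((le_max_left _ _).trans hv)).trans ?_
    rw [Real.norm_of_nonneg (by positivity)]
    have h1 : v ^ δ ≤ (1 + |v|) ^ δ := by
      gcongr
      linarith [le_abs_self v]
    calc c * v ^ δ ≤ |c| * v ^ δ := by
          gcongr
          exact le_abs_self c
      _ ≤ _ := by gcongr
  have hζ' : ∀ v : ℝ, t₁ ≤ |v| → ‖riemannZeta (1 / 2 + v * Complex.I)‖ ≤ |c| * (1 + |v|) ^ δ := by
    intro v hv
    rcases abs_choice v with h | h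
    · rw [h] at hv
      exact hζ v hv
    · rw [h] at hv
      have h1 := hζ (-v) hv
      rw [abs_neg] at h1
      have h2 : (1 / 2 + ((-v : ℝ) : ℂ) * Complex.I) =
          (starRingEnd ℂ) (1 / 2 + (v : ℂ) * Complex.I) := by
        simp [map_ofNat]
      rwa [h2, riemannZeta_conj, Complex.norm_conj] at h1
  refine ⟨|c| + 2 + |K|, by positivity, fun v => ?_⟩
  have hone : 1 ≤ (1 + |v|) ^ δ := Real.one_le_rpow (by linarith [abs_nonneg v]) hδ.le
  rcases le_total |v| t₁ with hv | hv
  · have h1 := hK v (abs_le.mp hv)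
    calc _ ≤ |K| * 1 := by
          rw [mul_one]
          exact h1.trans (le_abs_self K)
      _ ≤ _ := by
        gcongr
        linarith [abs_nonneg c]
  · have h1 := hζ' v hv
    have h2 : riemannZeta₀ (1 / 2 + v * Complex.I) = riemannZeta (1 / 2 + v * Complex.I) -
        ((1 / 2 + (v : ℂ) * Complex.I) - 1)⁻¹ := by
      rw [riemannZeta_eq_inv_sub_add (hne v)]
      ring
    rw [h2]
    refine (norm_sub_le _ _).trans ?_
    have h3 : 0 ≤ |K| * (1 + |v|) ^ δ := by positivity
    linarith [hinv v]

theorem norm_dirichletPoly_le {T : ℝ} {S : Finset ℕ} {ε : ℕ → ℂ} (hS : IsAdmissible T S ε) (t : ℝ) :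
    ‖dirichletPoly S ε (t * Complex.I)‖ ≤ S.card := by
  rw [dirichletPoly_eq_expSum hS.pos, expSum]
  refine (norm_sum_le _ _).trans ?_
  have h : (S.card : ℝ) = ∑ _m ∈ S, (1 : ℝ) := by simp
  rw [h]
  refine Finset.sum_le_sum fun m hm => ?_
  rw [norm_mul, ← Complex.ofReal_neg, Complex.norm_exp_ofReal_mul_I, mul_one]
  exact hS.norm_le_one m hm

theorem integral_inv_one_add_sq_le (T : ℝ) : ∫ t in (0 : ℝ)..T, (1 + t ^ 2)⁻¹ ≤ 2 := by
  rw [integral_inv_one_add_sq, Real.arctan_zero, sub_zero]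
  linarith [Real.arctan_lt_pi_div_two T, Real.pi_le_four]

/-- The peak X/(1+t) of Q near t = 0 is square-integrable and is paired with |M| ≤ R, giving X²R².
The remainder of size X^{1/2}T^δ is uniform and is paired with the mean value of |M|². -/
theorem meanValueI_rieszWeight_le {B δ C : ℝ} (hδ : 0 ≤ δ) (hδ1 : δ ≤ 1) (hB0 : 0 ≤ B)
    (hB : ∀ v : ℝ, ‖riemannZeta₀ (1 / 2 + v * Complex.I)‖ ≤ B * (1 + |v|) ^ δ) {T : ℝ}
    {S : Finset ℕ} {ε : ℕ → ℂ} (hS : IsAdmissible T S ε)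
    (hC : ∫ t in (0 : ℝ)..T, ‖dirichletPoly S ε (t * Complex.I)‖ ^ 2 ≤ C * (S.card * T)) {X : ℕ}
    (hX : 0 < X) :
    meanValueI T (dirichletPoly S ε) (realDirichletPoly X fun n => 4 * rieszWeight (n / X)) ≤
      16384 * ((X : ℝ) ^ 2 * (S.card : ℝ) ^ 2) +
        512 * B ^ 2 * C * ((2 * T) ^ (2 * δ) * (X * S.card * T)) := by
  have hT : 0 < T := by linarith [hS.twenty_le]
  have hfour : ∀ t : ℝ, realDirichletPoly X (fun n => 4 * rieszWeight (n / X)) (t * Complex.I) =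
      4 * realDirichletPoly X (fun n => rieszWeight (n / X)) (t * Complex.I) := by
    intro t
    rw [realDirichletPoly, realDirichletPoly, dirichletPoly, dirichletPoly, Finset.mul_sum]
    refine Finset.sum_congr rfl fun n _ => ?_
    push_cast
    ring
  set A : ℝ → ℂ := fun t => dirichletPoly S ε (t * Complex.I) with hA
  set Q : ℝ → ℂ := fun t => realDirichletPoly X (fun n => rieszWeight (n / X)) (t * Complex.I)
    with hQ
  have hAc : Continuous A := by
    have := continuous_expSum S ε fun n => Real.log n
    exact this.congr fun t => (dirichletPoly_eq_expSum hS.pos ε t).symm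
  have hQc : Continuous Q := by
    have := continuous_expSum (Finset.Icc 1 X) (fun n => ((rieszWeight (n / X) : ℝ) : ℂ))
      fun n => Real.log n
    exact this.congr fun t => (realDirichletPoly_eq_expSum X _ t).symm
  have hX' : (0 : ℝ) ≤ X := Nat.cast_nonneg X
  have hsqrt : ((X : ℝ) ^ (1 / 2 : ℝ)) ^ 2 = X := by
    rw [← Real.rpow_natCast, ← Real.rpow_mul hX']
    norm_num
  have hQle : ∀ t ∈ Set.Icc (0 : ℝ) T, ‖Q t‖ ^ 2 ≤
      512 * (X : ℝ) ^ 2 * (1 + t ^ 2)⁻¹ + 32 * B ^ 2 * X * (2 * T) ^ (2 * δ) := by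
    intro t ht
    have h1 := norm_sum_rieszSummand_le hδ hδ1 hB0 hB hX t
    rw [← realDirichletPoly_rieszWeight, abs_of_nonneg ht.1] at h1
    have ht1 : 0 < 1 + t := by linarith [ht.1]
    have h2 : ‖Q t‖ ^ 2 ≤ 2 * (16 * X / (1 + t)) ^ 2 +
        2 * (4 * B * (X : ℝ) ^ (1 / 2 : ℝ) * (1 + t) ^ δ) ^ 2 := by
      refine (pow_le_pow_left₀ (norm_nonneg _) h1 2).trans ?_
      nlinarith [sq_nonneg (16 * X / (1 + t) - 4 * B * (X : ℝ) ^ (1 / 2 : ℝ) * (1 + t) ^ δ)]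
    have h3 : (16 * X / (1 + t)) ^ 2 ≤ 256 * (X : ℝ) ^ 2 * (1 + t ^ 2)⁻¹ := by
      rw [div_pow, div_eq_mul_inv]
      have h4 : ((1 + t) ^ 2)⁻¹ ≤ (1 + t ^ 2)⁻¹ :=
        inv_anti₀ (by positivity) (by nlinarith [ht.1])
      calc _ ≤ (16 * (X : ℝ)) ^ 2 * (1 + t ^ 2)⁻¹ := by gcongr
        _ = _ := by ring
    have h5 : ((1 + t) ^ δ) ^ 2 ≤ (2 * T) ^ (2 * δ) := by
      rw [← Real.rpow_natCast, ← Real.rpow_mul ht1.le, mul_comm δ]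
      push_cast
      refine Real.rpow_le_rpow ht1.le ?_ (by linarith)
      linarith [ht.2, hS.twenty_le]
    have h6 : (4 * B * (X : ℝ) ^ (1 / 2 : ℝ) * (1 + t) ^ δ) ^ 2 ≤
        16 * B ^ 2 * X * (2 * T) ^ (2 * δ) := by
      calc _ = 16 * B ^ 2 * ((X : ℝ) ^ (1 / 2 : ℝ)) ^ 2 * ((1 + t) ^ δ) ^ 2 := by ring
        _ ≤ _ := by
          rw [hsqrt]
          gcongr
    linarith
  have hmono : ∫ t in (0 : ℝ)..T, ‖A t * (4 * Q t)‖ ^ 2 ≤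
      ∫ t in (0 : ℝ)..T, (8192 * ((X : ℝ) ^ 2 * (S.card : ℝ) ^ 2) * (1 + t ^ 2)⁻¹ +
        512 * B ^ 2 * X * (2 * T) ^ (2 * δ) * ‖A t‖ ^ 2) := by
    have hinv : Continuous fun t : ℝ => (1 + t ^ 2)⁻¹ :=
      Continuous.inv₀ (by fun_prop) fun t => by positivity
    refine intervalIntegral.integral_mono_on hT.le
      (by apply Continuous.intervalIntegrable; fun_prop)
      (by apply Continuous.intervalIntegrable; fun_prop) fun t ht => ?_
    rw [norm_mul, norm_mul]
    have h4 : ‖(4 : ℂ)‖ = 4 := by norm_num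
    have hAle : ‖A t‖ ^ 2 ≤ (S.card : ℝ) ^ 2 :=
      pow_le_pow_left₀ (norm_nonneg _) (norm_dirichletPoly_le hS t) 2
    calc (‖A t‖ * (‖(4 : ℂ)‖ * ‖Q t‖)) ^ 2 = 16 * (‖A t‖ ^ 2 * ‖Q t‖ ^ 2) := by
          rw [h4]
          ring
      _ ≤ 16 * (‖A t‖ ^ 2 * (512 * (X : ℝ) ^ 2 * (1 + t ^ 2)⁻¹ +
          32 * B ^ 2 * X * (2 * T) ^ (2 * δ))) := by
          gcongr
          exact hQle t ht
      _ = 8192 * (X : ℝ) ^ 2 * (1 + t ^ 2)⁻¹ * ‖A t‖ ^ 2 +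
          512 * B ^ 2 * X * (2 * T) ^ (2 * δ) * ‖A t‖ ^ 2 := by ring
      _ ≤ 8192 * (X : ℝ) ^ 2 * (1 + t ^ 2)⁻¹ * (S.card : ℝ) ^ 2 +
          512 * B ^ 2 * X * (2 * T) ^ (2 * δ) * ‖A t‖ ^ 2 := by gcongr
      _ = _ := by ring
  have hinv : Continuous fun t : ℝ => (1 + t ^ 2)⁻¹ :=
    Continuous.inv₀ (by fun_prop) fun t => by positivity
  rw [intervalIntegral.integral_add (by apply Continuous.intervalIntegrable; fun_prop)
    (by apply Continuous.intervalIntegrable; fun_prop), intervalIntegral.integral_const_mul,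
    intervalIntegral.integral_const_mul] at hmono
  unfold meanValueI
  simp_rw [hfour]
  refine hmono.trans ?_
  calc _ ≤ 8192 * ((X : ℝ) ^ 2 * (S.card : ℝ) ^ 2) * 2 +
        512 * B ^ 2 * X * (2 * T) ^ (2 * δ) * (C * (S.card * T)) := by
        gcongr
        exact integral_inv_one_add_sq_le T
    _ = _ := by ring

theorem exists_meanValueI_le_of_lindelof (hL : LindelofHypothesis) {η : ℝ} (hη : 0 < η) :
    ∃ C : ℝ, 0 < C ∧ ∀ (T : ℝ) (S : Finset ℕ) (ε : ℕ → ℂ) (N : ℕ) (q : ℕ → ℝ),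
      IsAdmissible T S ε → IsUnitWeight N q →
      meanValueI T (dirichletPoly S ε) (realDirichletPoly N q) ≤
        C * ((N : ℝ) ^ 2 * (S.card : ℝ) ^ 2 +
          ((N : ℝ) * T) ^ η * ((N : ℝ) * S.card * T)) := by
  obtain ⟨C₁, hC₁, h₁⟩ := exists_meanValueI_le_closeSumJ
  obtain ⟨C₂, hC₂, h₂⟩ := exists_integral_sq_dirichletPoly_le
  set δ := min (η / 2) 1 with hδ
  have hδ0 : 0 < δ := lt_min (by linarith) one_pos
  have hδ1 : δ ≤ 1 := min_le_right _ _
  have hδη : 2 * δ ≤ η := by linarith [min_le_left (η / 2) 1]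
  obtain ⟨B, hB0, hB⟩ := hL.exists_bound hδ0
  refine ⟨C₁ * (64 * (65536 + 1024 * B ^ 2 * C₂ * 2 ^ η)), by positivity,
    fun T S ε N q hS hq => ?_⟩
  have hT1 : 1 ≤ T := by linarith [hS.twenty_le]
  have hT : 0 < T := by linarith
  have hN1 : (1 : ℝ) ≤ N := by exact_mod_cast hq.pos
  have hX : 0 < 2 * N := Nat.mul_pos two_pos hq.pos
  -- For n ≤ N one has n/(2N) ≤ 1/2, so 4(1 - n/(2N))² ≥ 1 ≥ q_n. Doubling the length keeps the
  -- weight away from its zero.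
  have hcomp : closeSumJ T S N q ≤
      closeSumJ T S (2 * N) fun n => 4 * rieszWeight (n / ((2 * N : ℕ) : ℝ)) := by
    refine closeSumJ_mono hS.pos (by omega) (fun n hn => ⟨(hq.mem n hn).1, ?_⟩)
      (fun n _ => mul_nonneg (by norm_num) (rieszWeight_nonneg _)) T
    refine (hq.mem n hn).2.trans ?_
    have hnN : (n : ℝ) ≤ N := by exact_mod_cast (Finset.mem_Icc.mp hn).2
    have hx : (n : ℝ) / ((2 * N : ℕ) : ℝ) ≤ 1 / 2 := by
      rw [div_le_div_iff₀ (by positivity) two_pos]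
      push_cast
      linarith
    rw [rieszWeight_of_le_one (by linarith)]
    nlinarith
  have hlow := closeSumJ_le_meanValueI hS.one (N := 2 * N)
    (q := fun n => 4 * rieszWeight (n / ((2 * N : ℕ) : ℝ)))
    (fun n _ => mul_nonneg (by norm_num) (rieszWeight_nonneg _)) fun _ _ => rfl
  have hmean := meanValueI_rieszWeight_le hδ0.le hδ1 hB0 hB hS.one (h₂ T S _ hS.one) hX
  have hpow : (2 * T) ^ (2 * δ) ≤ 2 ^ η * ((N : ℝ) * T) ^ η := by
    calc (2 * T) ^ (2 * δ) ≤ (2 * T) ^ η :=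
          Real.rpow_le_rpow_of_exponent_le (by linarith) hδη
      _ = 2 ^ η * T ^ η := Real.mul_rpow (by norm_num) hT.le
      _ ≤ 2 ^ η * ((N : ℝ) * T) ^ η := by
        gcongr
        exact le_mul_of_one_le_left hT.le hN1
  set R : ℝ := (S.card : ℝ) with hR
  have hR0 : 0 ≤ R := by positivity
  have hfin : T * closeSumJ T S N q ≤ 64 * (65536 + 1024 * B ^ 2 * C₂ * 2 ^ η) *
      ((N : ℝ) ^ 2 * R ^ 2 + ((N : ℝ) * T) ^ η * (N * R * T)) := by
    calc T * closeSumJ T S N q ≤ _ := mul_le_mul_of_nonneg_left hcomp hT.le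
      _ ≤ _ := hlow.trans (mul_le_mul_of_nonneg_left hmean (by norm_num))
      _ = 64 * (65536 * ((N : ℝ) ^ 2 * R ^ 2) +
          1024 * B ^ 2 * C₂ * ((2 * T) ^ (2 * δ) * (N * R * T))) := by
        push_cast
        ring
      _ ≤ 64 * (65536 * ((N : ℝ) ^ 2 * R ^ 2) +
          1024 * B ^ 2 * C₂ * ((2 ^ η * ((N : ℝ) * T) ^ η) * (N * R * T))) := by gcongr
      _ ≤ _ := by
        have h3 : 0 ≤ 1024 * B ^ 2 * C₂ * 2 ^ η * ((N : ℝ) ^ 2 * R ^ 2) := by positivity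
        have h4 : 0 ≤ ((N : ℝ) * T) ^ η * (N * R * T) := by positivity
        linarith
  refine (h₁ T S ε N q hS hq).trans ?_
  rw [mul_assoc C₁]
  exact mul_le_mul_of_nonneg_left hfin hC₁.le

/-! ### Assembly. -/

theorem theorem4 :
    -- (i)
    ((∃ C : ℝ, 0 < C ∧ ∀ (T : ℝ) (S : Finset ℕ) (ε : ℕ → ℂ) (N : ℕ) (q : ℕ → ℝ),
        IsAdmissible T S ε → IsUnitWeight N q →
        meanValueI T (dirichletPoly S ε) (realDirichletPoly N q) ≤ C * (T * closeSumJ T S N q)) ∧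
      (∃ C : ℝ, 0 < C ∧ ∀ (T : ℝ) (S : Finset ℕ) (ε : ℕ → ℂ) (N : ℕ) (q : ℕ → ℝ),
        IsAdmissible T S ε → IsUnitWeight N q → (∀ m ∈ S, ε m = 1) →
        meanValueI T (dirichletPoly S ε) (realDirichletPoly N q) ≤ C * (T * closeSumJ T S N q) ∧
        T * closeSumJ T S N q ≤ C * meanValueI T (dirichletPoly S ε) (realDirichletPoly N q))) ∧
    -- (ii)
    (LindelofHypothesis → ∀ η : ℝ, 0 < η → ∃ C : ℝ, 0 < C ∧
      ∀ (T : ℝ) (S : Finset ℕ) (ε : ℕ → ℂ) (N : ℕ) (q : ℕ → ℝ),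
        IsAdmissible T S ε → IsUnitWeight N q →
        meanValueI T (dirichletPoly S ε) (realDirichletPoly N q) ≤
          C * ((N : ℝ) ^ 2 * (S.card : ℝ) ^ 2 + ((N : ℝ) * T) ^ η * ((N : ℝ) * S.card * T))) ∧
    -- (iii)
    ((∀ η : ℝ, 0 < η → ∃ C : ℝ, 0 < C ∧
      ∀ (T : ℝ) (S : Finset ℕ) (ε : ℕ → ℂ) (N : ℕ) (q : ℕ → ℝ),
        IsAdmissible T S ε → IsUnitWeight N q →
        meanValueI T (dirichletPoly S ε) (realDirichletPoly N q) ≤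
          C * ((N : ℝ) ^ 2 * (S.card : ℝ) ^ 2 +
            ((N : ℝ) * T) ^ η * ((N : ℝ) * S.card * T +
              (N : ℝ) * (S.card : ℝ) ^ (7 / 4 : ℝ) * T ^ (3 / 4 : ℝ)))) ∧
      (∀ η : ℝ, 0 < η → ∃ C : ℝ, 0 < C ∧
        ∀ (T : ℝ) (S : Finset ℕ) (ε : ℕ → ℂ) (N : ℕ) (q : ℕ → ℝ),
          IsAdmissible T S ε → IsUnitWeight N q →
          (T ^ (2 / 3 : ℝ) ≤ (N : ℝ) ∨ (S.card : ℝ) ≤ T ^ (1 / 3 : ℝ)) →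
          meanValueI T (dirichletPoly S ε) (realDirichletPoly N q) ≤
            C * ((N : ℝ) ^ 2 * (S.card : ℝ) ^ 2 +
              ((N : ℝ) * T) ^ η * ((N : ℝ) * S.card * T)))) ∧
    -- (iv)
    (∀ k : ℕ, 0 < k → ∃ C : ℝ, 0 < C ∧
      ∀ (T : ℝ) (S : Finset ℕ) (ε : ℕ → ℂ) (N : ℕ), IsAdmissible T S ε → 0 < N →
        meanValueI T (dirichletPoly S ε) (primePowerPoly N k) ≤
          C * ((N : ℝ) ^ 2 * (S.card : ℝ) ^ 2 + (S.card : ℝ) ^ 2 * T +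
            (N : ℝ) * S.card * T)) := by
  refine ⟨⟨exists_meanValueI_le_closeSumJ, ?_⟩,
    fun hL η hη => exists_meanValueI_le_of_lindelof hL hη,
    ⟨fun η hη => exists_meanValueI_le_unconditional hη,
      fun η hη => exists_meanValueI_le_of_range hη⟩,
    fun k hk => exists_meanValueI_primePowerPoly_le hk⟩
  obtain ⟨C, hC, h⟩ := exists_meanValueI_le_closeSumJ
  -- A single constant serves both directions: C for the upper bound and 64 for the lower one.
  refine ⟨C + 64, by positivity, fun T S ε N q hS hq hε => ⟨?_, ?_⟩⟩
  · refine (h T S ε N q hS hq).trans ?_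
    have hT : 0 < T := by linarith [hS.twenty_le]
    have hJ : 0 ≤ closeSumJ T S N q := by
      rw [closeSumJ_eq_closePairSum hS.pos]
      exact closePairSum_nonneg (fun p hp => (hq.mem _ (Finset.mem_product.mp hp).2).1) _ _
    have := mul_nonneg hT.le hJ
    linarith
  · refine (closeSumJ_le_meanValueI hS (fun n hn => (hq.mem n hn).1) hε).trans ?_
    have hI : 0 ≤ meanValueI T (dirichletPoly S ε) (realDirichletPoly N q) :=
      intervalIntegral.integral_nonneg (by linarith [hS.twenty_le]) fun t _ => by positivity
    have := mul_nonneg hC.le hI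
    linarith
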